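/- Let $G$ be an $n$-dimensional real Lie group with Lie algebra $\mathfrak g$, exponential map $\exp$ and left Haar measure $m$, and fix $\hbar\in\mathbb R\setminus\{0\}$. Assume that there is an open set $\mathcal O\ni 0$ in $\mathfrak g$ such that $tX\in\mathcal O$ for all $X\in\mathcal O$, $-1\le t\le 1$; $\exp|_{\mathcal O}$ is a diffeomorphism onto an open set $\mathcal U=\exp(\mathcal O)$; $G\setminus\mathcal U$ has measure zero; and, for every $S\subset\mathcal U$ with compact closure in $G$, the set $(\exp|_{\mathcal O})^{-1}(S)$ has compact closure in $\mathfrak g$. Fix such an $\mathcal O$. Let $dX$ be the Lebesgue measure on $\mathfrak g$ given by the value at $e$ of the left-invariant volume form defining $m$, let $dp$ be the dual measure on $\mathfrak g^*$ (so that $g(X)=(2\pi)^{-n}\int_{\mathfrak g^*}\int_{\mathfrak g} g(Y)e^{-i\langle p,Y\rangle}\,dY\,e^{i\langle p,X\rangle}\,dp$), and put $M=G\times\mathfrak g^*$ with the measure $dx=dm(q)\,dp$. Write $V_q(a)=(\exp|_{\mathcal O})^{-1}(q^{-1}a)$ for $a\in q\,\mathcal U$, $s_q(a)=qa^{-1}q$,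 $\phi(z)=\frac{1-e^{-z}}{z}$, $\psi(z)=\frac z2\coth\frac z2$, $$F(X)=\sqrt{|\det\phi(\mathrm{ad}_X)\,\det\mathrm{Ad}_{\exp(X/2)}|},\quad j_q(a)=|\det\psi(\mathrm{ad}_{V_q(a)})|\,\chi_{\mathcal O}(2V_q(a)),\quad J_q(a)=j_q(a)\,\frac{dm(s_q)}{dm}\Big|_a ,$$ where $\frac{dm(s_q)}{dm}$ is the Jacobian of $s_q$ with respect to $m$. Let $\mathcal F(M)$ be the set of functions $f(q,p)=\int_{\mathfrak g}\tilde f(q,X)e^{-\frac i\hbar\langle p,X\rangle}\,dX$, where $\tilde f\in L^2(G\times\mathfrak g,dm\,dX)$ vanishes outside $G\times\mathcal O$ and $\mathsf f(a,b)=\tilde f\bigl(a\exp(\tfrac12V_a(b)),V_a(b)\bigr)F(V_a(b))^{-1}$, defined for $a^{-1}b\in\mathcal U$, extends to a function $\mathsf f\in C_c^\infty(G\times G)$. For such $f$ let $\hat f$ be the operator on $L^2(G,dm)$ with $\hat f\psi(a)=\int_G\mathsf f(a,b)\psi(b)\,dm(b)$. For $x=(q,p)\in M$ let $$\Delta_x\psi(a)=\frac{1}{|\pi\hbar|^n}\sqrt{J_q(a)}\;e^{-\frac{2i}{\hbar}\langle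 p,V_q(a)\rangle}\,\psi(s_q(a)),\qquad a\in q\,\mathcal U ,$$ considered as an operator on $L^2(G,dm)$ with its natural domain $\mathcal D(\Delta_x)=\{\psi\in L^2(G,dm):\Delta_x\psi\in L^2(G,dm)\}$. **Theorem.** For every $f\in\mathcal F(M)$, the operator $\hat f$ is a bounded operator on $L^2(G,dm)$, and: 1. $\hat f=\int_M f(x)\Delta_x\,dx$, as an improper integral: for every square integrable function $\psi$ on $G$, every $a\in G$ and every increasing sequence of compact sets $K_1\subset K_2\subset\cdots$ with union $\mathfrak g^*$, the function $x\mapsto f(x)\Delta_x\psi(a)$ is integrable on each $G\times K_j$ and $$\hat f\psi(a)=\lim_{j\to\infty}\int_{G\times K_j}f(x)\,\Delta_x\psi(a)\,dx .$$ 2. For every $x\in M$, $\hat f$ maps $L^2(G,dm)$ into $\mathcal D(\Delta_x)$, the operator $\Delta_x\hat f$ is bounded and of trace class, and $f(x)=|2\pi\hbar|^n\,\mathrm{Tr}(\Delta_x\hat f)$. Moreover, for every $x=(q,p)\in M$, $\mathcal D(\Delta_x)=\{\psi\in L^2(G,dm):\int_G j_q|\psi|^2\,dm<\infty\}$, this domain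 is dense, and $\Delta_x$ is self-adjoint on it. -/

import Mathlib

open MeasureTheory Filter Topology Set
open scoped Manifold ContDiff ENNReal

noncomputable section

namespace LieGroupQ

/-
Conventions. `G` is a Lie group modelled on a finite-dimensional Euclidean space `E`, and
`n = dim E`. In Mathlib the Lie algebra `TangentSpace 𝓘(ℝ, E) (1 : G)` is by definition the vector
space `E` (via the preferred chart at `1`), so elements of the Lie algebra are elements of `E`, and
elements of its dual are elements of `StrongDual ℝ E`. The Lie bracket enters through `ad`.
-/

section Calculus

variable {E : Type*} [NormedAddCommGroup E] [NormedSpace ℝ E]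

/-- `φ(A)` for `φ(x) = (1 - exp (-x)) / x = ∑ (-1)^k x^k / (k+1)!`. -/
def phiOp (A : E →L[ℝ] E) : E →L[ℝ] E :=
  ∑' k : ℕ, ((-1 : ℝ) ^ k / ((k + 1).factorial : ℝ)) • A ^ k

/-- `λ(A)` for `λ(x) = (2 / x) sinh (x / 2) = ∑ x^(2k) / (4^k (2k+1)!)`. -/
def lambdaOp (A : E →L[ℝ] E) : E →L[ℝ] E :=
  ∑' k : ℕ, (1 / ((4 : ℝ) ^ k * ((2 * k + 1).factorial : ℝ))) • A ^ (2 * k)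

/-- `ψ(A)` for the meromorphic function `ψ(x) = (x / 2) coth (x / 2) = cosh (x / 2) / λ(x)`, which
makes sense whenever `λ(A)` is invertible, i.e. `A` has no eigenvalue at a pole of `ψ`. -/
def psiOp (A : E →L[ℝ] E) : E →L[ℝ] E :=
  ((1 / 2 : ℝ) • (NormedSpace.exp ((1 / 2 : ℝ) • A) + NormedSpace.exp (-((1 / 2 : ℝ) • A)))) *
    Ring.inverse (lambdaOp A)

end Calculus

section LieGroup

variable {E : Type*} [NormedAddCommGroup E] [InnerProductSpace ℝ E] [FiniteDimensional ℝ E]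
  {G : Type*} [TopologicalSpace G] [ChartedSpace E G]
  [Group G]

/-- `ad_X Y = ⁅X, Y⁆`, for the Lie bracket of left-invariant vector fields at `1`. -/
def ad (G : Type*) [TopologicalSpace G] [ChartedSpace E G]
    [Group G] [LieGroup 𝓘(ℝ, E) ∞ G] (X : E) : E →L[ℝ] E :=
  haveI : LieGroup 𝓘(ℝ, E) (minSmoothness ℝ 3) G :=
    LieGroup.of_le (n := ∞) (by rw [minSmoothness_of_isRCLikeNormedField]; exact ENat.LEInfty.out)
  LinearMap.toContinuousLinearMap
    (show E →ₗ[ℝ] E from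
      (LieAlgebra.ad ℝ (GroupLieAlgebra 𝓘(ℝ, E) G) (X : GroupLieAlgebra 𝓘(ℝ, E) G) :
        GroupLieAlgebra 𝓘(ℝ, E) G →ₗ[ℝ] GroupLieAlgebra 𝓘(ℝ, E) G))

/-- `Ad_g`, the derivative at `1` of `h ↦ g h g⁻¹`. -/
def Ad (g : G) : E →L[ℝ] E :=
  mfderiv 𝓘(ℝ, E) 𝓘(ℝ, E) (fun h : G => g * h * g⁻¹) 1

open Classical in
/-- The exponential map: `exp X = γ 1`, where `γ` is the integral curve starting at `1` of the
left-invariant vector field determined by `X`. -/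
def lieExp (G : Type*) [TopologicalSpace G] [ChartedSpace E G]
    [Group G] (X : E) : G :=
  if h : ∃ γ : ℝ → G, γ 0 = 1 ∧
      IsMIntegralCurve (I := 𝓘(ℝ, E)) γ
        (mulInvariantVectorField (I := 𝓘(ℝ, E)) (G := G) (X : GroupLieAlgebra 𝓘(ℝ, E) G))
  then h.choose 1 else 1

/-- A subset of the manifold `G` has measure zero if its image in every smooth chart has Lebesgue
measure zero. -/
def IsMeasureZero (E : Type*) [NormedAddCommGroup E] [InnerProductSpace ℝ E]
    [FiniteDimensional ℝ E] [MeasurableSpace E] [BorelSpace E] {G : Type*} [TopologicalSpace G]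
    [ChartedSpace E G] (A : Set G) : Prop :=
  ∀ e ∈ IsManifold.maximalAtlas 𝓘(ℝ, E) ∞ G, volume (e '' (A ∩ e.source)) = 0

/-- The inverse of `exp` restricted to `O`; it is meaningful on `exp(O)`. -/
def lieLog (O : Set E) (g : G) : E := Function.invFunOn (lieExp G) O g

/-- `G` is weakly exponential with respect to `O`, and `exp⁻¹ : exp(O) → O` maps precompact sets
of `G` to precompact sets of the Lie algebra. -/
structure IsWeaklyExponential [MeasurableSpace E] [BorelSpace E] (G : Type*)
    [TopologicalSpace G] [ChartedSpace E G] [Group G] (O : Set E) : Prop where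
  isOpen : IsOpen O
  zero_mem : (0 : E) ∈ O
  star : ∀ X ∈ O, ∀ t ∈ Icc (-1 : ℝ) 1, t • X ∈ O
  injOn : InjOn (lieExp G) O
  isOpen_image : IsOpen (lieExp G '' O)
  smooth_exp : ContMDiffOn 𝓘(ℝ, E) 𝓘(ℝ, E) ∞ (lieExp G) O
  smooth_log : ContMDiffOn 𝓘(ℝ, E) 𝓘(ℝ, E) ∞ (lieLog (G := G) O) (lieExp G '' O)
  measureZero : IsMeasureZero E (lieExp G '' O)ᶜ
  precompact : ∀ S ⊆ lieExp G '' O, IsCompact (closure S) → IsCompact (closure (lieLog O '' S))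

/-- `V_q(a) = exp⁻¹(q⁻¹ a)`. -/
def V (O : Set E) (q a : G) : E := lieLog O (q⁻¹ * a)

/-- The reflection `s_q(a) = q a⁻¹ q`. -/
def refl (q a : G) : G := q * a⁻¹ * q

/-- The Jacobian at `a` of a smooth map `s : G → G` with respect to a left Haar measure: both
tangent spaces are trivialized by left translations. -/
def haarJacobian (E : Type*) [NormedAddCommGroup E] [InnerProductSpace ℝ E]
    {G : Type*} [TopologicalSpace G]
    [ChartedSpace E G] [Group G] (s : G → G) (a : G) : ℝ :=
  |(show E →L[ℝ] E from
      mfderiv 𝓘(ℝ, E) 𝓘(ℝ, E) (fun h : G => (s a)⁻¹ * s (a * h)) 1).det|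

variable [LieGroup 𝓘(ℝ, E) ∞ G]

/-- `j_q(a) = |det ψ(ad_{V_q(a)})| χ_O(2 V_q(a))`. -/
def jFun (O : Set E) (q a : G) : ℝ :=
  |(psiOp (ad G (V O q a))).det| * O.indicator (fun _ => (1 : ℝ)) ((2 : ℝ) • V O q a)

/-- `J_q(a) = j_q(a) (dm(s_q)/dm)(a)`. -/
def bigJ (O : Set E) (q a : G) : ℝ := jFun O q a * haarJacobian E (refl q) a

/-- `F(X) = sqrt |det φ(ad_X) det Ad_{exp(X/2)}|`. -/
def bigF (G : Type*) [TopologicalSpace G] [ChartedSpace E G]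
    [Group G] [LieGroup 𝓘(ℝ, E) ∞ G] (X : E) : ℝ :=
  Real.sqrt |(phiOp (ad G X)).det * (Ad (E := E) (lieExp G ((1 / 2 : ℝ) • X))).det|

end LieGroup

section Measures

variable {E : Type*} [NormedAddCommGroup E] [InnerProductSpace ℝ E] [FiniteDimensional ℝ E]
  {G : Type*} [TopologicalSpace G] [ChartedSpace E G]
  [Group G]

/-- The density at the identity, in exponential coordinates, of a Haar measure `μ` with respect to
Lebesgue measure on the Lie algebra. -/
def haarDensity (E : Type*) [NormedAddCommGroup E] [InnerProductSpace ℝ E]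
    [FiniteDimensional ℝ E] [MeasurableSpace E] [BorelSpace E] {G : Type*} [TopologicalSpace G]
    [ChartedSpace E G] [Group G] [MeasurableSpace G]
    (μ : Measure G) : ℝ≥0∞ :=
  limUnder (𝓝[>] (0 : ℝ)) fun r =>
    μ (lieExp G '' Metric.ball (0 : E) r) / volume (Metric.ball (0 : E) r)

/-- The measure `dX` on the Lie algebra induced by the value at `1` of the left-invariant volume
form of the Haar measure `μ`. -/
def algMeasure (E : Type*) [NormedAddCommGroup E] [InnerProductSpace ℝ E]
    [FiniteDimensional ℝ E] [MeasurableSpace E] [BorelSpace E] {G : Type*} [TopologicalSpace G]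
    [ChartedSpace E G] [Group G] [MeasurableSpace G]
    (μ : Measure G) : Measure E :=
  haarDensity E μ • volume

/-- The measure `dp` on the dual of the Lie algebra, dual to `dX`: if `dX` is `c` times Lebesgue
measure in the standard coordinates, then `dp` is `c⁻¹` times Lebesgue measure in the dual
coordinates, so that `g(X) = (2π)⁻ⁿ ∫ (∫ g(Y) e^{-i⟨p,Y⟩} dY) e^{i⟨p,X⟩} dp`. -/
def dualMeasure (E : Type*) [NormedAddCommGroup E] [InnerProductSpace ℝ E]
    [FiniteDimensional ℝ E] [MeasurableSpace E] [BorelSpace E] {G : Type*} [TopologicalSpace G]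
    [ChartedSpace E G] [Group G] [MeasurableSpace G]
    (μ : Measure G) : Measure (StrongDual ℝ E) :=
  (haarDensity E μ)⁻¹ • (volume : Measure E).map (InnerProductSpace.toDual ℝ E)

/-- The Liouville measure `dx = dm × dp` on the phase space `M = G × 𝔤*`. -/
def liouville (E : Type*) [NormedAddCommGroup E] [InnerProductSpace ℝ E]
    [FiniteDimensional ℝ E] [MeasurableSpace E] [BorelSpace E] {G : Type*} [TopologicalSpace G]
    [ChartedSpace E G] [Group G] [MeasurableSpace G]
    (μ : Measure G) : Measure (G × StrongDual ℝ E) :=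
  μ.prod (dualMeasure E μ)

variable [LieGroup 𝓘(ℝ, E) ∞ G]

/-- `f` belongs to the space `F(M)` and `k ∈ C_c^∞(G × G)` is the corresponding integral kernel:
`f` is the inverse momentum Fourier transform of a square integrable function `ft` on `G × 𝔤`,
supported over `O`, such that `(a, b) ↦ ft(a exp(V_a(b)/2), V_a(b)) F(V_a(b))⁻¹`, defined for
`a⁻¹ b ∈ exp(O)`, extends to the smooth compactly supported function `k`. -/
def HasIntegralKernel [MeasurableSpace E] [BorelSpace E] [MeasurableSpace G]
    (ħ : ℝ) (O : Set E) (μ : Measure G)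
    (f : G × StrongDual ℝ E → ℂ) (k : G × G → ℂ) : Prop :=
  ContMDiff (𝓘(ℝ, E).prod 𝓘(ℝ, E)) 𝓘(ℝ, ℂ) ∞ k ∧ HasCompactSupport k ∧
  ∃ ft : G × E → ℂ,
    MemLp ft 2 (μ.prod (algMeasure E μ)) ∧
    (∀ q X, X ∉ O → ft (q, X) = 0) ∧
    (∀ a b : G, a⁻¹ * b ∈ lieExp G '' O →
      k (a, b) = ft (a * lieExp G ((1 / 2 : ℝ) • V O a b), V O a b) *
        ((bigF G (V O a b))⁻¹ : ℝ)) ∧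
    ∀ q p, f (q, p) =
      ∫ X, ft (q, X) * Complex.exp (-(Complex.I / ħ) * (p X : ℂ)) ∂(algMeasure E μ)

/-- The value at `a` of the integral operator with kernel `k` applied to `ψ`. -/
def kernelApply {G : Type*} [MeasurableSpace G] (μ : Measure G) (k : G × G → ℂ)
    (ψ : G → ℂ) (a : G) : ℂ :=
  ∫ b, k (a, b) * ψ b ∂μ

/-- The function `Δ_x ψ`, `x = (q, p)`:
`Δ_x ψ(a) = |πħ|⁻ⁿ sqrt(J_q(a)) exp(-(2i/ħ) ⟨p, V_q(a)⟩) ψ(s_q(a))`.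
It is meaningful for `a ∈ q exp(O)`, i.e. off a null set. -/
def quantizerFun (ħ : ℝ) (O : Set E) (x : G × StrongDual ℝ E) (ψ : G → ℂ) (a : G) : ℂ :=
  ((1 / |Real.pi * ħ| ^ Module.finrank ℝ E : ℝ) : ℂ) * (Real.sqrt (bigJ O x.1 a) : ℂ) *
    Complex.exp (-(2 * Complex.I / ħ) * (x.2 (V O x.1 a) : ℂ)) * ψ (refl x.1 a)

theorem quantizerFun_add (ħ : ℝ) (O : Set E) (x : G × StrongDual ℝ E) (ψ χ : G → ℂ) :
    quantizerFun ħ O x (ψ + χ) = quantizerFun ħ O x ψ + quantizerFun ħ O x χ := by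
  funext a
  simp only [quantizerFun, Pi.add_apply]
  ring

theorem quantizerFun_smul (ħ : ℝ) (O : Set E) (x : G × StrongDual ℝ E) (c : ℂ) (ψ : G → ℂ) :
    quantizerFun ħ O x (c • ψ) = c • quantizerFun ħ O x ψ := by
  funext a
  simp only [quantizerFun, Pi.smul_apply, smul_eq_mul]
  ring

end Measures

section Quantizer

variable {E : Type*} [NormedAddCommGroup E] [InnerProductSpace ℝ E] [FiniteDimensional ℝ E]
  {G : Type*} [TopologicalSpace G] [T2Space G] [SecondCountableTopology G]
  [ChartedSpace E G] [Group G] [LieGroup 𝓘(ℝ, E) ∞ G]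
  [MeasurableSpace G] [BorelSpace G]

theorem refl_quasiMeasurePreserving (E : Type*) [NormedAddCommGroup E]
    [InnerProductSpace ℝ E] [FiniteDimensional ℝ E] {G : Type*} [TopologicalSpace G] [T2Space G]
    [SecondCountableTopology G] [ChartedSpace E G] [Group G]
    [LieGroup 𝓘(ℝ, E) ∞ G] [MeasurableSpace G] [BorelSpace G] (μ : Measure G) [μ.IsHaarMeasure]
    (q : G) : Measure.QuasiMeasurePreserving (refl q) μ μ := by
  have : IsTopologicalGroup G := topologicalGroup_of_lieGroup 𝓘(ℝ, E) ∞
  have : ProperSpace E := FiniteDimensional.proper_real E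
  have : LocallyCompactSpace G := ChartedSpace.locallyCompactSpace E G
  exact (quasiMeasurePreserving_mul_right μ q).comp
    ((measurePreserving_mul_left μ q).quasiMeasurePreserving.comp (quasiMeasurePreserving_inv μ))

theorem quantizerFun_congr (ħ : ℝ) (O : Set E) (μ : Measure G) [μ.IsHaarMeasure]
    (x : G × StrongDual ℝ E) {ψ χ : G → ℂ} (h : ψ =ᵐ[μ] χ) :
    quantizerFun ħ O x ψ =ᵐ[μ] quantizerFun ħ O x χ := by
  filter_upwards [(refl_quasiMeasurePreserving E μ x.1).ae h] with a ha
  simp only [quantizerFun, ha]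

/-- The natural domain of `Δ_x`: all `ψ ∈ L²(G)` with `Δ_x ψ ∈ L²(G)`. -/
def quantizerDomain (ħ : ℝ) (O : Set E) (μ : Measure G) [μ.IsHaarMeasure]
    (x : G × StrongDual ℝ E) : Submodule ℂ (Lp ℂ 2 μ) where
  carrier := {ψ | MemLp (quantizerFun ħ O x ψ) 2 μ}
  add_mem' := by
    intro ψ χ hψ hχ
    refine MemLp.ae_eq ?_ (MemLp.add hψ hχ)
    rw [← quantizerFun_add]
    exact (quantizerFun_congr ħ O μ x (Lp.coeFn_add ψ χ)).symm
  zero_mem' := by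
    have h : quantizerFun ħ O x (0 : G → ℂ) = 0 := by
      funext a
      simp [quantizerFun]
    refine MemLp.ae_eq ?_ (MemLp.zero (ε := ℂ) (p := 2) (μ := μ))
    have h2 := (quantizerFun_congr ħ O μ x (Lp.coeFn_zero ℂ 2 μ)).symm
    rw [h] at h2
    exact h2
  smul_mem' := by
    intro c ψ hψ
    refine MemLp.ae_eq ?_ (MemLp.const_smul hψ c)
    rw [← quantizerFun_smul]
    exact (quantizerFun_congr ħ O μ x (Lp.coeFn_smul c ψ)).symm

/-- The quantizer `Δ_x` as an unbounded operator on `L²(G)` with its natural domain. -/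
def quantizer (ħ : ℝ) (O : Set E) (μ : Measure G) [μ.IsHaarMeasure]
    (x : G × StrongDual ℝ E) : Lp ℂ 2 μ →ₗ.[ℂ] Lp ℂ 2 μ where
  domain := quantizerDomain ħ O μ x
  toFun :=
    { toFun := fun ψ => MemLp.toLp (quantizerFun ħ O x (ψ : Lp ℂ 2 μ)) ψ.2
      map_add' := by
        intro ψ χ
        refine Eq.trans ?_ (MemLp.toLp_add (μ := μ) (p := 2) ψ.2 χ.2)
        refine (MemLp.toLp_eq_toLp_iff _ _).2 ?_
        rw [← quantizerFun_add]
        exact quantizerFun_congr ħ O μ x (Lp.coeFn_add (ψ : Lp ℂ 2 μ) (χ : Lp ℂ 2 μ))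
      map_smul' := by
        intro c ψ
        refine Eq.trans ?_ (MemLp.toLp_const_smul (μ := μ) (p := 2) c ψ.2)
        refine (MemLp.toLp_eq_toLp_iff _ _).2 ?_
        rw [← quantizerFun_smul]
        exact quantizerFun_congr ħ O μ x (Lp.coeFn_smul c (ψ : Lp ℂ 2 μ)) }

end Quantizer

section Trace

variable {H : Type*} [NormedAddCommGroup H] [InnerProductSpace ℂ H]

/-- Trace class operators on a Hilbert space: `T = ∑ ⟨u i, ·⟩ v i` with `∑ ‖u i‖ ‖v i‖ < ∞`. -/
def IsTraceClass (T : H →L[ℂ] H) : Prop :=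
  ∃ u v : ℕ → H, Summable (fun i => ‖u i‖ * ‖v i‖) ∧
    ∀ x, HasSum (fun i => inner ℂ (u i) x • v i) (T x)

/-- `T` is trace class and its trace, computed in any orthonormal basis, is `t`. -/
def HasTrace (T : H →L[ℂ] H) (t : ℂ) : Prop :=
  IsTraceClass T ∧
    ∀ (s : Set H) (b : HilbertBasis s ℂ H), HasSum (fun i => inner ℂ (b i) (T (b i))) t

end Trace

end LieGroupQ

end

/-! Everything is computed in exponential coordinates. A translation `Y ↦ log (g exp Y)` intertwines
the left-trivialized derivatives of `exp`, which are `φ(ad X)`. Hence `|det φ(ad X)| dX` on `O`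
pushes forward to a left-invariant measure, and uniqueness identifies it with Haar measure up to the
constant defining `dX`. Put `λ(x) = (2/x) sinh(x/2)`, an even function. Then `φ(x) = e^{-x/2} λ(x)`,
so `F = √|det λ(ad X)|`. The doubling rule `λ(2x) = cosh(x/2) λ(x)` turns the square roots in `Δ_x`
into values of the same function at `2X`.

Self-adjointness. `Δ_x` has the form `ψ ↦ m · (ψ ∘ s)`, where `s` is an involution with Jacobian `ρ`
and `m(s b) ρ(b) = conj m(b)`. Any such operator is symmetric. The sets `{|m| |m ∘ s| ≤ N}` are
invariant under `s` and exhaust the space, and truncation to them gives density of the maximal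
domain and equality with the adjoint. The same substitution shows that membership in the domain is
square integrability with weight `|m| |m ∘ s|`, a constant multiple of `j_q`
(`isSelfAdjoint_of_weightedComposition`, `quantizer_spec`).

Traces. Fourier inversion writes a smooth compactly supported kernel as `∑ α_i(a) β_i(b)`, with `∑
|α_i|²` and `∑ |β_i|²` uniformly bounded (`exists_nuclear_expansion`). Applying `Δ_x` replaces `α_i`
by `m · (α_i ∘ s_q)`. The total mass remains finite because the factor `det λ` in the Haar density
cancels the pole of `j_q`. So `Δ_x f̂` is trace class, with trace the integral of `m(a) k(s_q a,
a)`. At `a = q exp X` this is the integral defining `f(q, p)`, evaluated in the variable `2X`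
(`integral_weight_kernel_diagonal`).

Reconstruction. Fix `a` and write `q = a exp w`, so that `s_q(a) = a exp X` with `X = 2w`. For fixed
`p` the integral over `q` becomes an integral over `X` of an amplitude, the phase `e^{i⟨p,X⟩/ħ}` and
the Fourier transform at `p` of a smooth kernel `K(X, ·)` times a cutoff weight. Expanding `K` in
products and applying Plancherel termwise shows that the result is integrable in `p` over the whole
dual, with integral a multiple of the diagonal term. There `K(X, X) = k(a, a exp X)`, which gives
`f̂ψ(a)` (`integral_kernel_momentum`). -/

noncomputable section

set_option linter.unusedSectionVars false

namespace LieGroupQ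

/-! ### Left-invariant fields and the one-parameter groups `t ↦ exp (tX)`. -/

section Exponential

variable {E : Type*} [NormedAddCommGroup E] [InnerProductSpace ℝ E] [FiniteDimensional ℝ E]
  {G : Type*} [TopologicalSpace G] [T2Space G] [ChartedSpace E G] [Group G]
  [LieGroup 𝓘(ℝ, E) ∞ G]

/-- The left-invariant vector field determined by `X`. -/
abbrev leftField (G : Type*) [TopologicalSpace G] [ChartedSpace E G] [Group G] (X : E) :
    (g : G) → TangentSpace 𝓘(ℝ, E) g :=
  mulInvariantVectorField (I := 𝓘(ℝ, E)) (G := G) (X : GroupLieAlgebra 𝓘(ℝ, E) G)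

theorem contMDiff_leftField (X : E) : ContMDiff 𝓘(ℝ, E) 𝓘(ℝ, E).tangent 1
    (fun g : G => (⟨g, leftField G X g⟩ : TangentBundle 𝓘(ℝ, E) G)) := by
  have : LieGroup 𝓘(ℝ, E) (minSmoothness ℝ 3) G :=
    LieGroup.of_le (n := ∞) (by rw [minSmoothness_of_isRCLikeNormedField]; exact ENat.LEInfty.out)
  refine (contMDiff_mulInvariantVectorField (I := 𝓘(ℝ, E)) (G := G)
    (X : GroupLieAlgebra 𝓘(ℝ, E) G)).of_le ?_
  rw [minSmoothness_of_isRCLikeNormedField]; norm_num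

theorem leftField_mul (X : E) (g h : G) :
    leftField G X (g * h) = mfderiv 𝓘(ℝ, E) 𝓘(ℝ, E) (fun b : G => g * b) h (leftField G X h) := by
  have hd : ∀ a b : G, MDifferentiableAt 𝓘(ℝ, E) 𝓘(ℝ, E) (fun x : G => a * x) b := fun a b =>
    (contMDiff_mul_left (I := 𝓘(ℝ, E)) (n := ∞) (a := a)).mdifferentiable (by simp) b
  have D : (fun x : G => g * h * x) = (fun b => g * b) ∘ (fun x => h * x) := by
    ext x; simp [mul_assoc]
  -- The tangent spaces at `h * 1` and at `h` agree only after rewriting the base point, so the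
  -- derivatives are compared as endomorphisms of `E`.
  have key : ∀ y : G, y = h → ∀ v : E,
      (show E →L[ℝ] E from mfderiv 𝓘(ℝ, E) 𝓘(ℝ, E) (fun b : G => g * b) y) v =
      (show E →L[ℝ] E from mfderiv 𝓘(ℝ, E) 𝓘(ℝ, E) (fun b : G => g * b) h) v := by
    rintro y rfl v; rfl
  have h1 := mfderiv_comp (I' := 𝓘(ℝ, E)) (1 : G) (hd g _) (hd h 1)
  rw [← D] at h1
  exact (congrArg (fun A : E →L[ℝ] E => A X) h1).trans (key (h * 1) (mul_one h) _)

theorem leftField_one (X : E) : leftField G X (1 : G) = X := by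
  have h : (fun a : G => 1 * a) = id := by ext; simp
  simp only [leftField, mulInvariantVectorField]
  rw [h, mfderiv_id]; rfl

theorem hasMFDerivAt_mul_left_comp {γ : ℝ → G} {X : E} {t : ℝ} (g : G)
    (h : HasMFDerivAt 𝓘(ℝ, ℝ) 𝓘(ℝ, E) γ t ((1 : ℝ →L[ℝ] ℝ).smulRight (leftField G X (γ t)))) :
    HasMFDerivAt 𝓘(ℝ, ℝ) 𝓘(ℝ, E) (fun t => g * γ t) t
      ((1 : ℝ →L[ℝ] ℝ).smulRight (leftField G X (g * γ t))) := by
  have hd : MDifferentiableAt 𝓘(ℝ, E) 𝓘(ℝ, E) (fun x : G => g * x) (γ t) :=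
    (contMDiff_mul_left (I := 𝓘(ℝ, E)) (n := ∞) (a := g)).mdifferentiable (by simp) _
  have := hd.hasMFDerivAt.comp t h
  have e : (mfderiv 𝓘(ℝ, E) 𝓘(ℝ, E) (fun x : G => g * x) (γ t)).comp
      ((1 : ℝ →L[ℝ] ℝ).smulRight (leftField G X (γ t))) =
      (1 : ℝ →L[ℝ] ℝ).smulRight (leftField G X (g * γ t)) := by
    rw [leftField_mul]
    exact ContinuousLinearMap.ext fun r => map_smul
      (mfderiv 𝓘(ℝ, E) 𝓘(ℝ, E) (fun x : G => g * x) (γ t)) r _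
  rw [← e]
  exact this

/-- Left translates of a local integral curve through `1` are integral curves on the same time
interval. The existence time is therefore uniform over the group, and the field is complete. -/
theorem exists_integralCurve_leftField (X : E) (x : G) :
    ∃ γ : ℝ → G, γ 0 = x ∧ IsMIntegralCurve (I := 𝓘(ℝ, E)) γ (leftField G X) := by
  have hv := contMDiff_leftField (G := G) X
  obtain ⟨γ, h0, hγ⟩ := exists_isMIntegralCurveAt_of_contMDiffAt_boundaryless (t₀ := 0)
    (hv (1 : G))
  rw [isMIntegralCurveAt_iff'] at hγ
  obtain ⟨ε, hε, hγ⟩ := hγ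
  refine exists_isMIntegralCurve_of_isMIntegralCurveOn hv hε (fun y => ?_) x
  refine ⟨fun t => y * γ t, by simp [h0], fun t ht => ?_⟩
  have ht' : t ∈ Metric.ball (0 : ℝ) ε := by rwa [Real.ball_eq_Ioo, zero_sub, zero_add]
  have := hasMFDerivAt_mul_left_comp (X := X) y
    ((hγ t ht').hasMFDerivAt (Metric.isOpen_ball.mem_nhds ht'))
  exact this.hasMFDerivWithinAt

/-- The one-parameter group `t ↦ exp (t X)`, as an integral curve. -/
theorem exists_lieExp_curve (X : E) : ∃ γ : ℝ → G, γ 0 = 1 ∧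
    IsMIntegralCurve (I := 𝓘(ℝ, E)) γ (leftField G X) ∧ ∀ t, lieExp G (t • X) = γ t := by
  obtain ⟨γ, h0, hγ⟩ := exists_integralCurve_leftField (G := G) X 1
  refine ⟨γ, h0, hγ, fun t => ?_⟩
  have h := exists_integralCurve_leftField (G := G) (t • X) 1
  have e : lieExp G (t • X) = h.choose 1 := by
    unfold lieExp
    exact dif_pos h
  rw [e]
  -- Rescaling time by `t` turns a curve for `X` into one for `t • X`; uniqueness then identifies it
  -- with the curve chosen in the definition of `lieExp`.
  have h1 := hγ.comp_mul t
  have h2 : IsMIntegralCurve (I := 𝓘(ℝ, E)) (γ ∘ (· * t)) (leftField G (t • X)) := by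
    convert! h1 using 1
    have : LieGroup 𝓘(ℝ, E) (minSmoothness ℝ 3) G :=
      LieGroup.of_le (n := ∞)
        (by rw [minSmoothness_of_isRCLikeNormedField]; exact ENat.LEInfty.out)
    exact mulInvariantVectorField_smul (I := 𝓘(ℝ, E)) (G := G) t (X : GroupLieAlgebra 𝓘(ℝ, E) G)
  have h3 := isMIntegralCurve_Ioo_eq_of_contMDiff_boundaryless (t₀ := 0)
    (contMDiff_leftField (G := G) (t • X)) h.choose_spec.2 h2 (by simp [h.choose_spec.1, h0])
  rw [h3]; simp

theorem lieExp_zero : lieExp G (0 : E) = 1 := by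
  obtain ⟨γ, h0, -, h⟩ := exists_lieExp_curve (G := G) (0 : E)
  simpa [h0] using h 0

theorem lieExp_add_smul (X : E) (s t : ℝ) :
    lieExp G ((s + t) • X) = lieExp G (s • X) * lieExp G (t • X) := by
  obtain ⟨γ, h0, hγ, h⟩ := exists_lieExp_curve (G := G) X
  rw [h, h, h]
  have h1 : IsMIntegralCurve (I := 𝓘(ℝ, E)) (fun t => γ s * γ t) (leftField G X) :=
    fun t => hasMFDerivAt_mul_left_comp _ (hγ t)
  have h2 := hγ.comp_add s
  have h3 := isMIntegralCurve_Ioo_eq_of_contMDiff_boundaryless (t₀ := 0)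
    (contMDiff_leftField (G := G) X) h2 h1 (by simp [h0])
  simpa [add_comm] using congrFun h3 t

theorem lieExp_neg (X : E) : lieExp G (-X) = (lieExp G X)⁻¹ := by
  have := lieExp_add_smul (G := G) X (-1) 1
  simp only [neg_add_cancel, zero_smul, neg_smul, one_smul, lieExp_zero] at this
  exact eq_inv_of_mul_eq_one_left this.symm

theorem lieExp_nsmul (X : E) (n : ℕ) : lieExp G ((n : ℝ) • X) = lieExp G X ^ n := by
  induction n with
  | zero => simp [lieExp_zero]
  | succ k ih => rw [Nat.cast_succ, lieExp_add_smul, ih, one_smul, pow_succ]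

theorem hasMFDerivAt_lieExp_smul (X : E) (t : ℝ) :
    HasMFDerivAt 𝓘(ℝ, ℝ) 𝓘(ℝ, E) (fun t : ℝ => lieExp G (t • X)) t
      ((1 : ℝ →L[ℝ] ℝ).smulRight (leftField G X (lieExp G (t • X)))) := by
  obtain ⟨γ, h0, hγ, h⟩ := exists_lieExp_curve (G := G) X
  obtain rfl : (fun t : ℝ => lieExp G (t • X)) = γ := funext h
  exact hγ t

/-- Smoothness spreads from `O` to the whole Lie algebra through `exp Y = exp (Y / (n+1)) ^ (n+1)`,
with `n` so large that `X / (n+1)` lies in `O`. -/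
theorem contMDiff_lieExp {O : Set E} (hO : IsOpen O) (h0 : (0 : E) ∈ O)
    (hs : ContMDiffOn 𝓘(ℝ, E) 𝓘(ℝ, E) ∞ (lieExp G) O) :
    ContMDiff 𝓘(ℝ, E) 𝓘(ℝ, E) ∞ (lieExp G : E → G) := by
  intro X
  have ht : Tendsto (fun n : ℕ => ((n : ℝ) + 1)⁻¹ • X) atTop (𝓝 0) := by
    have := (tendsto_one_div_add_atTop_nhds_zero_nat (𝕜 := ℝ)).smul_const X
    simpa using this
  obtain ⟨n, hn⟩ := (ht.eventually (hO.mem_nhds h0)).exists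
  have h1 : (lieExp G : E → G) = fun Y => lieExp G (((n : ℝ) + 1)⁻¹ • Y) ^ (n + 1) := by
    ext Y
    rw [← lieExp_nsmul, smul_smul]
    push_cast
    rw [mul_inv_cancel₀ (by positivity), one_smul]
  rw [h1]
  have h2 : ContMDiffAt 𝓘(ℝ, E) 𝓘(ℝ, E) ∞ (fun Y : E => ((n : ℝ) + 1)⁻¹ • Y) X :=
    (contDiff_const.smul contDiff_id).contMDiff X
  have h3 : ContMDiffAt 𝓘(ℝ, E) 𝓘(ℝ, E) ∞ (fun Y : E => lieExp G (((n : ℝ) + 1)⁻¹ • Y)) X :=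
    (hs.contMDiffAt (hO.mem_nhds hn)).comp X h2
  exact ((contMDiff_pow (I := 𝓘(ℝ, E)) (G := G) (n + 1)).contMDiffAt).comp X h3

end Exponential


/-! ### First-order calculus at the identity in the preferred chart. -/

section ChartCalculus

variable {E : Type*} [NormedAddCommGroup E] [InnerProductSpace ℝ E] [FiniteDimensional ℝ E]
  {G : Type*} [TopologicalSpace G] [T2Space G] [ChartedSpace E G] [Group G]
  [LieGroup 𝓘(ℝ, E) ∞ G]
  {E' : Type*} [NormedAddCommGroup E'] [NormedSpace ℝ E']
  {E'' : Type*} [NormedAddCommGroup E''] [NormedSpace ℝ E'']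

/-- The preferred chart at the identity. -/
abbrev chart1 (E : Type*) [NormedAddCommGroup E] [InnerProductSpace ℝ E] (G : Type*)
    [TopologicalSpace G] [ChartedSpace E G] [Group G] : PartialEquiv G E :=
  extChartAt 𝓘(ℝ, E) (1 : G)

/-- `f` takes the value `1` at `x` and has derivative `f'` there. -/
structure HasDerivAtOne (f : E' → G) (f' : E' →L[ℝ] E) (x : E') : Prop where
  eq_one : f x = 1
  cont : ContinuousAt f x
  deriv : HasFDerivAt (fun y => chart1 E G (f y)) f' x

theorem HasDerivAtOne.unique {f : E' → G} {f' f'' : E' →L[ℝ] E} {x : E'}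
    (h : HasDerivAtOne f f' x) (h' : HasDerivAtOne f f'' x) : f' = f'' :=
  h.deriv.unique h'.deriv

theorem HasDerivAtOne.eventually_mem_source {f : E' → G} {f' : E' →L[ℝ] E} {x : E'}
    (h : HasDerivAtOne f f' x) : ∀ᶠ y in 𝓝 x, f y ∈ (chart1 E G).source :=
  h.cont.eventually (by rw [h.eq_one]; exact extChartAt_source_mem_nhds _)

theorem HasDerivAtOne.congr {f g : E' → G} {f' : E' →L[ℝ] E} {x : E'}
    (h : HasDerivAtOne f f' x) (hfg : ∀ᶠ y in 𝓝 x, g y = f y) : HasDerivAtOne g f' x :=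
  ⟨hfg.self_of_nhds.trans h.eq_one, h.cont.congr (hfg.mono fun _ hy => hy.symm),
    h.deriv.congr_of_eventuallyEq (hfg.mono fun y hy => by simp only [hy])⟩

theorem HasMFDerivAt.hasDerivAtOne {f : ℝ → G} {f' : ℝ →L[ℝ] E} {x : ℝ} (h1 : f x = 1)
    (h : HasMFDerivAt 𝓘(ℝ, ℝ) 𝓘(ℝ, E) f x f') : HasDerivAtOne f f' x := by
  have e : writtenInExtChartAt 𝓘(ℝ, ℝ) 𝓘(ℝ, E) x f = fun y => chart1 E G (f y) := by
    ext y; rw [writtenInExtChartAt, extChartAt_model_space_eq_id, h1]; rfl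
  have h2 := h.2
  rw [e, extChartAt_model_space_eq_id] at h2
  refine ⟨h1, h.1, hasFDerivWithinAt_univ.1 ?_⟩
  rw [modelWithCornersSelf_coe, range_id] at h2
  exact h2

theorem HasDerivAtOne.comp {f : E' → G} {f' : E' →L[ℝ] E} {h : E'' → E'} {h' : E'' →L[ℝ] E'}
    {x : E''} (hf : HasDerivAtOne f f' (h x)) (hh : HasFDerivAt h h' x) :
    HasDerivAtOne (fun y => f (h y)) (f'.comp h') x :=
  ⟨hf.eq_one, ContinuousAt.comp (g := f) hf.cont hh.continuousAt, hf.deriv.comp x hh⟩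

theorem chart1_symm_one : (chart1 E G).symm (chart1 E G 1) = 1 := extChartAt_to_inv _

theorem contMDiffAt_chart1_symm :
    ContMDiffAt 𝓘(ℝ, E) 𝓘(ℝ, E) ∞ (chart1 E G).symm (chart1 E G 1) :=
  (contMDiffOn_extChartAt_symm (I := 𝓘(ℝ, E)) (n := ∞) (1 : G)).contMDiffAt
    (extChartAt_target_mem_nhds _)

theorem contDiffAt_chart1_comp {f : E' → G} {x : E'} (h1 : f x = 1)
    (hf : ContMDiffAt 𝓘(ℝ, E') 𝓘(ℝ, E) ∞ f x) :
    ContDiffAt ℝ ∞ (fun y => chart1 E G (f y)) x := by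
  have : ContMDiffAt 𝓘(ℝ, E) 𝓘(ℝ, E) ∞ (chart1 E G) (f x) := by
    rw [h1]; exact contMDiffAt_extChartAt
  exact (this.comp x hf).contDiffAt

theorem hasDerivAtOne_of_contMDiffAt {f : E' → G} {x : E'} (h1 : f x = 1)
    (hf : ContMDiffAt 𝓘(ℝ, E') 𝓘(ℝ, E) ∞ f x) :
    HasDerivAtOne f (fderiv ℝ (fun y => chart1 E G (f y)) x) x :=
  ⟨h1, hf.continuousAt,
    ((contDiffAt_chart1_comp h1 hf).differentiableAt (by simp)).hasFDerivAt⟩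

theorem hasDerivAtOne_chart1_symm :
    HasDerivAtOne (chart1 E G).symm (ContinuousLinearMap.id ℝ E) (chart1 E G 1) := by
  refine ⟨chart1_symm_one, contMDiffAt_chart1_symm.continuousAt, ?_⟩
  refine (hasFDerivAt_id _).congr_of_eventuallyEq ?_
  filter_upwards [extChartAt_target_mem_nhds (I := 𝓘(ℝ, E)) (1 : G)] with y hy
  exact (chart1 E G).right_inv hy

theorem HasDerivAtOne.map {f : E' → G} {f' : E' →L[ℝ] E} {x : E'} (hf : HasDerivAtOne f f' x)
    {Φ : G → G} (hΦ : MDifferentiableAt 𝓘(ℝ, E) 𝓘(ℝ, E) Φ 1) (h1 : Φ 1 = 1) :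
    HasDerivAtOne (fun y => Φ (f y))
      ((show E →L[ℝ] E from mfderiv 𝓘(ℝ, E) 𝓘(ℝ, E) Φ 1).comp f') x := by
  have h2 : HasFDerivAt (fun y => chart1 E G (Φ ((chart1 E G).symm y)))
      (show E →L[ℝ] E from mfderiv 𝓘(ℝ, E) 𝓘(ℝ, E) Φ 1) (chart1 E G (f x)) := by
    have := hΦ.hasMFDerivAt.2
    have e : writtenInExtChartAt 𝓘(ℝ, E) 𝓘(ℝ, E) 1 Φ =
        fun y => chart1 E G (Φ ((chart1 E G).symm y)) := by
      ext y; simp [writtenInExtChartAt, h1]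
    rw [e] at this
    rw [hf.eq_one]
    refine hasFDerivWithinAt_univ.1 ?_
    simpa [mfld_simps] using! this
  have hc : ContinuousAt Φ (f x) := by rw [hf.eq_one]; exact hΦ.continuousAt
  refine ⟨by simp [hf.eq_one, h1], ContinuousAt.comp (g := Φ) hc hf.cont, ?_⟩
  refine (h2.comp x hf.deriv).congr_of_eventuallyEq ?_
  filter_upwards [hf.eventually_mem_source] with y hy
  simp only [Function.comp]
  rw [(chart1 E G).left_inv hy]

/-- Multiplication in the preferred chart at the identity. -/
def mulChart (E : Type*) [NormedAddCommGroup E] [InnerProductSpace ℝ E] (G : Type*)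
    [TopologicalSpace G] [ChartedSpace E G] [Group G] (p : E × E) : E :=
  chart1 E G ((chart1 E G).symm p.1 * (chart1 E G).symm p.2)

theorem contMDiffAt_mulChart_aux :
    ContMDiffAt 𝓘(ℝ, E × E) 𝓘(ℝ, E) ∞
      (fun p : E × E => (chart1 E G).symm p.1 * (chart1 E G).symm p.2)
      (chart1 E G 1, chart1 E G 1) := by
  have h1 : ContMDiffAt 𝓘(ℝ, E × E) 𝓘(ℝ, E) ∞ (fun p : E × E => (chart1 E G).symm p.1)
      (chart1 E G 1, chart1 E G 1) :=
    ContMDiffAt.comp (g := (chart1 E G).symm) _ contMDiffAt_chart1_symm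
      (contDiff_fst.contMDiff.contMDiffAt)
  have h2 : ContMDiffAt 𝓘(ℝ, E × E) 𝓘(ℝ, E) ∞ (fun p : E × E => (chart1 E G).symm p.2)
      (chart1 E G 1, chart1 E G 1) :=
    ContMDiffAt.comp (g := (chart1 E G).symm) _ contMDiffAt_chart1_symm
      (contDiff_snd.contMDiff.contMDiffAt)
  exact h1.mul h2

theorem contDiffAt_mulChart :
    ContDiffAt ℝ ∞ (mulChart E G) (chart1 E G 1, chart1 E G 1) :=
  contDiffAt_chart1_comp (by simp) contMDiffAt_mulChart_aux

theorem mulChart_left (y : E) (hy : y ∈ (chart1 E G).target) :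
    mulChart E G (chart1 E G 1, y) = y := by
  simp only [mulChart, chart1_symm_one, one_mul]
  exact (chart1 E G).right_inv hy

theorem mulChart_right (y : E) (hy : y ∈ (chart1 E G).target) :
    mulChart E G (y, chart1 E G 1) = y := by
  simp only [mulChart, chart1_symm_one, mul_one]
  exact (chart1 E G).right_inv hy

/-- The derivative is determined by its two partial derivatives, and both are the identity because
`1` is a two-sided unit. -/
theorem hasFDerivAt_mulChart :
    HasFDerivAt (mulChart E G)
      (ContinuousLinearMap.fst ℝ E E + ContinuousLinearMap.snd ℝ E E)
      (chart1 E G 1, chart1 E G 1) := by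
  set o := chart1 E G 1 with ho
  have hd := ((contDiffAt_mulChart (E := E) (G := G)).differentiableAt (by simp)).hasFDerivAt
  rw [← ho] at hd
  have ht : ∀ᶠ y in 𝓝 o, y ∈ (chart1 E G).target := extChartAt_target_mem_nhds _
  have h1 : HasFDerivAt (fun y => mulChart E G (o, y)) (ContinuousLinearMap.id ℝ E) o :=
    (hasFDerivAt_id o).congr_of_eventuallyEq (ht.mono fun y hy => mulChart_left y hy)
  have h2 : HasFDerivAt (fun y => mulChart E G (y, o)) (ContinuousLinearMap.id ℝ E) o :=
    (hasFDerivAt_id o).congr_of_eventuallyEq (ht.mono fun y hy => mulChart_right y hy)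
  have e1 := h1.unique (hd.comp o (hasFDerivAt_prodMk_right o o))
  have e2 := h2.unique (HasFDerivAt.comp (f := fun y => (y, o)) o hd (hasFDerivAt_prodMk_left o o))
  convert! hd using 1
  ext v
  · have := congrArg (fun A : E →L[ℝ] E => A v) e2
    simpa using this
  · have := congrArg (fun A : E →L[ℝ] E => A v) e1
    simpa using this

theorem HasDerivAtOne.mul {f g : E' → G} {f' g' : E' →L[ℝ] E} {x : E'}
    (hf : HasDerivAtOne f f' x) (hg : HasDerivAtOne g g' x) :
    HasDerivAtOne (fun y => f y * g y) (f' + g') x := by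
  have : IsTopologicalGroup G := topologicalGroup_of_lieGroup 𝓘(ℝ, E) ∞
  refine ⟨by simp [hf.eq_one, hg.eq_one], hf.cont.mul hg.cont, ?_⟩
  have hm := hasFDerivAt_mulChart (E := E) (G := G)
  have hp := hf.deriv.prodMk hg.deriv
  have hm' : HasFDerivAt (mulChart E G)
      (ContinuousLinearMap.fst ℝ E E + ContinuousLinearMap.snd ℝ E E)
      ((fun y => (chart1 E G (f y), chart1 E G (g y))) x) := by
    simpa [hf.eq_one, hg.eq_one] using hm
  have := hm'.comp x hp
  refine (this.congr_of_eventuallyEq ?_).congr_fderiv ?_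
  · filter_upwards [hf.eventually_mem_source, hg.eventually_mem_source] with y hy1 hy2
    simp only [Function.comp, mulChart]
    rw [(chart1 E G).left_inv hy1, (chart1 E G).left_inv hy2]
  · ext v; simp

theorem hasDerivAtOne_const {x : E'} : HasDerivAtOne (fun _ : E' => (1 : G)) (0 : E' →L[ℝ] E) x :=
  ⟨rfl, continuousAt_const, hasFDerivAt_const _ _⟩

theorem contMDiff_conj (g : G) : ContMDiff 𝓘(ℝ, E) 𝓘(ℝ, E) ∞ (fun h : G => g * h * g⁻¹) :=
  (contMDiff_const.mul contMDiff_id).mul contMDiff_const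

theorem HasDerivAtOne.conj {f : E' → G} {f' : E' →L[ℝ] E} {x : E'} (hf : HasDerivAtOne f f' x)
    (g : G) : HasDerivAtOne (fun y => g * f y * g⁻¹) ((Ad g : E →L[ℝ] E).comp f') x :=
  hf.map (Φ := fun h : G => g * h * g⁻¹) ((contMDiff_conj g).mdifferentiable (by simp) 1) (by simp)

/-- Inversion is smooth, so some derivative exists; the product rule applied to `f f⁻¹ = 1` forces
it to be `-f'`. -/
theorem HasDerivAtOne.inv {f : E' → G} {f' : E' →L[ℝ] E} {x : E'} (hf : HasDerivAtOne f f' x) :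
    HasDerivAtOne (fun y => (f y)⁻¹) (-f') x := by
  have h1 := hf.map (Φ := fun h : G => h⁻¹)
    ((contMDiff_inv 𝓘(ℝ, E) ∞).mdifferentiable (by simp) 1) (by simp)
  have h2 := hf.mul h1
  simp only [mul_inv_cancel] at h2
  have h3 := h2.unique hasDerivAtOne_const
  rwa [eq_neg_of_add_eq_zero_right h3] at h1

theorem Ad_mul (g h : G) : (Ad (g * h) : E →L[ℝ] E) = (Ad g).comp (Ad h) := by
  have h0 := hasDerivAtOne_chart1_symm (E := E) (G := G)
  have h1 := h0.conj (g * h)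
  have h2 := (h0.conj h).conj g
  refine Eq.trans (h1.unique (f'' := (Ad g).comp ((Ad h).comp (ContinuousLinearMap.id ℝ E)))
    (h2.congr ?_)) ?_
  · refine Eventually.of_forall fun y => ?_
    simp [mul_assoc]
  · simp

theorem Ad_one : (Ad (1 : G) : E →L[ℝ] E) = 1 := by
  have h0 := hasDerivAtOne_chart1_symm (E := E) (G := G)
  have h1 := h0.conj 1
  simp only [one_mul, inv_one, mul_one] at h1
  exact h1.unique h0

/-- With `g = q⁻¹ a`, the left-trivialized reflection is `h ↦ g h⁻¹ g⁻¹`, whose derivative at `1` is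
`-Ad g`. The absolute value removes the sign `(-1)^n`. -/
theorem haarJacobian_refl (q a : G) :
    haarJacobian E (refl q) a = |(Ad (E := E) (q⁻¹ * a)).det| := by
  have e : (fun h : G => (refl q a)⁻¹ * refl q (a * h)) =
      fun h : G => (q⁻¹ * a) * h⁻¹ * (q⁻¹ * a)⁻¹ := by
    ext h; simp [refl, mul_assoc]
  have hc : ContMDiff 𝓘(ℝ, E) 𝓘(ℝ, E) ∞ (fun h : G => (q⁻¹ * a) * h⁻¹ * (q⁻¹ * a)⁻¹) :=
    (contMDiff_const.mul (contMDiff_inv 𝓘(ℝ, E) ∞)).mul contMDiff_const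
  have h0 := hasDerivAtOne_chart1_symm (E := E) (G := G)
  have h1 := h0.inv.conj (q⁻¹ * a)
  have h2 := h0.map (Φ := fun h : G => (q⁻¹ * a) * h⁻¹ * (q⁻¹ * a)⁻¹)
    (hc.mdifferentiable (by simp) 1) (by simp)
  have h3 := h2.unique h1
  unfold haarJacobian
  rw [e]
  have h4 : (show E →L[ℝ] E from mfderiv 𝓘(ℝ, E) 𝓘(ℝ, E)
      (fun h : G => (q⁻¹ * a) * h⁻¹ * (q⁻¹ * a)⁻¹) 1) = -Ad (q⁻¹ * a) := by
    ext v
    have := congrArg (fun A : E →L[ℝ] E => A v) h3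
    simp only [ContinuousLinearMap.comp_neg, ContinuousLinearMap.comp_id,
      neg_apply] at this
    exact this
  rw [h4]
  have h5 : (-(Ad (q⁻¹ * a) : E →L[ℝ] E)).det =
      (-1) ^ Module.finrank ℝ E * (Ad (q⁻¹ * a) : E →L[ℝ] E).det := by
    have := LinearMap.det_smul (-1 : ℝ) ((Ad (q⁻¹ * a) : E →L[ℝ] E) : E →ₗ[ℝ] E)
    rw [neg_one_smul] at this
    exact this
  rw [h5, abs_mul, abs_pow, abs_neg, abs_one, one_pow, one_mul]

end ChartCalculus


/-! ### The derivative of `Ad` along a one-parameter group. -/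

section AdjointExp

variable {E : Type*} [NormedAddCommGroup E] [InnerProductSpace ℝ E] [FiniteDimensional ℝ E]
  {G : Type*} [TopologicalSpace G] [T2Space G] [ChartedSpace E G] [Group G]
  [LieGroup 𝓘(ℝ, E) ∞ G]

theorem hasDerivAtOne_lieExp_smul (X : E) :
    HasDerivAtOne (fun t : ℝ => lieExp G (t • X)) ((1 : ℝ →L[ℝ] ℝ).smulRight X) 0 := by
  refine HasMFDerivAt.hasDerivAtOne (by simp [lieExp_zero]) ?_
  have h := hasMFDerivAt_lieExp_smul (G := G) X 0
  have key : ∀ y : G, y = 1 → (show E from leftField G X y) = X := by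
    rintro y rfl; exact leftField_one X
  have e := key (lieExp G ((0 : ℝ) • X)) (by simp [lieExp_zero])
  have e2 : (1 : ℝ →L[ℝ] ℝ).smulRight X = (1 : ℝ →L[ℝ] ℝ).smulRight
      (show E from leftField G X (lieExp G ((0 : ℝ) • X))) := by rw [e]
  rw [e2]
  exact h

/-- The derivative at the identity of left translation by a point near the identity, in the
chart. -/
def leftDeriv (E : Type*) [NormedAddCommGroup E] [InnerProductSpace ℝ E] (G : Type*)
    [TopologicalSpace G] [ChartedSpace E G] [Group G] (x : E) : E →L[ℝ] E :=
  (fderiv ℝ (mulChart E G) (x, chart1 E G 1)).comp (ContinuousLinearMap.inr ℝ E E)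

/-- The derivative at the identity of right translation by a point near the identity, in the
chart. -/
def rightDeriv (E : Type*) [NormedAddCommGroup E] [InnerProductSpace ℝ E] (G : Type*)
    [TopologicalSpace G] [ChartedSpace E G] [Group G] (x : E) : E →L[ℝ] E :=
  (fderiv ℝ (mulChart E G) (chart1 E G 1, x)).comp (ContinuousLinearMap.inl ℝ E E)

theorem contDiffAt_fderiv_mulChart :
    ContDiffAt ℝ 1 (fderiv ℝ (mulChart E G)) (chart1 E G 1, chart1 E G 1) :=
  (contDiffAt_mulChart (E := E) (G := G)).fderiv_right (m := 1) (by norm_cast)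

theorem hasFDerivAt_fderiv_mulChart :
    HasFDerivAt (fderiv ℝ (mulChart E G))
      (fderiv ℝ (fderiv ℝ (mulChart E G)) (chart1 E G 1, chart1 E G 1))
      (chart1 E G 1, chart1 E G 1) :=
  ((contDiffAt_fderiv_mulChart (E := E) (G := G)).differentiableAt (by simp)).hasFDerivAt

theorem hasFDerivAt_leftDeriv_apply (Y : E) :
    HasFDerivAt (fun x => leftDeriv E G x Y)
      ((((fderiv ℝ (fderiv ℝ (mulChart E G)) (chart1 E G 1, chart1 E G 1)).flip (0, Y)).comp
        (ContinuousLinearMap.inl ℝ E E))) (chart1 E G 1) := by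
  have h := HasFDerivAt.comp (g := fderiv ℝ (mulChart E G)) (f := fun y : E => (y, chart1 E G 1)) (chart1 E G 1)
    (hasFDerivAt_fderiv_mulChart (E := E) (G := G)) (hasFDerivAt_prodMk_left (𝕜 := ℝ) (chart1 E G 1) (chart1 E G 1))
  have h2 := h.clm_apply (hasFDerivAt_const ((0, Y) : E × E) (chart1 E G 1))
  refine (h2.congr_fderiv ?_).congr_of_eventuallyEq (Eventually.of_forall fun x => ?_)
  · ext v; simp
  · simp [leftDeriv]

theorem hasFDerivAt_leftDeriv :
    HasFDerivAt (leftDeriv E G)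
      (((ContinuousLinearMap.compL ℝ E (E × E) E).flip (ContinuousLinearMap.inr ℝ E E)).comp
        ((fderiv ℝ (fderiv ℝ (mulChart E G)) (chart1 E G 1, chart1 E G 1)).comp
        (ContinuousLinearMap.inl ℝ E E))) (chart1 E G 1) := by
  have h := HasFDerivAt.comp (g := fderiv ℝ (mulChart E G)) (f := fun y : E => (y, chart1 E G 1)) (chart1 E G 1)
    (hasFDerivAt_fderiv_mulChart (E := E) (G := G)) (hasFDerivAt_prodMk_left (𝕜 := ℝ) (chart1 E G 1) (chart1 E G 1))
  exact (((ContinuousLinearMap.compL ℝ E (E × E) E).flip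
    (ContinuousLinearMap.inr ℝ E E)).hasFDerivAt).comp _ h

theorem hasFDerivAt_rightDeriv :
    HasFDerivAt (rightDeriv E G)
      (((ContinuousLinearMap.compL ℝ E (E × E) E).flip (ContinuousLinearMap.inl ℝ E E)).comp
        ((fderiv ℝ (fderiv ℝ (mulChart E G)) (chart1 E G 1, chart1 E G 1)).comp
        (ContinuousLinearMap.inr ℝ E E))) (chart1 E G 1) := by
  have h := HasFDerivAt.comp (g := fderiv ℝ (mulChart E G)) (f := fun y : E => (chart1 E G 1, y)) (chart1 E G 1)
    (hasFDerivAt_fderiv_mulChart (E := E) (G := G)) (hasFDerivAt_prodMk_right (𝕜 := ℝ) (chart1 E G 1) (chart1 E G 1))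
  exact (((ContinuousLinearMap.compL ℝ E (E × E) E).flip
    (ContinuousLinearMap.inl ℝ E E)).hasFDerivAt).comp _ h

theorem leftDeriv_one : leftDeriv E G (chart1 E G 1) = 1 := by
  rw [leftDeriv, hasFDerivAt_mulChart.fderiv]
  ext v; simp

theorem rightDeriv_one : rightDeriv E G (chart1 E G 1) = 1 := by
  rw [rightDeriv, hasFDerivAt_mulChart.fderiv]
  ext v; simp

theorem mfderiv_one_eq_fderiv {f : G → E} (hf : MDifferentiableAt 𝓘(ℝ, E) 𝓘(ℝ, E) f 1) :
    HasFDerivAt (fun y => f ((chart1 E G).symm y))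
      (show E →L[ℝ] E from mfderiv 𝓘(ℝ, E) 𝓘(ℝ, E) f 1) (chart1 E G 1) := by
  have := hf.hasMFDerivAt.2
  have e : writtenInExtChartAt 𝓘(ℝ, E) 𝓘(ℝ, E) 1 f = fun y => f ((chart1 E G).symm y) := by
    ext y; rw [writtenInExtChartAt, extChartAt_model_space_eq_id]; rfl
  rw [e, modelWithCornersSelf_coe, range_id] at this
  exact hasFDerivWithinAt_univ.1 this

theorem eventually_differentiableAt_mulChart :
    ∀ᶠ p in 𝓝 ((chart1 E G 1, chart1 E G 1) : E × E), DifferentiableAt ℝ (mulChart E G) p := by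
  have h := (contDiffAt_mulChart (E := E) (G := G)).of_le (m := 1) (by norm_cast)
  filter_upwards [h.eventually (by simp)] with p hp
  exact hp.differentiableAt (by simp)

/-- The left-invariant vector field in the chart. -/
theorem mpullback_leftField (X : E) : ∀ᶠ x in 𝓝 (chart1 E G 1),
    (show E from VectorField.mpullbackWithin 𝓘(ℝ, E) 𝓘(ℝ, E) (chart1 E G).symm (leftField G X)
      (range 𝓘(ℝ, E)) x) = leftDeriv E G x X := by
  have hc : Tendsto (fun x : E => (x, chart1 E G 1)) (𝓝 (chart1 E G 1))
      (𝓝 (chart1 E G 1, chart1 E G 1)) := by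
    rw [nhds_prod_eq]; exact tendsto_id.prodMk tendsto_const_nhds
  filter_upwards [extChartAt_target_mem_nhds (I := 𝓘(ℝ, E)) (1 : G),
    hc.eventually eventually_differentiableAt_mulChart] with x hx hdiff
  -- The pullback inverts the derivative of the inverse chart; that inverse is the derivative of the
  -- chart itself. The pulled-back field is thus the derivative of the chart composed with a left
  -- translation.
  have hinv := ContinuousLinearMap.inverse_eq
    (mfderivWithin_extChartAt_symm_comp_mfderiv_extChartAt (I := 𝓘(ℝ, E)) hx)
    (mfderiv_extChartAt_comp_mfderivWithin_extChartAt_symm (I := 𝓘(ℝ, E)) hx)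
  have hs : (chart1 E G).symm x ∈ (chartAt E (1 : G)).source := by
    rw [← extChartAt_source 𝓘(ℝ, E)]; exact (chart1 E G).map_target hx
  have hd1 : MDifferentiableAt 𝓘(ℝ, E) 𝓘(ℝ, E) (chart1 E G) ((chart1 E G).symm x) :=
    mdifferentiableAt_extChartAt hs
  have hd2 : MDifferentiableAt 𝓘(ℝ, E) 𝓘(ℝ, E) (fun h : G => (chart1 E G).symm x * h) 1 :=
    (contMDiff_mul_left (I := 𝓘(ℝ, E)) (n := ∞)).mdifferentiable (by simp) 1
  have hd1' : MDifferentiableAt 𝓘(ℝ, E) 𝓘(ℝ, E) (chart1 E G) ((chart1 E G).symm x * 1) := by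
    rwa [mul_one]
  have hcomp := mfderiv_comp (I' := 𝓘(ℝ, E)) (1 : G) hd1' hd2
  have key : ∀ y : G, y = (chart1 E G).symm x → ∀ v : E,
      (show E →L[ℝ] E from mfderiv 𝓘(ℝ, E) 𝓘(ℝ, E) (chart1 E G) y) v =
      (show E →L[ℝ] E from mfderiv 𝓘(ℝ, E) 𝓘(ℝ, E) (chart1 E G) ((chart1 E G).symm x)) v := by
    rintro y rfl v; rfl
  have h1 : (show E from VectorField.mpullbackWithin 𝓘(ℝ, E) 𝓘(ℝ, E) (chart1 E G).symm
      (leftField G X) (range 𝓘(ℝ, E)) x) =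
      (show E →L[ℝ] E from mfderiv 𝓘(ℝ, E) 𝓘(ℝ, E)
        ((chart1 E G) ∘ fun h : G => (chart1 E G).symm x * h) 1) X := by
    rw [VectorField.mpullbackWithin_apply, hinv]
    exact ((congrArg (fun A : E →L[ℝ] E => A X) hcomp).trans (key _ (mul_one _) _)).symm
  rw [h1]
  have h2 := mfderiv_one_eq_fderiv (hd1'.comp (1 : G) hd2)
  have h3 := HasFDerivAt.comp (f := fun y : E => (x, y)) (chart1 E G 1) hdiff.hasFDerivAt
    (hasFDerivAt_prodMk_right (𝕜 := ℝ) x (chart1 E G 1))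
  exact congrArg (fun A : E →L[ℝ] E => A X) (h2.unique h3)

/-- In the chart the left-invariant field of `X` is `x ↦ leftDeriv x X`, so the bracket at `1` is a
difference of mixed second derivatives of multiplication. Symmetry of the second derivative reorders
the last term so that the two terms are the derivatives of `leftDeriv` and `rightDeriv` along `X`.
-/
theorem ad_apply (X Y : E) :
    ad G X Y = fderiv ℝ (fderiv ℝ (mulChart E G)) (chart1 E G 1, chart1 E G 1) (X, 0) (0, Y) -
      fderiv ℝ (fderiv ℝ (mulChart E G)) (chart1 E G 1, chart1 E G 1) (0, X) (Y, 0) := by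
  have hsymm : IsSymmSndFDerivAt ℝ (mulChart E G) (chart1 E G 1, chart1 E G 1) := by
    refine contDiffAt_mulChart.isSymmSndFDerivAt ?_
    rw [minSmoothness_of_isRCLikeNormedField]; norm_cast
  have hX := mpullback_leftField (G := G) X
  have hY := mpullback_leftField (G := G) Y
  have h1 : ad G X Y = (show E from VectorField.mlieBracketWithin 𝓘(ℝ, E) (leftField G X)
    (leftField G Y) univ (1 : G)) := rfl
  rw [h1]
  have h2 : (show E from VectorField.mlieBracketWithin 𝓘(ℝ, E) (leftField G X)
    (leftField G Y) univ (1 : G)) = VectorField.lieBracket ℝ (fun x => leftDeriv E G x X)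
      (fun x => leftDeriv E G x Y) (chart1 E G 1) := by
    have hset : (chart1 E G).symm ⁻¹' univ ∩ range 𝓘(ℝ, E) = univ := by simp
    let V : E → E := fun x => VectorField.mpullbackWithin 𝓘(ℝ, E) 𝓘(ℝ, E) (chart1 E G).symm
      (leftField G X) (range 𝓘(ℝ, E)) x
    let W : E → E := fun x => VectorField.mpullbackWithin 𝓘(ℝ, E) 𝓘(ℝ, E) (chart1 E G).symm
      (leftField G Y) (range 𝓘(ℝ, E)) x
    have h3 : (show E from VectorField.mlieBracketWithin 𝓘(ℝ, E) (leftField G X)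
        (leftField G Y) univ (1 : G)) = (ContinuousLinearMap.id ℝ E).inverse
        (VectorField.lieBracketWithin ℝ V W univ (chart1 E G 1)) := by
      rw [VectorField.mlieBracketWithin_apply, mfderiv_extChartAt_self, hset]
      rfl
    rw [h3, VectorField.lieBracketWithin_univ, ContinuousLinearMap.inverse_id]
    exact Filter.EventuallyEq.lieBracket_vectorField_eq hX hY
  rw [h2, VectorField.lieBracket, (hasFDerivAt_leftDeriv_apply (G := G) X).fderiv,
    (hasFDerivAt_leftDeriv_apply (G := G) Y).fderiv, leftDeriv_one]
  rw [hsymm (0, X) (Y, 0)]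
  rfl

/-- The derivative of `Ad` at the identity is `ad`. -/
theorem rightDeriv_comp_Ad : ∀ᶠ x in 𝓝 (chart1 E G 1),
    (rightDeriv E G x).comp (Ad ((chart1 E G).symm x)) = leftDeriv E G x := by
  have hc : Tendsto (fun x : E => (x, chart1 E G 1)) (𝓝 (chart1 E G 1))
      (𝓝 (chart1 E G 1, chart1 E G 1)) := by
    rw [nhds_prod_eq]; exact tendsto_id.prodMk tendsto_const_nhds
  have hc' : Tendsto (fun x : E => (chart1 E G 1, x)) (𝓝 (chart1 E G 1))
      (𝓝 (chart1 E G 1, chart1 E G 1)) := by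
    rw [nhds_prod_eq]; exact tendsto_const_nhds.prodMk tendsto_id
  filter_upwards [extChartAt_target_mem_nhds (I := 𝓘(ℝ, E)) (1 : G),
    hc.eventually eventually_differentiableAt_mulChart,
    hc'.eventually eventually_differentiableAt_mulChart] with x hx hd hd'
  set g := (chart1 E G).symm x with hg
  -- The identity comes from differentiating `(g y g⁻¹) g = g y` at `y = 1`.
  have hconj := (hasDerivAtOne_chart1_symm (E := E) (G := G)).conj g
  have h1 := HasFDerivAt.comp (g := mulChart E G) (f := fun y : E => (x, y)) (chart1 E G 1)
    hd.hasFDerivAt (hasFDerivAt_prodMk_right (𝕜 := ℝ) x (chart1 E G 1))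
  have hpair : HasFDerivAt (fun y : E => (chart1 E G (g * (chart1 E G).symm y * g⁻¹), x))
      ((ContinuousLinearMap.inl ℝ E E).comp ((Ad g).comp (ContinuousLinearMap.id ℝ E)))
      (chart1 E G 1) := by
    refine (hconj.deriv.prodMk (hasFDerivAt_const x _)).congr_fderiv ?_
    ext v <;> simp
  have hd2 : HasFDerivAt (mulChart E G) (fderiv ℝ (mulChart E G) (chart1 E G 1, x))
      ((fun y : E => (chart1 E G (g * (chart1 E G).symm y * g⁻¹), x)) (chart1 E G 1)) := by
    have e : g * (chart1 E G).symm (chart1 E G 1) * g⁻¹ = 1 := hconj.eq_one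
    simp only [e]
    exact hd'.hasFDerivAt
  have h2 := hd2.comp (chart1 E G 1) hpair
  have hsrc : ∀ᶠ y in 𝓝 (chart1 E G 1),
      g * (chart1 E G).symm y * g⁻¹ ∈ (chart1 E G).source := hconj.eventually_mem_source
  have h3 := h1.unique (h2.congr_of_eventuallyEq ?_)
  · rw [leftDeriv, rightDeriv, h3]
    ext v; simp
  · filter_upwards [hsrc] with y hy
    simp only [Function.comp, mulChart]
    rw [(chart1 E G).left_inv hy, ← hg]
    simp

/-- Near the identity `Ad` is `rightDeriv⁻¹ * leftDeriv`. Both factors equal `1` at the identity, so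
the derivative there is that of `leftDeriv` minus that of `rightDeriv`, which `ad_apply` recognizes
as `ad`. -/
theorem hasDerivAt_Ad_lieExp_zero (X : E) :
    HasDerivAt (fun t : ℝ => (Ad (lieExp G (t • X)) : E →L[ℝ] E)) (ad G X) 0 := by
  have h0 := hasDerivAtOne_lieExp_smul (G := G) X
  have hx : HasDerivAt (fun t : ℝ => chart1 E G (lieExp G (t • X))) X 0 := by
    simpa using h0.deriv.hasDerivAt
  have hx0 : chart1 E G (lieExp G ((0 : ℝ) • X)) = chart1 E G 1 := by rw [h0.eq_one]
  have hL := HasFDerivAt.comp_hasDerivAt (l := leftDeriv E G) (0 : ℝ)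
    (by rw [hx0]; exact hasFDerivAt_leftDeriv (E := E) (G := G)) hx
  have hR := HasFDerivAt.comp_hasDerivAt (l := rightDeriv E G) (0 : ℝ)
    (by rw [hx0]; exact hasFDerivAt_rightDeriv (E := E) (G := G)) hx
  have hinv : HasFDerivAt (Ring.inverse : (E →L[ℝ] E) → (E →L[ℝ] E))
      (-ContinuousLinearMap.mulLeftRight ℝ (E →L[ℝ] E) 1 1)
      ((rightDeriv E G ∘ fun t : ℝ => chart1 E G (lieExp G (t • X))) 0) := by
    have := hasFDerivAt_ringInverse (𝕜 := ℝ) (1 : (E →L[ℝ] E)ˣ)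
    simp only [Function.comp, hx0, rightDeriv_one]
    simpa using this
  have hRi := hinv.comp_hasDerivAt (0 : ℝ) hR
  have hm := hRi.mul hL
  have hx1 : Tendsto (fun t : ℝ => chart1 E G (lieExp G (t • X))) (𝓝 0) (𝓝 (chart1 E G 1)) := by
    have := hx.continuousAt.tendsto
    rwa [hx0] at this
  have hRc : ContinuousAt (rightDeriv E G) (chart1 E G 1) := hasFDerivAt_rightDeriv.continuousAt
  have hunit : ∀ᶠ x in 𝓝 (chart1 E G 1), IsUnit (rightDeriv E G x) := by
    refine hRc.eventually ?_
    rw [rightDeriv_one]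
    exact Units.nhds (1 : (E →L[ℝ] E)ˣ)
  have hsrc : ∀ᶠ t : ℝ in 𝓝 0, lieExp G (t • X) ∈ (chart1 E G).source :=
    h0.eventually_mem_source
  refine (hm.congr_of_eventuallyEq ?_).congr_deriv ?_
  · filter_upwards [hx1.eventually rightDeriv_comp_Ad, hx1.eventually hunit, hsrc] with t h1 h2 h3
    rw [(chart1 E G).left_inv h3] at h1
    simp only [Function.comp, Pi.mul_apply]
    rw [← h1]
    have := Ring.inverse_mul_cancel _ h2
    calc (Ad (lieExp G (t • X)) : E →L[ℝ] E) = 1 * Ad (lieExp G (t • X)) := (one_mul _).symm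
      _ = _ := by rw [← this, mul_assoc]; rfl
  · ext Y
    rw [ad_apply]
    simp only [Function.comp, hx0, leftDeriv_one, rightDeriv_one, Ring.inverse_one]
    simp
    abel

end AdjointExp


/-! ### The operator functions `φ` and `λ` as integrals of `exp (tB)`. -/

section OperatorFunctions

variable {E : Type*} [NormedAddCommGroup E] [NormedSpace ℝ E] [CompleteSpace E]

theorem continuous_exp_smul (B : E →L[ℝ] E) :
    Continuous fun t : ℝ => NormedSpace.exp (t • B) := by
  let : NormedAlgebra ℚ (E →L[ℝ] E) := .restrictScalars ℚ ℝ _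
  exact NormedSpace.exp_continuous.comp (continuous_id.smul continuous_const)

theorem exp_smul_mul_exp_smul (B : E →L[ℝ] E) (s t : ℝ) :
    NormedSpace.exp (s • B) * NormedSpace.exp (t • B) = NormedSpace.exp ((s + t) • B) := by
  let : NormedAlgebra ℚ (E →L[ℝ] E) := .restrictScalars ℚ ℝ _
  rw [add_smul, NormedSpace.exp_add_of_commute]
  exact ((Commute.refl B).smul_left s).smul_right t

theorem mul_integral_exp_smul (A B : E →L[ℝ] E) (a b : ℝ) :
    A * ∫ t in a..b, NormedSpace.exp (t • B) = ∫ t in a..b, A * NormedSpace.exp (t • B) :=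
  ((ContinuousLinearMap.mul ℝ (E →L[ℝ] E) A).intervalIntegral_comp_comm
    ((continuous_exp_smul B).intervalIntegrable a b)).symm

/-- Once the power series are integrals of a one-parameter group, identities between `φ`, `λ` and
`exp` reduce to shifting, scaling and splitting intervals of integration. -/
theorem hasSum_integral_exp_smul (B : E →L[ℝ] E) (a b : ℝ) :
    HasSum (fun k : ℕ => ((b ^ (k + 1) - a ^ (k + 1)) / ((k + 1).factorial : ℝ)) • B ^ k)
      (∫ t in a..b, NormedSpace.exp (t • B)) := by
  have hcont : ∀ k : ℕ, Continuous fun t : ℝ => ((k.factorial : ℝ)⁻¹) • (t • B) ^ k := by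
    intro k
    fun_prop
  have h := intervalIntegral.hasSum_intervalIntegral_of_summable_norm (a := a) (b := b)
    (f := fun k : ℕ => (⟨fun t : ℝ => ((k.factorial : ℝ)⁻¹) • (t • B) ^ k, hcont k⟩ :
      C(ℝ, E →L[ℝ] E))) ?_
  · convert! h using 1
    · ext1 k
      have : ∀ t : ℝ, ((k.factorial : ℝ)⁻¹) • (t • B) ^ k =
          (t ^ k) • (((k.factorial : ℝ)⁻¹) • B ^ k) := fun t => by
        rw [smul_pow, smul_comm]
      simp only [ContinuousMap.coe_mk, this]
      rw [intervalIntegral.integral_smul_const, integral_pow, smul_smul]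
      congr 1
      rw [Nat.factorial_succ]
      push_cast
      field_simp
    · refine intervalIntegral.integral_congr fun t _ => ?_
      simp only [ContinuousMap.coe_mk]
      rw [NormedSpace.exp_eq_tsum ℝ]
  · set M := max |a| |b| with hM
    refine Summable.of_nonneg_of_le (fun k => norm_nonneg _) (fun k => ?_)
      (NormedSpace.norm_expSeries_summable' (𝕂 := ℝ) ((M * ‖B‖ : ℝ)))
    rw [ContinuousMap.norm_le _ (norm_nonneg _)]
    rintro ⟨t, ht⟩
    simp only [ContinuousMap.restrict_apply, ContinuousMap.coe_mk]
    have htM : |t| ≤ M := by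
      rw [abs_le]
      have h1 := ht.1
      have h2 := ht.2
      simp only [inf_le_iff, le_sup_iff] at h1 h2
      have := neg_abs_le a; have := neg_abs_le b; have := le_abs_self a
      have := le_abs_self b; have := le_max_left |a| |b|; have := le_max_right |a| |b|
      constructor
      · rcases h1 with h1 | h1 <;> linarith
      · rcases h2 with h2 | h2 <;> linarith
    rw [norm_smul, smul_eq_mul, norm_mul, norm_pow (M * ‖B‖)]
    refine mul_le_mul_of_nonneg_left ?_ (norm_nonneg _)
    -- The term `k = 0` is separate because `E` may be trivial, in which case the identity operator
    -- has norm `0` rather than `1`.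
    rcases Nat.eq_zero_or_pos k with rfl | hk
    · simpa using! ContinuousLinearMap.norm_id_le (𝕜 := ℝ) (E := E)
    refine (norm_pow_le' _ hk).trans ?_
    refine pow_le_pow_left₀ (norm_nonneg _) ?_ k
    rw [norm_smul, Real.norm_eq_abs, norm_mul, norm_norm]
    refine mul_le_mul_of_nonneg_right (htM.trans (le_abs_self _)) (norm_nonneg _)

theorem phiOp_eq_integral (B : E →L[ℝ] E) :
    phiOp B = ∫ t in (0 : ℝ)..1, NormedSpace.exp (-(t • B)) := by
  have h := (hasSum_integral_exp_smul (-B) 0 1).tsum_eq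
  simp only [smul_neg] at h
  rw [← h, phiOp]
  refine tsum_congr fun k => ?_
  rw [neg_pow B]
  simp only [one_pow, zero_pow (Nat.succ_ne_zero k), sub_zero]
  rw [show ((-1 : E →L[ℝ] E)) ^ k * B ^ k = ((-1 : ℝ) ^ k) • B ^ k by
    rw [← neg_one_smul ℝ (1 : E →L[ℝ] E), smul_pow, one_pow, smul_mul_assoc, one_mul], smul_smul]
  congr 1
  ring

/-- Over the symmetric interval the odd powers integrate to zero, which leaves the even series
defining `λ`. -/
theorem lambdaOp_eq_integral (B : E →L[ℝ] E) :
    lambdaOp B = ∫ t in (-(1 / 2) : ℝ)..(1 / 2), NormedSpace.exp (t • B) := by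
  have h := hasSum_integral_exp_smul B (-(1 / 2)) (1 / 2)
  rw [← h.tsum_eq, lambdaOp]
  have hinj : Function.Injective (fun k : ℕ => 2 * k) := fun a b hab => by simpa using hab
  rw [← hinj.tsum_eq (f := fun k : ℕ =>
    (((1 / 2 : ℝ) ^ (k + 1) - (-(1 / 2)) ^ (k + 1)) / ((k + 1).factorial : ℝ)) • B ^ k)]
  · refine tsum_congr fun k => ?_
    congr 1
    have h1 : (-(1 / 2 : ℝ)) ^ (2 * k + 1) = -((1 / 2 : ℝ) ^ (2 * k + 1)) :=
      Odd.neg_pow ⟨k, rfl⟩ _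
    rw [h1, pow_succ, pow_mul]
    have : ((2 * k + 1).factorial : ℝ) ≠ 0 := by positivity
    norm_num
    field_simp
    rw [← mul_pow]; norm_num
  · intro k hk
    rcases Nat.even_or_odd k with he | ho
    · obtain ⟨m, rfl⟩ := he
      exact ⟨m, by simp; ring⟩
    · exfalso
      apply hk
      have : Even (k + 1) := by
        obtain ⟨m, rfl⟩ := ho
        exact ⟨m + 1, by ring⟩
      simp only
      rw [this.neg_pow, sub_self, zero_div, zero_smul]

theorem phiOp_eq_exp_mul_lambdaOp (B : E →L[ℝ] E) :
    phiOp B = NormedSpace.exp (-((1 / 2 : ℝ) • B)) * lambdaOp B := by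
  rw [phiOp_eq_integral, lambdaOp_eq_integral, mul_integral_exp_smul]
  have h := intervalIntegral.integral_comp_sub_left (a := (-(1 / 2) : ℝ)) (b := 1 / 2)
    (fun t : ℝ => NormedSpace.exp (-(t • B))) (1 / 2)
  norm_num at h
  rw [← h]
  refine intervalIntegral.integral_congr fun t _ => ?_
  rw [← neg_smul, ← neg_smul, exp_smul_mul_exp_smul]
  congr 2
  ring

/-- This is `λ(2x) = cosh(x/2) λ(x)`. The integral over `[-1, 1]` splits at `0` into two unit
intervals, each a shift by `±1/2` of the interval for `λ`. -/
theorem lambdaOp_two_smul (B : E →L[ℝ] E) :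
    lambdaOp ((2 : ℝ) • B) = ((1 / 2 : ℝ) • (NormedSpace.exp ((1 / 2 : ℝ) • B) +
      NormedSpace.exp (-((1 / 2 : ℝ) • B)))) * lambdaOp B := by
  have hi : ∀ a b : ℝ, IntervalIntegrable (fun t : ℝ => NormedSpace.exp (t • B)) volume a b :=
    fun a b => (continuous_exp_smul B).intervalIntegrable a b
  have h1 : lambdaOp ((2 : ℝ) • B) = (1 / 2 : ℝ) • ∫ t in (-1 : ℝ)..1, NormedSpace.exp (t • B) := by
    rw [lambdaOp_eq_integral]
    have h := intervalIntegral.integral_comp_mul_right (a := (-(1 / 2) : ℝ)) (b := 1 / 2)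
      (fun t : ℝ => NormedSpace.exp (t • B)) (two_ne_zero)
    norm_num at h
    norm_num
    rw [← h]
    refine intervalIntegral.integral_congr fun t _ => ?_
    simp only [smul_smul]
  have h2 : NormedSpace.exp ((1 / 2 : ℝ) • B) * lambdaOp B =
      ∫ t in (0 : ℝ)..1, NormedSpace.exp (t • B) := by
    rw [lambdaOp_eq_integral, mul_integral_exp_smul]
    have h := intervalIntegral.integral_comp_add_left (a := (-(1 / 2) : ℝ)) (b := 1 / 2)
      (fun t : ℝ => NormedSpace.exp (t • B)) (1 / 2)
    norm_num at h
    rw [← h]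
    refine intervalIntegral.integral_congr fun t _ => ?_
    rw [exp_smul_mul_exp_smul]
  have h3 : NormedSpace.exp (-((1 / 2 : ℝ) • B)) * lambdaOp B =
      ∫ t in (-1 : ℝ)..0, NormedSpace.exp (t • B) := by
    rw [lambdaOp_eq_integral, mul_integral_exp_smul]
    have h := intervalIntegral.integral_comp_add_left (a := (-(1 / 2) : ℝ)) (b := 1 / 2)
      (fun t : ℝ => NormedSpace.exp (t • B)) (-(1 / 2))
    norm_num at h
    rw [← h]
    refine intervalIntegral.integral_congr fun t _ => ?_
    rw [← neg_smul, exp_smul_mul_exp_smul]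
  rw [h1, smul_mul_assoc, add_mul, h2, h3, add_comm,
    intervalIntegral.integral_add_adjacent_intervals (hi _ _) (hi _ _)]

theorem lambdaOp_neg (B : E →L[ℝ] E) : lambdaOp (-B) = lambdaOp B := by
  unfold lambdaOp
  refine tsum_congr fun k => ?_
  rw [(even_two_mul k).neg_pow]

theorem continuous_lambdaOp : Continuous (lambdaOp : (E →L[ℝ] E) → (E →L[ℝ] E)) := by
  have : (lambdaOp : (E →L[ℝ] E) → (E →L[ℝ] E)) =
      fun B => ∫ t in (-(1 / 2) : ℝ)..(1 / 2), NormedSpace.exp (t • B) :=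
    funext lambdaOp_eq_integral
  rw [this]
  refine intervalIntegral.continuous_parametric_intervalIntegral_of_continuous' ?_ _ _
  let : NormedAlgebra ℚ (E →L[ℝ] E) := .restrictScalars ℚ ℝ _
  exact NormedSpace.exp_continuous.comp (continuous_snd.smul continuous_fst)

end OperatorFunctions


/-! ### The formula `d exp = φ(ad)`. -/

section DerivExp

variable {E : Type*} [NormedAddCommGroup E] [InnerProductSpace ℝ E] [FiniteDimensional ℝ E]
  {G : Type*} [TopologicalSpace G] [T2Space G] [ChartedSpace E G] [Group G]
  [LieGroup 𝓘(ℝ, E) ∞ G]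

theorem ad_smul (c : ℝ) (X : E) : ad G (c • X) = c • ad G X := by
  ext Y
  have h1 : ((c • X, 0) : E × E) = c • (X, 0) := by simp
  have h2 : ((0, c • X) : E × E) = c • (0, X) := by simp
  rw [smul_apply, ad_apply, ad_apply, h1, h2, map_smul, map_smul]
  simp only [smul_apply, smul_sub]

theorem ad_add (X X' : E) : ad G (X + X') = ad G X + ad G X' := by
  ext Y
  have h1 : ((X + X', 0) : E × E) = (X, 0) + (X', 0) := by simp
  have h2 : ((0, X + X') : E × E) = (0, X) + (0, X') := by simp
  rw [add_apply, ad_apply, ad_apply, ad_apply, h1, h2, map_add, map_add]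
  simp only [add_apply]
  abel

theorem ad_neg (X : E) : ad G (-X) = -ad G X := by
  simpa using ad_smul (G := G) (-1) X

theorem continuous_ad : Continuous (ad G : E → E →L[ℝ] E) :=
  (LinearMap.toContinuousLinearMap
    ({ toFun := ad G, map_add' := ad_add, map_smul' := ad_smul } : E →ₗ[ℝ] E →L[ℝ] E)).continuous

theorem hasDerivAt_Ad_lieExp (X : E) (t : ℝ) :
    HasDerivAt (fun t : ℝ => (Ad (lieExp G (t • X)) : E →L[ℝ] E))
      (Ad (lieExp G (t • X)) * ad G X) t := by
  have h0 := (hasDerivAt_Ad_lieExp_zero (G := G) X)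
  have h1 : HasDerivAt (fun u : ℝ => (Ad (lieExp G ((u - t) • X)) : E →L[ℝ] E)) (ad G X) t := by
    have h0' : HasDerivAt (fun t : ℝ => (Ad (lieExp G (t • X)) : E →L[ℝ] E)) (ad G X) (t - t) := by
      rwa [sub_self]
    exact h0'.comp_sub_const t t
  have h2 := h1.const_mul (Ad (lieExp G (t • X)) : E →L[ℝ] E)
  refine h2.congr_of_eventuallyEq (Eventually.of_forall fun u => ?_)
  simp only
  have : u = t + (u - t) := by ring
  conv_lhs => rw [this, lieExp_add_smul, Ad_mul]
  rfl

/-- The product `Ad (exp (tX)) * exp (-t ad X)` has zero derivative in `t` and equals `1` at `t =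
0`. -/
theorem Ad_lieExp (X : E) : (Ad (lieExp G X) : E →L[ℝ] E) = NormedSpace.exp (ad G X) := by
  let : NormedAlgebra ℚ (E →L[ℝ] E) := .restrictScalars ℚ ℝ _
  have hd : ∀ t : ℝ, HasDerivAt (fun t : ℝ => (Ad (lieExp G (t • X)) : E →L[ℝ] E) *
      NormedSpace.exp (t • -ad G X)) 0 t := by
    intro t
    refine ((hasDerivAt_Ad_lieExp X t).mul
      (hasDerivAt_exp_smul_const' (-ad G X) t)).congr_deriv ?_
    simp [mul_assoc]
  have hc := is_const_of_deriv_eq_zero (fun t => (hd t).differentiableAt) (fun t => (hd t).deriv)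
    1 0
  simp only [one_smul, zero_smul, lieExp_zero, Ad_one, NormedSpace.exp_zero, mul_one] at hc
  have h2 : NormedSpace.exp (-ad G X) * NormedSpace.exp (ad G X) = 1 := by
    rw [← NormedSpace.exp_add_of_commute ((Commute.refl (ad G X)).neg_left), neg_add_cancel,
      NormedSpace.exp_zero]
  calc (Ad (lieExp G X) : E →L[ℝ] E)
      = Ad (lieExp G X) * (NormedSpace.exp (-ad G X) * NormedSpace.exp (ad G X)) := by
        rw [h2, mul_one]
    _ = _ := by rw [← mul_assoc, hc, one_mul]

/-- The left-trivialized derivative of the exponential map at `X`. -/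
def dexp (G : Type*) [TopologicalSpace G] [ChartedSpace E G] [Group G] (X : E) : E →L[ℝ] E :=
  fderiv ℝ (fun Y => chart1 E G ((lieExp G X)⁻¹ * lieExp G Y)) X

theorem hasDerivAtOne_dexp (hs : ContMDiff 𝓘(ℝ, E) 𝓘(ℝ, E) ∞ (lieExp G : E → G)) (X : E) :
    HasDerivAtOne (fun Y => (lieExp G X)⁻¹ * lieExp G Y) (dexp G X) X :=
  hasDerivAtOne_of_contMDiffAt (by simp) ((contMDiff_const.mul hs) X)

theorem dexp_zero (hs : ContMDiff 𝓘(ℝ, E) 𝓘(ℝ, E) ∞ (lieExp G : E → G)) :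
    dexp G (0 : E) = 1 := by
  ext Y
  have h1 : HasDerivAt (fun t : ℝ => t • Y) Y 0 := by
    simpa using (hasDerivAt_id (0 : ℝ)).smul_const Y
  have h0 := hasDerivAtOne_dexp hs (0 : E)
  have h2 := HasDerivAtOne.comp (h := fun t : ℝ => t • Y) (x := (0 : ℝ))
    (by simpa only [zero_smul] using h0) h1.hasFDerivAt
  simp only [lieExp_zero, inv_one, one_mul] at h2
  have h3 := h2.unique (hasDerivAtOne_lieExp_smul (G := G) Y)
  have h4 := congrArg (fun A : ℝ →L[ℝ] E => A 1) h3
  simpa using h4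

theorem continuousAt_dexp_zero (hs : ContMDiff 𝓘(ℝ, E) 𝓘(ℝ, E) ∞ (lieExp G : E → G)) :
    ContinuousAt (dexp G : E → E →L[ℝ] E) 0 := by
  set h : E × E → E := fun p => chart1 E G ((lieExp G p.1)⁻¹ * lieExp G p.2) with hh
  have hcd : ContDiffAt ℝ ∞ h (0, 0) := by
    refine contDiffAt_chart1_comp (by simp) ?_
    have h1 : ContMDiff 𝓘(ℝ, E × E) 𝓘(ℝ, E) ∞ (fun p : E × E => lieExp G p.1) :=
      hs.comp contDiff_fst.contMDiff
    have h2 : ContMDiff 𝓘(ℝ, E × E) 𝓘(ℝ, E) ∞ (fun p : E × E => lieExp G p.2) :=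
      hs.comp contDiff_snd.contMDiff
    exact (h1.inv.mul h2) _
  have hdiag : Tendsto (fun X : E => (X, X)) (𝓝 0) (𝓝 (0, 0)) := by
    rw [nhds_prod_eq]; exact tendsto_id.prodMk tendsto_id
  have hev : ∀ᶠ X : E in 𝓝 0,
      dexp G X = (fderiv ℝ h (X, X)).comp (ContinuousLinearMap.inr ℝ E E) := by
    have := (hcd.of_le (m := 1) (by norm_cast)).eventually (by simp)
    filter_upwards [hdiag.eventually this] with X hX
    have h1 := HasFDerivAt.comp (g := h) (f := fun y : E => (X, y)) X
      (hX.differentiableAt (by simp)).hasFDerivAt (hasFDerivAt_prodMk_right (𝕜 := ℝ) X X)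
    exact h1.fderiv
  have hc : ContinuousAt (fderiv ℝ h) (0, 0) :=
    (hcd.fderiv_right (m := 0) (by norm_cast)).continuousAt
  have hc2 : ContinuousAt (fun X : E => (fderiv ℝ h (X, X)).comp (ContinuousLinearMap.inr ℝ E E))
      0 := by
    have : ContinuousAt (fun X : E => fderiv ℝ h (X, X)) 0 :=
      ContinuousAt.comp (g := fderiv ℝ h) (f := fun X : E => (X, X)) hc hdiag
    exact this.clm_comp continuousAt_const
  exact hc2.congr (hev.mono fun X hX => hX.symm)

/-- Differentiate `exp ((s+t)Y) = exp (sY) exp (tY)` at `Y = X`. After left trivialization the first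
factor is conjugated by `exp (-tX)`, which contributes `exp (-t ad X)`. -/
theorem dexp_add_smul (hs : ContMDiff 𝓘(ℝ, E) 𝓘(ℝ, E) ∞ (lieExp G : E → G)) (X : E) (s t : ℝ) :
    (s + t) • dexp G ((s + t) • X) =
      NormedSpace.exp (-(t • ad G X)) * (s • dexp G (s • X)) + t • dexp G (t • X) := by
  have hu : ∀ u : ℝ, HasDerivAtOne (fun Y => (lieExp G (u • X))⁻¹ * lieExp G (u • Y))
      (u • dexp G (u • X)) X := by
    intro u
    have h1 : HasFDerivAt (fun Y : E => u • Y) (u • ContinuousLinearMap.id ℝ E) X :=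
      (hasFDerivAt_id X).const_smul u
    have h2 := (hasDerivAtOne_dexp hs (u • X)).comp (h := fun Y : E => u • Y) h1
    convert h2 using 1
    ext v; simp
  have h3 := ((hu s).conj (lieExp G (t • X))⁻¹).mul (hu t)
  rw [← lieExp_neg, Ad_lieExp, ad_neg, ad_smul] at h3
  refine (hu (s + t)).unique (h3.congr (Eventually.of_forall fun Y => ?_))
  rw [lieExp_add_smul, lieExp_add_smul, lieExp_neg]
  group

/-- The cocycle relation determines `t ↦ t • dexp (tX)` from its derivative at `0`, for which
continuity of `dexp` at the origin suffices. Its derivative at `t` is `exp (-t ad X)`, and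
integration over `[0, 1]` gives `φ(ad X)`. -/
theorem dexp_eq_phiOp (hs : ContMDiff 𝓘(ℝ, E) 𝓘(ℝ, E) ∞ (lieExp G : E → G)) (X : E) :
    dexp G X = phiOp (ad G X) := by
  have hcont : ContinuousAt (fun s : ℝ => dexp G (s • X)) 0 := by
    have h1 : ContinuousAt (fun s : ℝ => s • X) 0 := by fun_prop
    refine ContinuousAt.comp (g := dexp G) (f := fun s : ℝ => s • X) ?_ h1
    simpa using continuousAt_dexp_zero hs
  have h0 : HasDerivAt (fun s : ℝ => s • dexp G (s • X)) 1 0 := by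
    rw [hasDerivAt_iff_tendsto_slope_zero]
    have h2 : Tendsto (fun s : ℝ => dexp G (s • X)) (𝓝[≠] 0) (𝓝 1) := by
      have := hcont.tendsto
      simp only [zero_smul, dexp_zero hs] at this
      exact this.mono_left nhdsWithin_le_nhds
    refine h2.congr' ?_
    filter_upwards [self_mem_nhdsWithin] with s hs'
    have : s ≠ 0 := hs'
    simp [smul_smul, this]
  have hd : ∀ t : ℝ, HasDerivAt (fun s : ℝ => s • dexp G (s • X))
      (NormedSpace.exp (-(t • ad G X))) t := by
    intro t
    have h1 : HasDerivAt (fun u : ℝ => (u - t) • dexp G ((u - t) • X)) 1 t := by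
      have h0' : HasDerivAt (fun s : ℝ => s • dexp G (s • X)) 1 (t - t) := by rwa [sub_self]
      exact h0'.comp_sub_const t t
    have h2 := (h1.const_mul (NormedSpace.exp (-(t • ad G X)))).add_const (t • dexp G (t • X))
    rw [mul_one] at h2
    refine h2.congr_of_eventuallyEq (Eventually.of_forall fun u => ?_)
    simp only
    rw [← dexp_add_smul hs]
    simp
  have hcontexp : Continuous fun t : ℝ => NormedSpace.exp (-(t • ad G X)) := by
    simpa using continuous_exp_smul (-ad G X)
  rw [phiOp_eq_integral, intervalIntegral.integral_eq_sub_of_hasDerivAt (fun t _ => hd t)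
    (hcontexp.intervalIntegrable 0 1)]
  simp

end DerivExp


/-! ### Logarithm charts and left translations in exponential coordinates. -/

section LogChart

variable {E : Type*} [NormedAddCommGroup E] [InnerProductSpace ℝ E] [FiniteDimensional ℝ E]
  [MeasurableSpace E] [BorelSpace E]
  {G : Type*} [TopologicalSpace G] [T2Space G] [SecondCountableTopology G] [ChartedSpace E G]
  [Group G] [LieGroup 𝓘(ℝ, E) ∞ G] {O : Set E}

theorem lieExp_lieLog {g : G} (hg : g ∈ lieExp G '' O) : lieExp G (lieLog O g) = g :=
  Function.invFunOn_eq hg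

theorem lieLog_mem {g : G} (hg : g ∈ lieExp G '' O) : lieLog O g ∈ O :=
  Function.invFunOn_mem hg

namespace IsWeaklyExponential

variable (hO : IsWeaklyExponential G O)

include hO

theorem lieLog_lieExp {X : E} (hX : X ∈ O) : lieLog O (lieExp G X) = X :=
  hO.injOn (lieLog_mem (mem_image_of_mem _ hX)) hX (lieExp_lieLog (mem_image_of_mem _ hX))

theorem contMDiff_exp : ContMDiff 𝓘(ℝ, E) 𝓘(ℝ, E) ∞ (lieExp G : E → G) :=
  contMDiff_lieExp hO.isOpen hO.zero_mem hO.smooth_exp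

theorem continuous_exp : Continuous (lieExp G : E → G) := hO.contMDiff_exp.continuous

theorem neg_mem {X : E} (hX : X ∈ O) : -X ∈ O := by
  simpa using hO.star X hX (-1) (by norm_num)

theorem neg_mem_iff {X : E} : -X ∈ O ↔ X ∈ O :=
  ⟨fun h => by simpa using hO.neg_mem h, hO.neg_mem⟩

theorem half_mem {X : E} (hX : X ∈ O) : (1 / 2 : ℝ) • X ∈ O :=
  hO.star X hX (1 / 2) (by norm_num)

theorem contMDiffAt_log {g : G} (hg : g ∈ lieExp G '' O) :
    ContMDiffAt 𝓘(ℝ, E) 𝓘(ℝ, E) ∞ (lieLog (G := G) O) g :=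
  hO.smooth_log.contMDiffAt (hO.isOpen_image.mem_nhds hg)

theorem exists_dexp_leftInverse {X : E} (hX : X ∈ O) :
    ∃ M : E →L[ℝ] E, M.comp (dexp G X) = ContinuousLinearMap.id ℝ E := by
  have hd : MDifferentiableAt 𝓘(ℝ, E) 𝓘(ℝ, E) (fun h : G => lieLog O (lieExp G X * h)) 1 := by
    have h1 : ContMDiffAt 𝓘(ℝ, E) 𝓘(ℝ, E) ∞ (lieLog (G := G) O) (lieExp G X * 1) := by
      rw [mul_one]; exact hO.contMDiffAt_log (mem_image_of_mem _ hX)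
    exact (h1.comp (1 : G) (contMDiff_mul_left (I := 𝓘(ℝ, E)) (n := ∞)).contMDiffAt).mdifferentiableAt
      (by simp)
  have h1 := mfderiv_one_eq_fderiv hd
  have h2 := hasDerivAtOne_dexp hO.contMDiff_exp X
  have h1' : HasFDerivAt (fun y => lieLog O (lieExp G X * (chart1 E G).symm y))
      (show E →L[ℝ] E from
        mfderiv 𝓘(ℝ, E) 𝓘(ℝ, E) (fun h : G => lieLog O (lieExp G X * h)) 1)
      (chart1 E G ((lieExp G X)⁻¹ * lieExp G X)) := by
    rw [inv_mul_cancel]; exact h1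
  have h3 := h1'.comp X h2.deriv
  refine ⟨_, h3.unique ((hasFDerivAt_id X).congr_of_eventuallyEq ?_)⟩
  filter_upwards [h2.eventually_mem_source, hO.isOpen.mem_nhds hX] with Y hY hYO
  simp only [Function.comp]
  rw [(chart1 E G).left_inv hY, mul_inv_cancel_left, hO.lieLog_lieExp hYO]
  rfl

theorem det_dexp_ne_zero {X : E} (hX : X ∈ O) : (dexp G X).det ≠ 0 := by
  obtain ⟨M, hM⟩ := hO.exists_dexp_leftInverse hX
  have h : M.det * (dexp G X).det = 1 := by
    have := congrArg ContinuousLinearMap.det hM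
    rw [ContinuousLinearMap.det, ContinuousLinearMap.det, ContinuousLinearMap.toLinearMap_comp,
      LinearMap.det_comp] at this
    simpa using this
  exact right_ne_zero_of_mul_eq_one h

/-- The domain of the translation by `g` in exponential coordinates. -/
theorem isOpen_translationDomain (g : G) : IsOpen {X ∈ O | g * lieExp G X ∈ lieExp G '' O} := by
  have : IsTopologicalGroup G := topologicalGroup_of_lieGroup 𝓘(ℝ, E) ∞
  exact hO.isOpen.inter
    (hO.isOpen_image.preimage (continuous_const.mul hO.continuous_exp))

/-- If `g exp Y = exp (Ψ Y)`, then left trivialization cancels `g`, so the chain rule reads `dexp (Ψ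
X) ∘ Ψ' = dexp X`. On determinants this is the transformation rule of a left-invariant density. -/
theorem exists_hasFDerivAt_translation (g : G) {X : E} (hX : X ∈ O)
    (hg : g * lieExp G X ∈ lieExp G '' O) :
    ∃ Ψ' : E →L[ℝ] E, HasFDerivAt (fun Y => lieLog O (g * lieExp G Y)) Ψ' X ∧
      (dexp G (lieLog O (g * lieExp G X))).comp Ψ' = dexp G X := by
  have hs : ContMDiffAt 𝓘(ℝ, E) 𝓘(ℝ, E) ∞ (fun Y => lieLog O (g * lieExp G Y)) X :=
    ContMDiffAt.comp (g := lieLog (G := G) O) (f := fun Y => g * lieExp G Y) X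
      (hO.contMDiffAt_log hg) ((contMDiff_const.mul hO.contMDiff_exp) X)
  have hd := (hs.contDiffAt.differentiableAt (by simp)).hasFDerivAt
  refine ⟨_, hd, ?_⟩
  have h1 := (hasDerivAtOne_dexp hO.contMDiff_exp (lieLog O (g * lieExp G X))).comp
    (h := fun Y => lieLog O (g * lieExp G Y)) (x := X) hd
  refine h1.unique ((hasDerivAtOne_dexp hO.contMDiff_exp X).congr ?_)
  filter_upwards [(hO.isOpen_translationDomain g).mem_nhds ⟨hX, hg⟩] with Y hY
  rw [lieExp_lieLog hg, lieExp_lieLog hY.2]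
  group

/-- `h ↦ log (g⁻¹ h)`, as an open partial homeomorphism. -/
def translatedLog (g : G) : OpenPartialHomeomorph G E where
  toFun h := lieLog O (g⁻¹ * h)
  invFun X := g * lieExp G X
  source := {h | g⁻¹ * h ∈ lieExp G '' O}
  target := O
  map_source' h hh := lieLog_mem hh
  map_target' X hX := by simpa using mem_image_of_mem _ hX
  left_inv' h hh := by simp [lieExp_lieLog hh]
  right_inv' X hX := by simp [hO.lieLog_lieExp hX]
  open_source := by
    have : IsTopologicalGroup G := topologicalGroup_of_lieGroup 𝓘(ℝ, E) ∞
    exact hO.isOpen_image.preimage (continuous_const.mul continuous_id)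
  open_target := hO.isOpen
  continuousOn_toFun := by
    have : IsTopologicalGroup G := topologicalGroup_of_lieGroup 𝓘(ℝ, E) ∞
    exact hO.smooth_log.continuousOn.comp (continuous_const.mul continuous_id).continuousOn
      (fun h hh => hh)
  continuousOn_invFun := by
    have : IsTopologicalGroup G := topologicalGroup_of_lieGroup 𝓘(ℝ, E) ∞
    exact (continuous_const.mul hO.continuous_exp).continuousOn

theorem translatedLog_mem_maximalAtlas (g : G) :
    translatedLog hO g ∈ IsManifold.maximalAtlas 𝓘(ℝ, E) ∞ G := by
  refine (translatedLog hO g).mem_maximalAtlas_of_contMDiffOn ?_ ?_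
  · intro h hh
    exact (ContMDiffAt.comp (g := lieLog (G := G) O) (f := fun h => g⁻¹ * h) h
      (hO.contMDiffAt_log hh)
      (contMDiff_mul_left (I := 𝓘(ℝ, E)) (n := ∞)).contMDiffAt).contMDiffWithinAt
  · exact (contMDiff_const.mul hO.contMDiff_exp).contMDiffOn

/-- The null-set assumption on the complement of `exp O` is stated for charts of the maximal atlas.
The set in question is the image of that complement under the chart `h ↦ log (g⁻¹ h)`. -/
theorem volume_translation_compl (g : G) :
    volume {X ∈ O | g * lieExp G X ∉ lieExp G '' O} = 0 := by
  refine measure_mono_null ?_ (hO.measureZero _ (hO.translatedLog_mem_maximalAtlas g))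
  rintro X ⟨hX, hg⟩
  refine ⟨g * lieExp G X, ⟨hg, ?_⟩, ?_⟩
  · simpa [translatedLog] using mem_image_of_mem _ hX
  · simp [translatedLog, hO.lieLog_lieExp hX]

end IsWeaklyExponential

end LogChart


/-! ### Haar measure in exponential coordinates. -/

section HaarFormula

variable {E : Type*} [NormedAddCommGroup E] [InnerProductSpace ℝ E] [FiniteDimensional ℝ E]
  [MeasurableSpace E] [BorelSpace E]
  {G : Type*} [TopologicalSpace G] [T2Space G] [SecondCountableTopology G] [ChartedSpace E G]
  [Group G] [LieGroup 𝓘(ℝ, E) ∞ G] [MeasurableSpace G] [BorelSpace G] {O : Set E}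

/-- The absolute value of the Jacobian of the exponential map, trivialized by left
translations. -/
def expDensity (G : Type*) [TopologicalSpace G] [ChartedSpace E G]
    [Group G] [LieGroup 𝓘(ℝ, E) ∞ G] (X : E) : ℝ :=
  |(phiOp (ad G X)).det|

theorem continuous_expDensity : Continuous (expDensity G : E → ℝ) := by
  let : NormedAlgebra ℚ (E →L[ℝ] E) := .restrictScalars ℚ ℝ _
  have h1 : Continuous fun X : E => phiOp (ad G X) := by
    simp only [phiOp_eq_exp_mul_lambdaOp]
    exact (NormedSpace.exp_continuous.comp ((continuous_ad (E := E) (G := G)).const_smul (1 / 2 : ℝ)).neg).mul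
      (continuous_lambdaOp.comp (continuous_ad (E := E) (G := G)))
  exact (ContinuousLinearMap.continuous_det.comp h1).abs

theorem expDensity_nonneg (X : E) : 0 ≤ expDensity G X := abs_nonneg _

theorem expDensity_zero : expDensity G (0 : E) = 1 := by
  have : ad G (0 : E) = 0 := by simpa using ad_smul (G := G) (0 : ℝ) (0 : E)
  rw [expDensity, this, phiOp_eq_integral]
  simp [NormedSpace.exp_zero, ContinuousLinearMap.det]

/-- Lebesgue measure on `O` times the Jacobian of the exponential map. -/
def expMeasure (G : Type*) [TopologicalSpace G] [ChartedSpace E G]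
    [Group G] [LieGroup 𝓘(ℝ, E) ∞ G] (O : Set E) : Measure E :=
  (volume.restrict O).withDensity fun X => ENNReal.ofReal (expDensity G X)

theorem measurable_ofReal_expDensity :
    Measurable fun X : E => ENNReal.ofReal (expDensity G X) :=
  (ENNReal.continuous_ofReal.comp continuous_expDensity).measurable

theorem expMeasure_apply {A : Set E} (hA : MeasurableSet A) :
    expMeasure G O A = ∫⁻ X in A ∩ O, ENNReal.ofReal (expDensity G X) := by
  rw [expMeasure, withDensity_apply _ hA, Measure.restrict_restrict hA]

theorem tendsto_average_expDensity :
    Tendsto (fun r : ℝ => (∫⁻ X in Metric.ball (0 : E) r, ENNReal.ofReal (expDensity G X)) /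
      volume (Metric.ball (0 : E) r)) (𝓝[>] 0) (𝓝 1) := by
  have hc : ContinuousAt (fun X : E => ENNReal.ofReal (expDensity G X)) 0 :=
    (ENNReal.continuous_ofReal.comp continuous_expDensity).continuousAt
  have h0 : ENNReal.ofReal (expDensity G (0 : E)) = 1 := by simp [expDensity_zero]
  have hball : ∀ {p : E → Prop}, (∀ᶠ X in 𝓝 0, p X) →
      ∀ᶠ r : ℝ in 𝓝[>] 0, 0 < r ∧ ∀ X ∈ Metric.ball (0 : E) r, p X := by
    intro p hp
    obtain ⟨ε, hε, h⟩ := Metric.eventually_nhds_iff_ball.1 hp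
    filter_upwards [self_mem_nhdsWithin, nhdsWithin_le_nhds (Iio_mem_nhds hε)] with r hr hr'
    exact ⟨hr, fun X hX => h X (Metric.ball_subset_ball (le_of_lt hr') hX)⟩
  have hv : ∀ r : ℝ, 0 < r → volume (Metric.ball (0 : E) r) ≠ 0 := fun r hr =>
    (Metric.measure_ball_pos volume _ hr).ne'
  have hv' : ∀ r : ℝ, volume (Metric.ball (0 : E) r) ≠ ⊤ := fun r => measure_ball_lt_top.ne
  refine tendsto_order.2 ⟨fun a ha => ?_, fun a ha => ?_⟩
  · obtain ⟨b, hab, hb⟩ := exists_between ha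
    have : ∀ᶠ X in 𝓝 (0 : E), b < ENNReal.ofReal (expDensity G X) :=
      hc.eventually (lt_mem_nhds (hb.trans_eq h0.symm))
    filter_upwards [hball this] with r ⟨hr, h⟩
    refine hab.trans_le ?_
    rw [ENNReal.le_div_iff_mul_le (Or.inl (hv r hr)) (Or.inl (hv' r)), ← setLIntegral_const]
    exact setLIntegral_mono' Metric.isOpen_ball.measurableSet fun X hX => (h X hX).le
  · obtain ⟨b, hb, hab⟩ := exists_between ha
    have : ∀ᶠ X in 𝓝 (0 : E), ENNReal.ofReal (expDensity G X) < b :=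
      hc.eventually (gt_mem_nhds (h0.trans_lt hb))
    filter_upwards [hball this] with r ⟨hr, h⟩
    refine lt_of_le_of_lt ?_ hab
    rw [ENNReal.div_le_iff (hv r hr) (hv' r), ← setLIntegral_const]
    exact setLIntegral_mono' Metric.isOpen_ball.measurableSet fun X hX => (h X hX).le

namespace IsWeaklyExponential

variable (hO : IsWeaklyExponential G O)

include hO

theorem expDensity_pos {X : E} (hX : X ∈ O) : 0 < expDensity G X := by
  rw [expDensity, ← dexp_eq_phiOp hO.contMDiff_exp]
  exact abs_pos.2 (hO.det_dexp_ne_zero hX)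

/-- Change of variables along `Y ↦ log (g exp Y)`, injective where it is defined; the density
absorbs the Jacobian by the chain rule for `dexp`. -/
theorem setLIntegral_translation (g : G) {A : Set G} (hA : MeasurableSet A) :
    ∫⁻ X in {X ∈ O | g * lieExp G X ∈ lieExp G '' O ∧ g * lieExp G X ∈ A},
      ENNReal.ofReal (expDensity G X) =
    ∫⁻ X in {X ∈ O | g⁻¹ * lieExp G X ∈ lieExp G '' O ∧ lieExp G X ∈ A},
      ENNReal.ofReal (expDensity G X) := by
  have : IsTopologicalGroup G := topologicalGroup_of_lieGroup 𝓘(ℝ, E) ∞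
  set S := {X ∈ O | g * lieExp G X ∈ lieExp G '' O ∧ g * lieExp G X ∈ A} with hS
  set Ψ : E → E := fun Y => lieLog O (g * lieExp G Y) with hΨ
  have hSm : MeasurableSet S := by
    have h1 : S = {X ∈ O | g * lieExp G X ∈ lieExp G '' O} ∩
        (fun X => g * lieExp G X) ⁻¹' A := by
      ext X; exact and_assoc.symm
    rw [h1]
    exact (hO.isOpen_translationDomain g).measurableSet.inter
      ((continuous_const.mul hO.continuous_exp).measurable hA)
  have himg : Ψ '' S = {X ∈ O | g⁻¹ * lieExp G X ∈ lieExp G '' O ∧ lieExp G X ∈ A} := by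
    ext Y
    constructor
    · rintro ⟨X, ⟨hX, h1, h2⟩, rfl⟩
      refine ⟨lieLog_mem h1, ?_, ?_⟩
      · rw [lieExp_lieLog h1, inv_mul_cancel_left]; exact mem_image_of_mem _ hX
      · rwa [lieExp_lieLog h1]
    · rintro ⟨hY, h1, h2⟩
      refine ⟨lieLog O (g⁻¹ * lieExp G Y), ⟨lieLog_mem h1, ?_, ?_⟩, ?_⟩
      · rw [lieExp_lieLog h1, mul_inv_cancel_left]; exact mem_image_of_mem _ hY
      · rwa [lieExp_lieLog h1, mul_inv_cancel_left]
      · simp only [hΨ]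
        rw [lieExp_lieLog h1, mul_inv_cancel_left, hO.lieLog_lieExp hY]
  have hinj : InjOn Ψ S := by
    rintro X ⟨hX, h1, -⟩ Y ⟨hY, h2, -⟩ hXY
    have := congrArg (lieExp G) hXY
    simp only [hΨ] at this
    rw [lieExp_lieLog h1, lieExp_lieLog h2] at this
    exact hO.injOn hX hY (mul_left_cancel this)
  have hex : ∀ X : E, ∃ Ψ' : E →L[ℝ] E, X ∈ S → HasFDerivAt Ψ Ψ' X ∧
      (dexp G (Ψ X)).comp Ψ' = dexp G X := by
    intro X
    by_cases hX : X ∈ S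
    · obtain ⟨Ψ', h1, h2⟩ := hO.exists_hasFDerivAt_translation g hX.1 hX.2.1
      exact ⟨Ψ', fun _ => ⟨h1, h2⟩⟩
    · exact ⟨0, fun h => absurd h hX⟩
  choose Ψ' hΨ' using hex
  rw [← himg, lintegral_image_eq_lintegral_abs_det_fderiv_mul volume hSm
    (fun X hX => (hΨ' X hX).1.hasFDerivWithinAt) hinj]
  refine setLIntegral_congr_fun hSm fun X hX => ?_
  rw [← ENNReal.ofReal_mul (abs_nonneg _)]
  congr 1
  have h2 := congrArg ContinuousLinearMap.det (hΨ' X hX).2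
  rw [dexp_eq_phiOp hO.contMDiff_exp, dexp_eq_phiOp hO.contMDiff_exp, ContinuousLinearMap.det,
    ContinuousLinearMap.toLinearMap_comp, LinearMap.det_comp] at h2
  rw [expDensity, expDensity, ← h2, abs_mul, mul_comm]

theorem map_expMeasure_apply {A : Set G} (hA : MeasurableSet A) :
    (expMeasure G O).map (lieExp G) A =
      ∫⁻ X in {X ∈ O | lieExp G X ∈ A}, ENNReal.ofReal (expDensity G X) := by
  rw [Measure.map_apply hO.continuous_exp.measurable hA,
    expMeasure_apply (hO.continuous_exp.measurable hA), inter_comm]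
  rfl

theorem isMulLeftInvariant_map_expMeasure :
    ((expMeasure G O).map (lieExp G)).IsMulLeftInvariant := by
  have : IsTopologicalGroup G := topologicalGroup_of_lieGroup 𝓘(ℝ, E) ∞
  have measurable_const_mul' : ∀ g : G, Measurable fun h : G => g * h := fun g =>
    (continuous_const.mul continuous_id).measurable
  -- Translation by `g` matches only the points whose translates stay in `exp O`; the points lost on
  -- either side form a null set.
  have hnull : ∀ (g : G) (A : Set E),
      ∫⁻ X in O ∩ A, ENNReal.ofReal (expDensity G X) =
      ∫⁻ X in {X ∈ O | g * lieExp G X ∈ lieExp G '' O ∧ X ∈ A},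
        ENNReal.ofReal (expDensity G X) := by
    intro g A
    refine (setLIntegral_congr ?_).symm
    refine ae_eq_set.2 ⟨?_, ?_⟩
    · convert! measure_empty (μ := (volume : Measure E)) using 2
      ext X; simp +contextual
    · refine measure_mono_null ?_ (hO.volume_translation_compl g)
      rintro X ⟨⟨h1, h2⟩, h3⟩
      exact ⟨h1, fun h4 => h3 ⟨h1, h4, h2⟩⟩
  refine ⟨fun g => ?_⟩
  ext A hA
  have hgA : MeasurableSet ((fun h : G => g * h) ⁻¹' A) :=
    (measurable_const_mul' g) hA
  rw [Measure.map_apply (measurable_const_mul' g) hA,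
    hO.map_expMeasure_apply hgA, hO.map_expMeasure_apply hA]
  have h1 := hnull g {X | g * lieExp G X ∈ A}
  have h2 := hnull g⁻¹ {X | lieExp G X ∈ A}
  have h3 := hO.setLIntegral_translation g hA
  calc _ = ∫⁻ X in O ∩ {X | g * lieExp G X ∈ A}, ENNReal.ofReal (expDensity G X) := rfl
    _ = _ := h1.trans (h3.trans h2.symm)

theorem isCompact_closure_log {K : Set G} (hK : IsCompact K) :
    IsCompact (closure (lieLog O '' (K ∩ lieExp G '' O))) :=
  hO.precompact _ inter_subset_right
    (hK.of_isClosed_subset isClosed_closure (closure_minimal inter_subset_left hK.isClosed))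

theorem mem_closure_log {K : Set G} {X : E} (hX : X ∈ O) (hK : lieExp G X ∈ K) :
    X ∈ closure (lieLog O '' (K ∩ lieExp G '' O)) :=
  subset_closure ⟨lieExp G X, ⟨hK, mem_image_of_mem _ hX⟩, hO.lieLog_lieExp hX⟩

/-- This is where the precompactness of logarithms is needed: the part of a compact set inside `exp
O` lifts into a compact set, on which the continuous density is integrable. -/
theorem isFiniteMeasureOnCompacts_map_expMeasure :
    IsFiniteMeasureOnCompacts ((expMeasure G O).map (lieExp G)) := by
  refine ⟨fun K hK => ?_⟩
  rw [hO.map_expMeasure_apply hK.measurableSet]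
  have hC := hO.isCompact_closure_log hK
  refine (lintegral_mono_set (t := closure (lieLog O '' (K ∩ lieExp G '' O)))
    fun X hX => hO.mem_closure_log hX.1 hX.2).trans_lt ?_
  exact ((continuous_expDensity (G := G)).continuousOn.integrableOn_compact hC).lintegral_lt_top

theorem exists_eq_smul_map_expMeasure (μ : Measure G) [μ.IsHaarMeasure] :
    ∃ c : ℝ≥0∞, c ≠ 0 ∧ c ≠ ⊤ ∧ μ = c • (expMeasure G O).map (lieExp G) := by
  have : IsTopologicalGroup G := topologicalGroup_of_lieGroup 𝓘(ℝ, E) ∞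
  have : ProperSpace E := FiniteDimensional.proper_real E
  have : LocallyCompactSpace G := ChartedSpace.locallyCompactSpace E G
  have := hO.isMulLeftInvariant_map_expMeasure
  have := hO.isFiniteMeasureOnCompacts_map_expMeasure
  have h := Measure.isMulLeftInvariant_eq_smul ((expMeasure G O).map (lieExp G)) μ
  set c := Measure.haarScalarFactor ((expMeasure G O).map (lieExp G)) μ with hc
  have hc0 : c ≠ 0 := by
    intro h0
    rw [h0, zero_smul] at h
    have h1 : (expMeasure G O).map (lieExp G) univ = 0 := by rw [h]; simp
    rw [hO.map_expMeasure_apply MeasurableSet.univ] at h1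
    simp only [mem_univ, and_true, ofPred_mem_eq] at h1
    rw [setLIntegral_eq_zero_iff hO.isOpen.measurableSet measurable_ofReal_expDensity] at h1
    have h2 : volume O = 0 := by
      refine measure_mono_null ?_ h1
      intro X hX h3
      have := h3 hX
      simp only [ENNReal.ofReal_eq_zero] at this
      exact absurd (hO.expDensity_pos hX) (not_lt.2 this)
    exact (hO.isOpen.measure_pos volume ⟨0, hO.zero_mem⟩).ne' h2
  refine ⟨((c⁻¹ : NNReal) : ℝ≥0∞), ?_, ENNReal.coe_ne_top, ?_⟩
  · simpa using hc0
  · conv_rhs => rw [h]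
    rw [← ENNReal.smul_def, smul_smul, inv_mul_cancel₀ hc0, one_smul]

/-- For small `r` the ball lies in `O`, where `exp` is injective. The measure of its image is then
`c` times the integral of the density over the ball, and the density is continuous with value `1` at
`0`. -/
theorem haarDensity_eq {μ : Measure G} {c : ℝ≥0∞} (hc : c ≠ ⊤)
    (hμ : μ = c • (expMeasure G O).map (lieExp G)) : haarDensity E μ = c := by
  have : IsTopologicalGroup G := topologicalGroup_of_lieGroup 𝓘(ℝ, E) ∞
  have ht := ENNReal.Tendsto.const_mul (a := c) (tendsto_average_expDensity (E := E) (G := G))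
    (Or.inr hc)
  rw [mul_one] at ht
  refine Tendsto.limUnder_eq (ht.congr' ?_)
  obtain ⟨ε, hε, hεO⟩ := Metric.isOpen_iff.1 hO.isOpen 0 hO.zero_mem
  filter_upwards [self_mem_nhdsWithin, nhdsWithin_le_nhds (Iio_mem_nhds hε)] with r hr hr'
  have hsub : Metric.ball (0 : E) r ⊆ O := (Metric.ball_subset_ball (le_of_lt hr')).trans hεO
  have hopen : IsOpen (lieExp G '' Metric.ball (0 : E) r) := by
    have e : lieExp G '' Metric.ball (0 : E) r =
        lieExp G '' O ∩ lieLog (G := G) O ⁻¹' Metric.ball (0 : E) r := by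
      ext g
      constructor
      · rintro ⟨X, hX, rfl⟩
        exact ⟨mem_image_of_mem _ (hsub hX), by
          rw [mem_preimage, hO.lieLog_lieExp (hsub hX)]; exact hX⟩
      · rintro ⟨h1, h2⟩
        exact ⟨_, h2, lieExp_lieLog h1⟩
    rw [e]
    exact hO.smooth_log.continuousOn.isOpen_inter_preimage hO.isOpen_image Metric.isOpen_ball
  rw [hμ, Measure.smul_apply, hO.map_expMeasure_apply hopen.measurableSet, smul_eq_mul,
    mul_div_assoc]
  have hset : {X ∈ O | lieExp G X ∈ lieExp G '' Metric.ball (0 : E) r} = Metric.ball (0 : E) r := by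
    ext X
    constructor
    · rintro ⟨hX, Y, hY, hXY⟩
      rwa [← hO.injOn (hsub hY) hX hXY]
    · exact fun hX => ⟨hsub hX, mem_image_of_mem _ hX⟩
  rw [hset]

/-- The Haar measure in exponential coordinates. -/
theorem haarDensity_spec (μ : Measure G) [μ.IsHaarMeasure] :
    haarDensity E μ ≠ 0 ∧ haarDensity E μ ≠ ⊤ ∧
      μ = (haarDensity E μ • expMeasure G O).map (lieExp G) := by
  obtain ⟨c, h0, ht, h⟩ := hO.exists_eq_smul_map_expMeasure μ
  have := hO.haarDensity_eq ht h
  rw [this, Measure.map_smul]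
  exact ⟨h0, ht, h⟩

end IsWeaklyExponential

end HaarFormula


/-! ### The scalar functions `|det λ|`, `|det cosh|` and `|det exp|` of `ad X`. -/

section Scalars

variable {E : Type*} [NormedAddCommGroup E] [InnerProductSpace ℝ E] [FiniteDimensional ℝ E]
  {G : Type*} [TopologicalSpace G] [T2Space G] [ChartedSpace E G] [Group G]
  [LieGroup 𝓘(ℝ, E) ∞ G]

/-- `|det λ(ad X)|`. -/
def lambdaDet (G : Type*) [TopologicalSpace G] [ChartedSpace E G]
    [Group G] [LieGroup 𝓘(ℝ, E) ∞ G] (X : E) : ℝ :=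
  |(lambdaOp (ad G X)).det|

/-- `|det cosh(ad X / 2)|`. -/
def coshDet (G : Type*) [TopologicalSpace G] [ChartedSpace E G]
    [Group G] [LieGroup 𝓘(ℝ, E) ∞ G] (X : E) : ℝ :=
  |((1 / 2 : ℝ) • (NormedSpace.exp ((1 / 2 : ℝ) • ad G X) +
    NormedSpace.exp (-((1 / 2 : ℝ) • ad G X)))).det|

/-- `|det exp(ad X / 2)|`. -/
def expDet (G : Type*) [TopologicalSpace G] [ChartedSpace E G]
    [Group G] [LieGroup 𝓘(ℝ, E) ∞ G] (X : E) : ℝ :=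
  |(NormedSpace.exp ((1 / 2 : ℝ) • ad G X)).det|

theorem abs_det_mul (A B : E →L[ℝ] E) : |(A * B).det| = |A.det| * |B.det| := by
  rw [← abs_mul]
  congr 1
  exact LinearMap.det_comp _ _

theorem continuous_lambdaDet : Continuous (lambdaDet G : E → ℝ) :=
  (ContinuousLinearMap.continuous_det.comp
    (continuous_lambdaOp.comp (continuous_ad (E := E) (G := G)))).abs

theorem continuous_exp_half_ad :
    Continuous fun X : E => NormedSpace.exp ((1 / 2 : ℝ) • ad G X) := by
  let : NormedAlgebra ℚ (E →L[ℝ] E) := .restrictScalars ℚ ℝ _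
  exact NormedSpace.exp_continuous.comp ((continuous_ad (E := E) (G := G)).const_smul (1 / 2 : ℝ))

theorem continuous_coshDet : Continuous (coshDet G : E → ℝ) := by
  have h1 := continuous_exp_half_ad (E := E) (G := G)
  have h2 := h1.comp continuous_neg
  simp only [Function.comp_def, ad_neg, smul_neg] at h2
  exact (ContinuousLinearMap.continuous_det.comp ((h1.add h2).const_smul (1 / 2 : ℝ))).abs

theorem continuous_expDet : Continuous (expDet G : E → ℝ) :=
  (ContinuousLinearMap.continuous_det.comp continuous_exp_half_ad).abs

theorem expDet_add_smul (X : E) (s t : ℝ) :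
    expDet G ((s + t) • X) = expDet G (s • X) * expDet G (t • X) := by
  simp only [expDet, ad_smul, smul_smul]
  rw [← abs_det_mul, exp_smul_mul_exp_smul, mul_add]

theorem expDet_zero : expDet G (0 : E) = 1 := by
  have : ad G (0 : E) = 0 := by simpa using ad_smul (G := G) (0 : ℝ) (0 : E)
  rw [expDet, this]
  simp [NormedSpace.exp_zero, ContinuousLinearMap.det]

theorem expDet_neg_mul (X : E) : expDet G (-X) * expDet G X = 1 := by
  have := expDet_add_smul (G := G) X (-1) 1
  simpa [expDet_zero] using this.symm

theorem expDet_pos (X : E) : 0 < expDet G X :=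
  lt_of_le_of_ne (abs_nonneg _) (right_ne_zero_of_mul_eq_one (expDet_neg_mul X)).symm

theorem expDet_neg (X : E) : expDet G (-X) = (expDet G X)⁻¹ :=
  eq_inv_of_mul_eq_one_left (expDet_neg_mul X)

theorem expDet_two_smul (X : E) : expDet G ((2 : ℝ) • X) = expDet G X ^ 2 := by
  have := expDet_add_smul (G := G) X 1 1
  rw [one_smul] at this
  rw [pow_two, ← this]
  norm_num

theorem lambdaDet_nonneg (X : E) : 0 ≤ lambdaDet G X := abs_nonneg _

theorem coshDet_nonneg (X : E) : 0 ≤ coshDet G X := abs_nonneg _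

theorem lambdaDet_neg (X : E) : lambdaDet G (-X) = lambdaDet G X := by
  rw [lambdaDet, ad_neg, lambdaOp_neg, lambdaDet]

theorem coshDet_neg (X : E) : coshDet G (-X) = coshDet G X := by
  rw [coshDet, ad_neg, smul_neg, neg_neg, add_comm, coshDet]

theorem lambdaDet_two_smul (X : E) :
    lambdaDet G ((2 : ℝ) • X) = coshDet G X * lambdaDet G X := by
  rw [lambdaDet, ad_smul, lambdaOp_two_smul, abs_det_mul]
  rfl

theorem expDensity_eq (X : E) : expDensity G X = lambdaDet G X / expDet G X := by
  rw [expDensity, phiOp_eq_exp_mul_lambdaOp, abs_det_mul,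
    div_eq_inv_mul (lambdaDet G X) (expDet G X), ← expDet_neg, expDet, ad_neg, smul_neg]
  rfl

theorem abs_det_Ad_lieExp (X : E) : |(Ad (lieExp G X) : E →L[ℝ] E).det| = expDet G X ^ 2 := by
  rw [← expDet_two_smul, Ad_lieExp, expDet, ad_smul, smul_smul]
  norm_num

/-- The factor `e^{-x/2}` in `φ = e^{-x/2} λ` is cancelled by `|det Ad (exp (X/2))|`. -/
theorem bigF_eq (X : E) : bigF G X = √(lambdaDet G X) := by
  rw [bigF, abs_mul, abs_det_Ad_lieExp, ← expDet_two_smul, smul_smul]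
  have h : |(phiOp (ad G X)).det| = lambdaDet G X / expDet G X := expDensity_eq X
  rw [h, show (2 : ℝ) * (1 / 2) = 1 by norm_num, one_smul, div_mul_cancel₀ _ (expDet_pos X).ne']

theorem abs_det_psiOp {X : E} (h : 0 < lambdaDet G X) :
    |(psiOp (ad G X)).det| = coshDet G X / lambdaDet G X := by
  -- `Ring.inverse` is a true inverse only for units, hence the positivity assumption on the
  -- determinant.
  have hu : IsUnit (lambdaOp (ad G X)) := by
    have h1 : IsUnit (lambdaOp (ad G X)).det := (abs_pos.1 h).isUnit
    exact ContinuousLinearMap.isUnit_iff_isUnit_toLinearMap.2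
      ((LinearMap.isUnit_iff_isUnit_det _).2 h1)
  rw [psiOp, abs_det_mul, eq_div_iff h.ne', mul_assoc]
  have h2 := congrArg (fun A : E →L[ℝ] E => |A.det|) (Ring.inverse_mul_cancel _ hu)
  simp only [abs_det_mul] at h2
  rw [lambdaDet, h2]
  simp [coshDet, ContinuousLinearMap.det]

end Scalars

/-! ### The ingredients of `Δ_x` in exponential coordinates. -/

section ExpCoordinates

variable {E : Type*} [NormedAddCommGroup E] [InnerProductSpace ℝ E] [FiniteDimensional ℝ E]
  [MeasurableSpace E] [BorelSpace E]
  {G : Type*} [TopologicalSpace G] [T2Space G] [SecondCountableTopology G] [ChartedSpace E G]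
  [Group G] [LieGroup 𝓘(ℝ, E) ∞ G] [MeasurableSpace G] [BorelSpace G] {O : Set E}
  {μ : Measure G}

/-- The Haar measure `μ` in exponential coordinates. -/
def haarExp (μ : Measure G) (O : Set E) : Measure E := haarDensity E μ • expMeasure G O

theorem haarExp_eq (μ : Measure G) (O : Set E) : haarExp μ O =
    ((algMeasure E μ).restrict O).withDensity fun X => ENNReal.ofReal (expDensity G X) := by
  rw [haarExp, expMeasure, algMeasure, Measure.restrict_smul, withDensity_smul_measure]

namespace IsWeaklyExponential

variable (hO : IsWeaklyExponential G O)

include hO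

theorem lambdaDet_pos {X : E} (hX : X ∈ O) : 0 < lambdaDet G X := by
  have h := hO.expDensity_pos hX
  rw [expDensity_eq] at h
  exact (div_pos_iff_of_pos_right (expDet_pos X)).1 h

theorem measurable_log : Measurable (lieLog O : G → E) := by
  classical
  have h1 : Measurable ((lieExp G '' O).domRestrict (lieLog O : G → E)) :=
    hO.smooth_log.continuousOn.domRestrict.measurable
  have h2 : Measurable ((lieExp G '' O)ᶜ.domRestrict (lieLog O : G → E)) := by
    -- Off `exp O`, `Function.invFunOn` returns one fixed default element.
    have : (lieExp G '' O)ᶜ.domRestrict (lieLog O : G → E) =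
        fun _ => Classical.choice (inferInstance : Nonempty E) := by
      funext g
      exact dif_neg g.2
    rw [this]; exact measurable_const
  exact measurable_of_restrict_of_restrict_compl hO.isOpen_image.measurableSet h1 h2

theorem ae_haarExp_mem : ∀ᵐ X ∂haarExp μ O, X ∈ O := by
  rw [haarExp_eq]
  exact (withDensity_absolutelyContinuous _ _).ae_le (ae_restrict_mem hO.isOpen.measurableSet)

theorem measurePreserving_exp [μ.IsHaarMeasure] : MeasurePreserving (lieExp G) (haarExp μ O) μ :=
  ⟨hO.continuous_exp.measurable, (hO.haarDensity_spec μ).2.2.symm⟩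

theorem measurePreserving_mul_exp [μ.IsHaarMeasure] (q : G) :
    MeasurePreserving (fun X => q * lieExp G X) (haarExp μ O) μ := by
  have : IsTopologicalGroup G := topologicalGroup_of_lieGroup 𝓘(ℝ, E) ∞
  exact (measurePreserving_mul_left μ q).comp hO.measurePreserving_exp

theorem ae_mem_image [μ.IsHaarMeasure] : ∀ᵐ g ∂μ, g ∈ lieExp G '' O := by
  rw [← (hO.measurePreserving_exp (μ := μ)).map_eq,
    ae_map_iff (p := fun g => g ∈ lieExp G '' O) hO.continuous_exp.measurable.aemeasurable
      hO.isOpen_image.measurableSet]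
  exact hO.ae_haarExp_mem.mono fun X hX => mem_image_of_mem _ hX

theorem ae_inv_mul_mem_image [μ.IsHaarMeasure] (q : G) : ∀ᵐ a ∂μ, q⁻¹ * a ∈ lieExp G '' O := by
  have : IsTopologicalGroup G := topologicalGroup_of_lieGroup 𝓘(ℝ, E) ∞
  exact (measurePreserving_mul_left μ q⁻¹).quasiMeasurePreserving.ae hO.ae_mem_image

theorem inv_mem_image {g : G} (hg : g ∈ lieExp G '' O) : g⁻¹ ∈ lieExp G '' O := by
  obtain ⟨X, hX, rfl⟩ := hg
  exact ⟨-X, hO.neg_mem hX, lieExp_neg X⟩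

theorem log_inv {g : G} (hg : g ∈ lieExp G '' O) : lieLog O g⁻¹ = -lieLog O g := by
  obtain ⟨X, hX, rfl⟩ := hg
  rw [← lieExp_neg, hO.lieLog_lieExp hX, hO.lieLog_lieExp (hO.neg_mem hX)]

theorem measurePreserving_log [μ.IsHaarMeasure] : MeasurePreserving (lieLog O) μ (haarExp μ O) := by
  refine ⟨hO.measurable_log, ?_⟩
  conv_lhs => rw [← (hO.measurePreserving_exp (μ := μ)).map_eq]
  rw [Measure.map_map hO.measurable_log hO.continuous_exp.measurable]
  conv_rhs => rw [← Measure.map_id (μ := haarExp μ O)]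
  refine Measure.map_congr ?_
  filter_upwards [hO.ae_haarExp_mem] with X hX
  exact hO.lieLog_lieExp hX

theorem measurePreserving_V [μ.IsHaarMeasure] (q : G) : MeasurePreserving (fun a => V O q a) μ (haarExp μ O) := by
  have : IsTopologicalGroup G := topologicalGroup_of_lieGroup 𝓘(ℝ, E) ∞
  exact hO.measurePreserving_log.comp (measurePreserving_mul_left μ q⁻¹)

theorem jFun_eq {q a : G} (ha : q⁻¹ * a ∈ lieExp G '' O) :
    jFun O q a = coshDet G (V O q a) / lambdaDet G (V O q a) *
      O.indicator (fun _ => (1 : ℝ)) ((2 : ℝ) • V O q a) := by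
  rw [jFun, abs_det_psiOp (X := V O q a) (hO.lambdaDet_pos (lieLog_mem ha))]

theorem haarJacobian_refl_eq {q a : G} (ha : q⁻¹ * a ∈ lieExp G '' O) :
    haarJacobian E (refl q) a = expDet G (V O q a) ^ 2 := by
  rw [haarJacobian_refl, ← abs_det_Ad_lieExp, V, lieExp_lieLog ha]

theorem bigJ_eq {q a : G} (ha : q⁻¹ * a ∈ lieExp G '' O) :
    bigJ O q a = coshDet G (V O q a) / lambdaDet G (V O q a) *
      O.indicator (fun _ => (1 : ℝ)) ((2 : ℝ) • V O q a) * expDet G (V O q a) ^ 2 := by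
  rw [bigJ, hO.jFun_eq ha, hO.haarJacobian_refl_eq ha]

theorem V_refl {q a : G} (ha : q⁻¹ * a ∈ lieExp G '' O) : V O q (refl q a) = -V O q a := by
  rw [V, V, ← hO.log_inv ha]
  congr 1
  simp [refl, mul_assoc]

theorem lieExp_V {q a : G} (ha : q⁻¹ * a ∈ lieExp G '' O) : q * lieExp G (V O q a) = a := by
  rw [V, lieExp_lieLog ha, mul_inv_cancel_left]

theorem refl_eq {q a : G} (ha : q⁻¹ * a ∈ lieExp G '' O) :
    refl q a = q * lieExp G (-V O q a) := by
  rw [lieExp_neg, V, lieExp_lieLog ha]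
  simp [refl, mul_assoc]

end IsWeaklyExponential

theorem refl_refl (q a : G) : refl q (refl q a) = a := by simp [refl, mul_assoc]

end ExpCoordinates


/-! ### Self-adjointness of weighted compositions with an involution. -/

section WeightedComposition

variable {Ω : Type*} [MeasurableSpace Ω] {μ : Measure Ω} {s : Ω → Ω} {m : Ω → ℂ} {ρ : Ω → ℝ}

theorem quasiMeasurePreserving_of_involutive (hs : Measurable s) (hinv : ∀ b, s (s b) = b)
    (hmap : (μ.withDensity fun b => ENNReal.ofReal (ρ b)).map s = μ) :
    Measure.QuasiMeasurePreserving s μ μ := by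
  refine ⟨hs, ?_⟩
  conv_lhs => rw [← hmap]
  rw [Measure.map_map hs hs, show s ∘ s = id from funext hinv, Measure.map_id]
  exact withDensity_absolutelyContinuous _ _

/-- Here `hmap` says that `ρ` is the Jacobian of `s`, and `hmρ` makes the operator formally
symmetric. Substituting `s b` for `b` produces `|m(s b)|² ρ(b)`, which is `|m(b)| |m(s b)|` by
`hmρ`. -/
theorem lintegral_enorm_sq_mul_comp (hs : Measurable s) (hρ : Measurable ρ)
    (hinv : ∀ b, s (s b) = b)
    (hmap : (μ.withDensity fun b => ENNReal.ofReal (ρ b)).map s = μ)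
    (hρ0 : ∀ b, 0 ≤ ρ b) (hm : Measurable m) (hmρ : ∀ᵐ b ∂μ, m (s b) * ρ b = star (m b))
    {ψ : Ω → ℂ} (hψ : AEStronglyMeasurable ψ μ) :
    ∫⁻ b, ‖m b * ψ (s b)‖ₑ ^ 2 ∂μ =
      ∫⁻ b, ENNReal.ofReal (‖m b‖ * ‖m (s b)‖) * ‖ψ b‖ₑ ^ 2 ∂μ := by
  have hq := quasiMeasurePreserving_of_involutive hs hinv hmap
  conv_lhs => rw [← hmap]
  have h1 : AEMeasurable (fun b => ‖m b * ψ (s b)‖ₑ ^ 2) μ :=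
    (hm.aestronglyMeasurable.mul (hψ.comp_quasiMeasurePreserving hq)).enorm.pow_const 2
  rw [lintegral_map' (by rwa [hmap]) hs.aemeasurable,
    lintegral_withDensity_eq_lintegral_mul₀' (by fun_prop)
    (by simpa only [Function.comp_def] using
      (h1.comp_quasiMeasurePreserving hq).mono_ac (withDensity_absolutelyContinuous _ _))]
  refine lintegral_congr_ae ?_
  filter_upwards [hmρ] with b hb
  have h2 : ‖m (s b)‖ * ρ b = ‖m b‖ := by
    have := congrArg norm hb
    rwa [norm_mul, norm_star, Complex.norm_real, Real.norm_of_nonneg (hρ0 b)] at this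
  simp only [Pi.mul_apply, hinv, enorm_mul, mul_pow]
  rw [← mul_assoc, ← h2]
  congr 1
  rw [show ‖m (s b)‖ * ρ b * ‖m (s b)‖ = ρ b * ‖m (s b)‖ ^ 2 by ring,
    ENNReal.ofReal_mul (hρ0 b), ENNReal.ofReal_pow (norm_nonneg _), ofReal_norm]

theorem integral_star_mul_comp (hs : Measurable s) (hρ : Measurable ρ)
    (hinv : ∀ b, s (s b) = b)
    (hmap : (μ.withDensity fun b => ENNReal.ofReal (ρ b)).map s = μ)
    (hρ0 : ∀ b, 0 ≤ ρ b) (hm : Measurable m) (hmρ : ∀ᵐ b ∂μ, m (s b) * ρ b = star (m b))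
    {χ ψ : Ω → ℂ} (hχ : AEStronglyMeasurable χ μ) (hψ : AEStronglyMeasurable ψ μ) :
    ∫ b, star (χ b) * (m b * ψ (s b)) ∂μ = ∫ b, star (m b * χ (s b)) * ψ b ∂μ := by
  have hq := quasiMeasurePreserving_of_involutive hs hinv hmap
  conv_lhs => rw [← hmap]
  rw [integral_map hs.aemeasurable (by
    rw [hmap]
    exact hχ.star.mul (hm.aestronglyMeasurable.mul (hψ.comp_quasiMeasurePreserving hq))),
    integral_withDensity_eq_integral_toReal_smul (by fun_prop) (by simp)]
  refine integral_congr_ae ?_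
  filter_upwards [hmρ] with b hb
  rw [ENNReal.toReal_ofReal (hρ0 b), hinv, star_mul', ← hb, Complex.real_smul]
  ring

theorem memLp_two_iff_lintegral {f : Ω → ℂ} (hf : AEStronglyMeasurable f μ) :
    MemLp f 2 μ ↔ ∫⁻ b, ‖f b‖ₑ ^ 2 ∂μ < ⊤ := by
  have h := eLpNorm_lt_top_iff_lintegral_rpow_enorm_lt_top (f := f) (μ := μ) (p := 2)
    (by norm_num) (by norm_num)
  simp only [ENNReal.toReal_ofNat, ENNReal.rpow_ofNat] at h
  rw [← h]
  exact ⟨fun h => h.2, fun h => ⟨hf, h⟩⟩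

theorem inner_Lp_eq_integral (f g : Lp ℂ 2 μ) : inner ℂ f g = ∫ b, star (f b) * g b ∂μ := by
  rw [L2.inner_def]
  refine integral_congr_ae (Eventually.of_forall fun b => ?_)
  simp [mul_comm]

variable {T : Lp ℂ 2 μ →ₗ.[ℂ] Lp ℂ 2 μ}

theorem mem_domain_iff_of_weightedComposition (hs : Measurable s) (hρ : Measurable ρ)
    (hinv : ∀ b, s (s b) = b)
    (hmap : (μ.withDensity fun b => ENNReal.ofReal (ρ b)).map s = μ)
    (hρ0 : ∀ b, 0 ≤ ρ b) (hm : Measurable m) (hmρ : ∀ᵐ b ∂μ, m (s b) * ρ b = star (m b))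
    (hdom : ∀ ψ, ψ ∈ T.domain ↔ MemLp (fun b => m b * ψ (s b)) 2 μ) (ψ : Lp ℂ 2 μ) :
    ψ ∈ T.domain ↔ ∫⁻ b, ENNReal.ofReal (‖m b‖ * ‖m (s b)‖) * ‖ψ b‖ₑ ^ 2 ∂μ < ⊤ := by
  have hq := quasiMeasurePreserving_of_involutive hs hinv hmap
  have hψ := Lp.aestronglyMeasurable ψ
  rw [hdom, memLp_two_iff_lintegral (f := fun b => m b * ψ (s b))
    (hm.aestronglyMeasurable.mul (hψ.comp_quasiMeasurePreserving hq)),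
    lintegral_enorm_sq_mul_comp hs hρ hinv hmap hρ0 hm hmρ hψ]

/-- The truncation of an `L²` function to a measurable set. -/
def truncLp {S : Set Ω} (hS : MeasurableSet S) (ψ : Lp ℂ 2 μ) : Lp ℂ 2 μ :=
  ((Lp.memLp ψ).indicator hS).toLp

theorem coeFn_truncLp {S : Set Ω} (hS : MeasurableSet S) (ψ : Lp ℂ 2 μ) :
    truncLp hS ψ =ᵐ[μ] S.indicator ψ := MemLp.coeFn_toLp _

theorem eq_of_truncLp_eq {S : ℕ → Set Ω} (hU : ⋃ N, S N = univ)
    {f g : Ω → ℂ} (h : ∀ N, (S N).indicator f =ᵐ[μ] (S N).indicator g) : f =ᵐ[μ] g := by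
  filter_upwards [ae_all_iff.2 h] with b hb
  obtain ⟨N, hN⟩ := mem_iUnion.1 (hU.symm ▸ mem_univ b : b ∈ ⋃ N, S N)
  simpa [hN] using hb N

/-- The weight `|m| |m ∘ s|` is unchanged by the involution, so truncation to its sublevel sets
commutes with the weighted composition. -/
theorem measurableSet_truncation (hs : Measurable s) (hm : Measurable m) (N : ℕ) :
    MeasurableSet {b | ‖m b‖ * ‖m (s b)‖ ≤ N} :=
  measurableSet_le (hm.norm.mul (hm.comp hs).norm) measurable_const

theorem iUnion_truncation : ⋃ N : ℕ, {b | ‖m b‖ * ‖m (s b)‖ ≤ N} = univ :=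
  eq_univ_of_forall fun b => mem_iUnion.2 (exists_nat_ge (‖m b‖ * ‖m (s b)‖))

theorem truncLp_mem_domain (hs : Measurable s) (hρ : Measurable ρ)
    (hinv : ∀ b, s (s b) = b)
    (hmap : (μ.withDensity fun b => ENNReal.ofReal (ρ b)).map s = μ)
    (hρ0 : ∀ b, 0 ≤ ρ b) (hm : Measurable m) (hmρ : ∀ᵐ b ∂μ, m (s b) * ρ b = star (m b))
    (hdom : ∀ ψ, ψ ∈ T.domain ↔ MemLp (fun b => m b * ψ (s b)) 2 μ) (N : ℕ) (ψ : Lp ℂ 2 μ) :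
    truncLp (measurableSet_truncation hs hm N) ψ ∈ T.domain := by
  rw [mem_domain_iff_of_weightedComposition hs hρ hinv hmap hρ0 hm hmρ hdom]
  have h1 := (memLp_two_iff_lintegral (Lp.aestronglyMeasurable ψ)).1 (Lp.memLp ψ)
  refine lt_of_le_of_lt ?_ (ENNReal.mul_lt_top (ENNReal.natCast_lt_top N) h1)
  rw [← lintegral_const_mul' _ _ (ENNReal.natCast_ne_top N)]
  refine lintegral_mono_ae ?_
  filter_upwards [coeFn_truncLp (measurableSet_truncation hs hm N) ψ] with b hb
  rw [hb]
  by_cases h : ‖m b‖ * ‖m (s b)‖ ≤ N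
  · rw [indicator_of_mem (show b ∈ {b | ‖m b‖ * ‖m (s b)‖ ≤ N} from h)]
    gcongr
    exact ENNReal.ofReal_le_natCast.2 h
  · rw [indicator_of_notMem (show b ∉ {b | ‖m b‖ * ‖m (s b)‖ ≤ N} from h)]
    simp

theorem inner_truncLp_left {S : Set Ω} (hS : MeasurableSet S) (f g : Lp ℂ 2 μ) :
    inner ℂ (truncLp hS f) g = inner ℂ f (truncLp hS g) := by
  rw [inner_Lp_eq_integral, inner_Lp_eq_integral]
  refine integral_congr_ae ?_
  filter_upwards [coeFn_truncLp hS f, coeFn_truncLp hS g] with b h1 h2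
  rw [h1, h2]
  by_cases h : b ∈ S <;> simp [h]

/-- A vector orthogonal to the domain is orthogonal to its own truncations, hence each of them
vanishes; the truncation sets cover the space. -/
theorem dense_domain_of_weightedComposition (hs : Measurable s) (hρ : Measurable ρ)
    (hinv : ∀ b, s (s b) = b)
    (hmap : (μ.withDensity fun b => ENNReal.ofReal (ρ b)).map s = μ)
    (hρ0 : ∀ b, 0 ≤ ρ b) (hm : Measurable m) (hmρ : ∀ᵐ b ∂μ, m (s b) * ρ b = star (m b))
    (hdom : ∀ ψ, ψ ∈ T.domain ↔ MemLp (fun b => m b * ψ (s b)) 2 μ) :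
    Dense (T.domain : Set (Lp ℂ 2 μ)) := by
  rw [Submodule.dense_iff_topologicalClosure_eq_top, Submodule.topologicalClosure_eq_top_iff,
    Submodule.eq_bot_iff]
  intro χ hχ
  have h0 : ∀ N : ℕ, truncLp (measurableSet_truncation hs hm N) χ = 0 := fun N => by
    have h := (Submodule.mem_orthogonal _ _).1 hχ _
      (truncLp_mem_domain hs hρ hinv hmap hρ0 hm hmρ hdom N
        (truncLp (measurableSet_truncation hs hm N) χ))
    rwa [inner_truncLp_left, inner_self_eq_zero] at h
  rw [Lp.eq_zero_iff_ae_eq_zero]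
  refine eq_of_truncLp_eq (iUnion_truncation (m := m) (s := s)) fun N => ?_
  have h1 := coeFn_truncLp (measurableSet_truncation hs hm N) χ
  rw [h0 N] at h1
  filter_upwards [h1, Lp.coeFn_zero ℂ 2 μ] with b h2 h3
  rw [← h2, h3]
  simp [indicator]

/-- Symmetry gives `T ≤ T†`. Conversely, for `χ` in the domain of `T†`, testing against truncated
vectors shows that `T† χ` agrees almost everywhere with `m · (χ ∘ s)`. The latter is then square
integrable, so `χ` already lies in the maximal domain. -/
theorem isSelfAdjoint_of_weightedComposition (hs : Measurable s) (hρ : Measurable ρ)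
    (hinv : ∀ b, s (s b) = b)
    (hmap : (μ.withDensity fun b => ENNReal.ofReal (ρ b)).map s = μ)
    (hρ0 : ∀ b, 0 ≤ ρ b) (hm : Measurable m) (hmρ : ∀ᵐ b ∂μ, m (s b) * ρ b = star (m b))
    (hdom : ∀ ψ, ψ ∈ T.domain ↔ MemLp (fun b => m b * ψ (s b)) 2 μ)
    (hT : ∀ ψ : T.domain, T ψ =ᵐ[μ] fun b => m b * (ψ : Lp ℂ 2 μ) (s b)) : IsSelfAdjoint T := by
  have hq := quasiMeasurePreserving_of_involutive hs hinv hmap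
  have hdense := dense_domain_of_weightedComposition hs hρ hinv hmap hρ0 hm hmρ hdom
  have key : ∀ (χ : Lp ℂ 2 μ) (ψ : T.domain),
      inner ℂ χ (T ψ) = ∫ b, star (m b * χ (s b)) * (ψ : Lp ℂ 2 μ) b ∂μ := fun χ ψ => by
    rw [← integral_star_mul_comp hs hρ hinv hmap hρ0 hm hmρ (Lp.aestronglyMeasurable χ)
      (Lp.aestronglyMeasurable (ψ : Lp ℂ 2 μ)), inner_Lp_eq_integral]
    refine integral_congr_ae ?_
    filter_upwards [hT ψ] with b hb
    rw [hb]
  have hformal : T.IsFormalAdjoint T := fun χ ψ => by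
    rw [key, inner_Lp_eq_integral]
    refine integral_congr_ae ?_
    filter_upwards [hT χ] with b hb
    rw [hb]
  have hle : T ≤ T.adjoint := hformal.le_adjoint hdense
  rw [LinearPMap.isSelfAdjoint_def]
  refine (LinearPMap.eq_of_le_of_domain_eq hle (le_antisymm hle.1 fun χ hχ => ?_)).symm
  rw [hdom]
  set η := T.adjoint ⟨χ, hχ⟩ with hη
  have hadj : ∀ ψ : T.domain, inner ℂ χ (T ψ) = inner ℂ η (ψ : Lp ℂ 2 μ) := fun ψ =>
    (LinearPMap.adjoint_isFormalAdjoint hdense ⟨χ, hχ⟩ ψ).symm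
  refine (Lp.memLp η).ae_eq (eq_of_truncLp_eq (iUnion_truncation (m := m) (s := s)) fun N => ?_)
  set hS := measurableSet_truncation hs hm N
  have hd := truncLp_mem_domain hs hρ hinv hmap hρ0 hm hmρ hdom N
  have hw : T ⟨truncLp hS χ, hd χ⟩ =ᵐ[μ]
      {b | ‖m b‖ * ‖m (s b)‖ ≤ N}.indicator fun b => m b * χ (s b) := by
    filter_upwards [hT ⟨truncLp hS χ, hd χ⟩, hq.ae (coeFn_truncLp hS χ)] with b h1 h2
    rw [h1, h2]
    by_cases h : ‖m b‖ * ‖m (s b)‖ ≤ N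
    -- The truncation set is invariant under `s`, so the indicator passes through the composition.
    · have h' : ‖m (s b)‖ * ‖m (s (s b))‖ ≤ N := by rwa [hinv, mul_comm]
      simp [indicator, h, h']
    · have h' : ¬ ‖m (s b)‖ * ‖m (s (s b))‖ ≤ N := by rwa [hinv, mul_comm]
      simp [indicator, h, h']
  have heq : truncLp hS η = T ⟨truncLp hS χ, hd χ⟩ := by
    refine ext_inner_right ℂ fun φ => ?_
    rw [inner_truncLp_left, ← hadj ⟨_, hd φ⟩, key, inner_Lp_eq_integral]
    refine integral_congr_ae ?_
    filter_upwards [hw, coeFn_truncLp hS φ] with b h1 h2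
    rw [h1, h2]
    by_cases h : ‖m b‖ * ‖m (s b)‖ ≤ N <;> simp [indicator, h]
  exact (coeFn_truncLp hS η).symm.trans ((EventuallyEq.of_eq (by rw [heq])).trans hw)

end WeightedComposition


/-! ### Domain, density and self-adjointness of `Δ_x`. -/

section QuantizerSelfAdjoint

variable {E : Type*} [NormedAddCommGroup E] [InnerProductSpace ℝ E] [FiniteDimensional ℝ E]
  [MeasurableSpace E] [BorelSpace E]
  {G : Type*} [TopologicalSpace G] [T2Space G] [SecondCountableTopology G] [ChartedSpace E G]
  [Group G] [LieGroup 𝓘(ℝ, E) ∞ G] [MeasurableSpace G] [BorelSpace G] {O : Set E}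
  {μ : Measure G}

/-- The function `j_q` in exponential coordinates. -/
def jExp (G : Type*) [TopologicalSpace G] [ChartedSpace E G]
    [Group G] [LieGroup 𝓘(ℝ, E) ∞ G] (O : Set E) (X : E) : ℝ :=
  coshDet G X / lambdaDet G X * O.indicator (fun _ => (1 : ℝ)) ((2 : ℝ) • X)

/-- The multiplier in `Δ_{(q, p)}` in exponential coordinates. -/
def quantizerWeight (G : Type*) [TopologicalSpace G] [ChartedSpace E G]
    [Group G] [LieGroup 𝓘(ℝ, E) ∞ G] (ħ : ℝ) (O : Set E) (p : StrongDual ℝ E) (X : E) : ℂ :=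
  ((1 / |Real.pi * ħ| ^ Module.finrank ℝ E : ℝ) : ℂ) *
    (Real.sqrt (jExp G O X * expDet G X ^ 2) : ℂ) * Complex.exp (-(2 * Complex.I / ħ) * (p X : ℂ))

theorem jExp_nonneg (X : E) : 0 ≤ jExp G O X :=
  mul_nonneg (div_nonneg (coshDet_nonneg X) (lambdaDet_nonneg X))
    (indicator_nonneg (fun _ _ => zero_le_one) _)

theorem norm_exp_phase (c t : ℝ) (ħ : ℝ) :
    ‖Complex.exp (-(c * Complex.I / ħ) * (t : ℂ))‖ = 1 := by
  rw [show -(c * Complex.I / ħ) * (t : ℂ) = ((-(c / ħ * t) : ℝ) : ℂ) * Complex.I by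
    push_cast; ring, Complex.norm_exp_ofReal_mul_I]

theorem norm_quantizerWeight (ħ : ℝ) (p : StrongDual ℝ E) (X : E) :
    ‖quantizerWeight G ħ O p X‖ =
      1 / |Real.pi * ħ| ^ Module.finrank ℝ E * (√(jExp G O X) * expDet G X) := by
  have h := norm_exp_phase 2 (p X) ħ
  push_cast at h
  rw [quantizerWeight, norm_mul, norm_mul, h, mul_one, Complex.norm_real, Complex.norm_real,
    Real.norm_of_nonneg (by positivity), Real.norm_of_nonneg (Real.sqrt_nonneg _),
    Real.sqrt_mul (jExp_nonneg X), Real.sqrt_sq (expDet_pos X).le]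

namespace IsWeaklyExponential

variable (hO : IsWeaklyExponential G O)

include hO

theorem isAddHaarMeasure_algMeasure (μ : Measure G) [μ.IsHaarMeasure] :
    (algMeasure E μ).IsAddHaarMeasure :=
  have h := hO.haarDensity_spec μ
  Measure.IsAddHaarMeasure.smul _ h.1 h.2.1

theorem lintegral_haarExp (μ : Measure G) {F : E → ℝ≥0∞} (hF : Measurable F) :
    ∫⁻ X, F X ∂haarExp μ O =
      ∫⁻ X in O, ENNReal.ofReal (expDensity G X) * F X ∂algMeasure E μ := by
  rw [haarExp_eq, lintegral_withDensity_eq_lintegral_mul _ measurable_ofReal_expDensity hF]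
  rfl

theorem jExp_neg (X : E) : jExp G O (-X) = jExp G O X := by
  rw [jExp, coshDet_neg, lambdaDet_neg, jExp, smul_neg]
  congr 1
  by_cases h : (2 : ℝ) • X ∈ O
  · rw [indicator_of_mem h, indicator_of_mem (hO.neg_mem h)]
  · rw [indicator_of_notMem h, indicator_of_notMem (mt hO.neg_mem_iff.1 h)]

theorem measurable_jExp : Measurable (jExp G O : E → ℝ) :=
  (continuous_coshDet.measurable.div continuous_lambdaDet.measurable).mul
    ((measurable_const.indicator hO.isOpen.measurableSet).comp (measurable_const_smul (2 : ℝ)))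

theorem measurable_quantizerWeight (ħ : ℝ) (p : StrongDual ℝ E) :
    Measurable (quantizerWeight G ħ O p) := by
  have h1 := (hO.measurable_jExp (G := G)).mul ((continuous_expDet (G := G)).measurable.pow_const 2)
  have h2 : Continuous fun X : E => Complex.exp (-(2 * Complex.I / ħ) * (p X : ℂ)) := by
    fun_prop
  exact (measurable_const.mul (Complex.measurable_ofReal.comp h1.sqrt)).mul h2.measurable

/-- This is the symmetry relation required of a weighted composition: `j` is even, the phase is
conjugated by `X ↦ -X`, and `expDet (-X)` is the inverse of `expDet X`. -/
theorem quantizerWeight_neg (ħ : ℝ) (p : StrongDual ℝ E) (X : E) :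
    quantizerWeight G ħ O p (-X) * (expDet G X ^ 2 : ℝ) = Star.star (quantizerWeight G ħ O p X) := by
  have he := expDet_pos (G := G) X
  have h1 : √(jExp G O X * (expDet G X)⁻¹ ^ 2) * expDet G X ^ 2 =
      √(jExp G O X * expDet G X ^ 2) := by
    rw [Real.sqrt_mul (jExp_nonneg X), Real.sqrt_mul (jExp_nonneg X), Real.sqrt_sq he.le,
      Real.sqrt_sq (inv_pos.2 he).le]
    field_simp
  rw [quantizerWeight, hO.jExp_neg (G := G), expDet_neg, mul_right_comm, mul_assoc (Complex.ofReal _),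
    ← Complex.ofReal_mul, h1, quantizerWeight]
  simp only [RCLike.star_def, map_mul, Complex.conj_ofReal, ← Complex.exp_conj, map_neg, map_div₀,
    Complex.conj_I, map_ofNat, Complex.ofReal_neg]
  congr 2
  ring

theorem norm_quantizerWeight_mul (ħ : ℝ) (p : StrongDual ℝ E) (X : E) :
    ‖quantizerWeight G ħ O p X‖ * ‖quantizerWeight G ħ O p (-X)‖ =
      (1 / |Real.pi * ħ| ^ Module.finrank ℝ E) ^ 2 * jExp G O X := by
  have he := (expDet_pos (G := G) X).ne'
  rw [norm_quantizerWeight, norm_quantizerWeight, hO.jExp_neg, expDet_neg]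
  calc _ = (1 / |Real.pi * ħ| ^ Module.finrank ℝ E) ^ 2 * √(jExp G O X) ^ 2 *
        (expDet G X * (expDet G X)⁻¹) := by ring
    _ = _ := by rw [mul_inv_cancel₀ he, Real.sq_sqrt (jExp_nonneg X), mul_one]

theorem quantizerFun_eq (ħ : ℝ) (x : G × StrongDual ℝ E) (ψ : G → ℂ) {a : G}
    (ha : x.1⁻¹ * a ∈ lieExp G '' O) :
    quantizerFun ħ O x ψ a = quantizerWeight G ħ O x.2 (V O x.1 a) * ψ (refl x.1 a) := by
  rw [quantizerFun, hO.bigJ_eq ha]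
  rfl

theorem quantizerFun_ae_eq [μ.IsHaarMeasure] (ħ : ℝ) (x : G × StrongDual ℝ E) (ψ : G → ℂ) :
    quantizerFun ħ O x ψ =ᵐ[μ]
      fun a => quantizerWeight G ħ O x.2 (V O x.1 a) * ψ (refl x.1 a) :=
  (hO.ae_inv_mul_mem_image x.1).mono fun _ ha => hO.quantizerFun_eq ħ x ψ ha

theorem measurable_V (q : G) : Measurable fun a => V O q a :=
  have : IsTopologicalGroup G := topologicalGroup_of_lieGroup 𝓘(ℝ, E) ∞
  hO.measurable_log.comp (measurable_const_mul q⁻¹)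

/-- In the coordinates centred at `q` the reflection is `X ↦ -X`, which preserves Lebesgue measure.
The Haar density is `λ/e` with `λ` even and `e(-X) = e(X)⁻¹`, so the factor `e²` accounts for the
difference between the values at `X` and `-X`. -/
theorem map_refl_withDensity [μ.IsHaarMeasure] (q : G) :
    (μ.withDensity fun b => ENNReal.ofReal (expDet G (V O q b) ^ 2)).map (refl q) = μ := by
  have : IsTopologicalGroup G := topologicalGroup_of_lieGroup 𝓘(ℝ, E) ∞
  have := hO.isAddHaarMeasure_algMeasure μ
  have hs : Measurable (refl q : G → G) := by unfold refl; fun_prop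
  have hexp := (hO.continuous_exp (G := G)).measurable
  ext A hA
  have hA' : Measurable fun g : G => A.indicator (fun _ => (1 : ℝ≥0∞)) g :=
    measurable_const.indicator hA
  have he : Measurable fun X : E => ENNReal.ofReal (expDet G X ^ 2) :=
    ((continuous_expDet (G := G)).measurable.pow_const 2).ennreal_ofReal
  have hF : Measurable fun X : E => ENNReal.ofReal (expDet G X ^ 2) *
      A.indicator (fun _ => (1 : ℝ≥0∞)) (q * lieExp G (-X)) :=
    he.mul (hA'.comp ((hexp.comp measurable_neg).const_mul q))
  have hF' : Measurable fun X : E => A.indicator (fun _ => (1 : ℝ≥0∞)) (q * lieExp G X) :=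
    hA'.comp (hexp.const_mul q)
  rw [Measure.map_apply hs hA, withDensity_apply _ (hs hA)]
  calc ∫⁻ b in refl q ⁻¹' A, ENNReal.ofReal (expDet G (V O q b) ^ 2) ∂μ
      = ∫⁻ b, (fun X => ENNReal.ofReal (expDet G X ^ 2) *
          A.indicator (fun _ => (1 : ℝ≥0∞)) (q * lieExp G (-X))) (V O q b) ∂μ := by
        rw [← lintegral_indicator (hs hA)]
        refine lintegral_congr_ae ?_
        filter_upwards [hO.ae_inv_mul_mem_image q] with b hb
        rw [← hO.refl_eq hb]
        by_cases h : refl q b ∈ A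
        · rw [indicator_of_mem (show b ∈ refl q ⁻¹' A from h), indicator_of_mem h, mul_one]
        · rw [indicator_of_notMem (show b ∉ refl q ⁻¹' A from h), indicator_of_notMem h, mul_zero]
    _ = ∫⁻ X, ENNReal.ofReal (expDet G X ^ 2) *
          A.indicator (fun _ => (1 : ℝ≥0∞)) (q * lieExp G (-X)) ∂haarExp μ O :=
        (hO.measurePreserving_V q).lintegral_comp hF
    _ = ∫⁻ X, ENNReal.ofReal (expDensity G X) *
          A.indicator (fun _ => (1 : ℝ≥0∞)) (q * lieExp G X) ∂(algMeasure E μ).restrict O := by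
        rw [hO.lintegral_haarExp _ hF,
          ← lintegral_indicator hO.isOpen.measurableSet,
          ← lintegral_indicator hO.isOpen.measurableSet,
          ← lintegral_neg_eq_self]
        refine lintegral_congr fun X => ?_
        by_cases hX : X ∈ O
        · rw [indicator_of_mem hX, indicator_of_mem (hO.neg_mem hX), neg_neg, ← mul_assoc,
            ← ENNReal.ofReal_mul (expDensity_nonneg _)]
          congr 2
          rw [expDensity_eq, expDensity_eq, lambdaDet_neg, expDet_neg]
          have := (expDet_pos (G := G) X).ne'
          field_simp
        · rw [indicator_of_notMem hX, indicator_of_notMem (mt hO.neg_mem_iff.1 hX)]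
    _ = ∫⁻ X, A.indicator (fun _ => (1 : ℝ≥0∞)) (q * lieExp G X) ∂haarExp μ O :=
        (hO.lintegral_haarExp _ hF').symm
    _ = μ A := by
        rw [(hO.measurePreserving_mul_exp q).lintegral_comp hA', lintegral_indicator_const hA,
          one_mul]

theorem quantizer_spec [μ.IsHaarMeasure] {ħ : ℝ} (hħ : ħ ≠ 0) (x : G × StrongDual ℝ E) :
    (∀ ψ : Lp ℂ 2 μ, ψ ∈ (quantizer ħ O μ x).domain ↔
        ∫⁻ a, ENNReal.ofReal (jFun O x.1 a) * ‖ψ a‖ₑ ^ 2 ∂μ < ⊤) ∧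
      Dense ((quantizer ħ O μ x).domain : Set (Lp ℂ 2 μ)) ∧
      IsSelfAdjoint (quantizer ħ O μ x) := by
  have : IsTopologicalGroup G := topologicalGroup_of_lieGroup 𝓘(ℝ, E) ∞
  obtain ⟨q, p⟩ := x
  have hs : Measurable (refl q : G → G) := by unfold refl; fun_prop
  have hρ : Measurable fun b : G => expDet G (V O q b) ^ 2 :=
    ((continuous_expDet (G := G)).measurable.comp (hO.measurable_V q)).pow_const 2
  have hinv : ∀ b, refl q (refl q b) = b := refl_refl q
  have hmap := hO.map_refl_withDensity (μ := μ) q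
  have hρ0 : ∀ b : G, 0 ≤ expDet G (V O q b) ^ 2 := fun b => sq_nonneg _
  have hm : Measurable fun b : G => quantizerWeight G ħ O p (V O q b) :=
    (hO.measurable_quantizerWeight ħ p).comp (hO.measurable_V q)
  have hmρ : ∀ᵐ b ∂μ, quantizerWeight G ħ O p (V O q (refl q b)) * (expDet G (V O q b) ^ 2 : ℝ) =
      Star.star (quantizerWeight G ħ O p (V O q b)) := by
    filter_upwards [hO.ae_inv_mul_mem_image q] with b hb
    rw [hO.V_refl hb, hO.quantizerWeight_neg]
  have hdom : ∀ ψ, ψ ∈ (quantizer ħ O μ (q, p)).domain ↔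
      MemLp (fun b => quantizerWeight G ħ O p (V O q b) * ψ (refl q b)) 2 μ := fun ψ =>
    memLp_congr_ae (hO.quantizerFun_ae_eq ħ (q, p) ψ)
  refine ⟨fun ψ => ?_, dense_domain_of_weightedComposition hs hρ hinv hmap hρ0 hm hmρ hdom,
    isSelfAdjoint_of_weightedComposition hs hρ hinv hmap hρ0 hm hmρ hdom fun ψ =>
      (MemLp.coeFn_toLp (f := quantizerFun ħ O (q, p) (ψ : Lp ℂ 2 μ)) ψ.2).trans
        (hO.quantizerFun_ae_eq ħ (q, p) _)⟩
  rw [mem_domain_iff_of_weightedComposition hs hρ hinv hmap hρ0 hm hmρ hdom]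
  set c : ℝ := (1 / |Real.pi * ħ| ^ Module.finrank ℝ E) ^ 2 with hc
  have hc0 : 0 < c := by
    have : Real.pi * ħ ≠ 0 := mul_ne_zero Real.pi_ne_zero hħ
    positivity
  have heq : ∫⁻ b, ENNReal.ofReal (‖quantizerWeight G ħ O p (V O q b)‖ *
        ‖quantizerWeight G ħ O p (V O q (refl q b))‖) * ‖ψ b‖ₑ ^ 2 ∂μ =
      ENNReal.ofReal c * ∫⁻ a, ENNReal.ofReal (jFun O q a) * ‖ψ a‖ₑ ^ 2 ∂μ := by
    rw [← lintegral_const_mul' _ _ ENNReal.ofReal_ne_top]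
    refine lintegral_congr_ae ?_
    filter_upwards [hO.ae_inv_mul_mem_image q] with b hb
    rw [hO.V_refl hb, hO.norm_quantizerWeight_mul, ← mul_assoc, ← ENNReal.ofReal_mul hc0.le,
      hO.jFun_eq hb]
    rfl
  rw [heq]
  refine ⟨fun h => ?_, fun h => ENNReal.mul_lt_top ENNReal.ofReal_lt_top h⟩
  exact ENNReal.lt_top_of_mul_ne_top_right h.ne (ENNReal.ofReal_pos.2 hc0).ne'

end IsWeaklyExponential

end QuantizerSelfAdjoint


/-! ### Expansion of a smooth kernel into products. -/

section NuclearExpansion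

theorem Orthonormal.countable {H ι : Type*} [NormedAddCommGroup H] [InnerProductSpace ℂ H]
    [TopologicalSpace.SeparableSpace H] {v : ι → H} (hv : Orthonormal ℂ v) : Countable ι := by
  rw [← countable_univ_iff]
  refine Set.PairwiseDisjoint.countable_of_isOpen (s := fun i => Metric.ball (v i) (1 / 2))
    (fun i _ j _ hij => ?_) (fun _ _ => Metric.isOpen_ball)
    (fun i _ => Metric.nonempty_ball.2 (by norm_num))
  refine Metric.ball_disjoint_ball ?_
  have h1 : ‖v i - v j‖ ^ 2 = 2 := by
    rw [norm_sub_sq (𝕜 := ℂ), hv.2 hij, hv.1 i, hv.1 j]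
    norm_num
  rw [dist_eq_norm]
  nlinarith [norm_nonneg (v i - v j)]

theorem exists_parseval_sequence (H : Type*) [NormedAddCommGroup H] [InnerProductSpace ℂ H]
    [CompleteSpace H] [TopologicalSpace.SeparableSpace H] :
    ∃ b : ℕ → H, ∀ x y, HasSum (fun i => inner ℂ x (b i) * inner ℂ (b i) y) (inner ℂ x y) := by
  obtain ⟨w, b, -⟩ := exists_hilbertBasis ℂ H
  have := Orthonormal.countable b.orthonormal
  obtain ⟨e, he⟩ := exists_injective_nat w
  -- The basis is padded with zero vectors, so one index set `ℕ` serves finite and infinite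
  -- dimension alike.
  refine ⟨Function.extend e b 0, fun x y => ?_⟩
  rw [← he.hasSum_iff]
  · refine (b.hasSum_inner_mul_inner x y).congr_fun fun i => ?_
    simp [he.extend_apply]
  · intro i hi
    rw [Function.extend_apply' _ _ _ (by simpa using hi)]
    simp

theorem tsum_enorm_inner_sq {H : Type*} [NormedAddCommGroup H] [InnerProductSpace ℂ H]
    {b : ℕ → H}
    (hb : ∀ x y, HasSum (fun i => inner ℂ x (b i) * inner ℂ (b i) y) (inner ℂ x y)) (x : H) :
    ∑' i, ‖inner ℂ x (b i)‖ₑ ^ 2 = ‖x‖ₑ ^ 2 := by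
  have h1 : HasSum (fun i => ‖inner ℂ x (b i)‖ ^ 2) (‖x‖ ^ 2) := by
    have := Complex.hasSum_re (hb x x)
    rw [inner_self_eq_norm_sq_to_K] at this
    convert this using 1
    · funext i
      rw [← inner_conj_symm (b i) x, Complex.mul_conj, Complex.ofReal_re, Complex.normSq_eq_norm_sq]
    · norm_cast
  have h2 := ENNReal.ofReal_tsum_of_nonneg (fun i => sq_nonneg ‖inner ℂ x (b i)‖) h1.summable
  rw [h1.tsum_eq] at h2
  simp only [ENNReal.ofReal_pow (norm_nonneg _), ofReal_norm] at h2
  exact h2.symm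

variable {V : Type*} [MeasurableSpace V] {ν : Measure V}

theorem memLp_mul_phase {g : V → ℂ} (hg : MemLp g 2 ν) {θ : V → ℝ} (hθ : Measurable θ) :
    MemLp (fun ξ => g ξ * Complex.exp (θ ξ * Complex.I)) 2 ν := by
  refine hg.congr_norm ?_ (Eventually.of_forall fun ξ => ?_)
  · exact hg.1.mul (by fun_prop)
  · simp [Complex.norm_exp_ofReal_mul_I]

theorem enorm_toLp_mul_phase {g : V → ℂ} (hg : MemLp g 2 ν) {θ : V → ℝ} (hθ : Measurable θ) :
    ‖(memLp_mul_phase hg hθ).toLp‖ₑ = eLpNorm g 2 ν := by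
  rw [Lp.enorm_toLp]
  refine eLpNorm_congr_norm_ae (Eventually.of_forall fun ξ => ?_)
  simp [Complex.norm_exp_ofReal_mul_I]

theorem continuous_inner_toLp_mul_phase {X : Type*} [TopologicalSpace X]
    [FirstCountableTopology X] {g : V → ℂ} (hg : MemLp g 2 ν)
    {θ : X → V → ℝ} (hθ : ∀ x, Measurable (θ x)) (hc : ∀ ξ, Continuous fun x => θ x ξ)
    (b : Lp ℂ 2 ν) :
    Continuous fun x => inner ℂ (memLp_mul_phase hg (hθ x)).toLp b := by
  have h1 : ∀ x, inner ℂ (memLp_mul_phase hg (hθ x)).toLp b =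
      ∫ ξ, star (g ξ * Complex.exp (θ x ξ * Complex.I)) * b ξ ∂ν := fun x => by
    rw [inner_Lp_eq_integral]
    refine integral_congr_ae ?_
    filter_upwards [(memLp_mul_phase hg (hθ x)).coeFn_toLp] with ξ h
    rw [h]
  simp only [h1]
  refine continuous_of_dominated (bound := fun ξ => ‖g ξ‖ * ‖b ξ‖) (fun x => ?_)
    (fun x => Eventually.of_forall fun ξ => ?_) ?_ (Eventually.of_forall fun ξ => ?_)
  · exact (memLp_mul_phase hg (hθ x)).1.star.mul (Lp.aestronglyMeasurable b)
  · simp [Complex.norm_exp_ofReal_mul_I]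
  · exact hg.norm.integrable_mul (Lp.memLp b).norm
  · have := hc ξ
    fun_prop

/-- Fourier inversion presents `K(X, Y)` as the integral of a Schwartz function `w` against a phase
that factors into an `X` part and a `Y` part. Distributing `√|w|` over both parts makes `K(X, Y)` an
inner product of two vectors of `L²`, whose norms do not depend on `X` or `Y`. Parseval then yields
the expansion, with uniform bounds on the sums of squares. -/
theorem exists_nuclear_expansion {E : Type*} [NormedAddCommGroup E] [InnerProductSpace ℝ E]
    [FiniteDimensional ℝ E] {K : E × E → ℂ} (hK : ContDiff ℝ ∞ K) (hc : HasCompactSupport K) :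
    ∃ (α β : ℕ → E → ℂ) (A : ℝ≥0∞), A ≠ ⊤ ∧ (∀ i, Continuous (α i)) ∧ (∀ i, Continuous (β i)) ∧
      (∀ X, ∑' i, ‖α i X‖ₑ ^ 2 ≤ A) ∧ (∀ Y, ∑' i, ‖β i Y‖ₑ ^ 2 ≤ A) ∧
      ∀ X Y, HasSum (fun i => α i X * β i Y) (K (X, Y)) := by
  let : MeasurableSpace E := borel E
  have : BorelSpace E := ⟨rfl⟩
  have : Fact ((2 : ℝ≥0∞) ≠ ⊤) := ⟨by norm_num⟩
  let W := WithLp 2 (E × E)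
  let L : W ≃L[ℝ] E × E := WithLp.prodContinuousLinearEquiv 2 ℝ E E
  let f : SchwartzMap W ℂ := (hc.comp_homeomorph L.toHomeomorph).toSchwartzMap
    (f := fun x => K (L x)) (hK.comp L.contDiff)
  let w : W → ℂ := ⇑(FourierTransform.fourier f)
  have hwi : Integrable w := (FourierTransform.fourier f).integrable
  have hwm : Measurable w := (FourierTransform.fourier f).continuous.measurable
  have hinv : ∀ x : W, K (L x) = ∫ ξ, Complex.exp ((2 * Real.pi * inner ℝ ξ x : ℝ) * Complex.I) * w ξ := by
    intro x
    have h1 := congrFun (f.continuous.fourierInv_fourier_eq f.integrable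
      (by rw [← SchwartzMap.fourier_coe]; exact hwi)) x
    rw [← SchwartzMap.fourier_coe, Real.fourierInv_eq'] at h1
    exact h1.symm
  set r : W → ℂ := fun ξ => (√‖w ξ‖ : ℝ) with hr
  set s : W → ℂ := fun ξ => w ξ / (√‖w ξ‖ : ℝ) with hs
  have hrn : ∀ ξ, ‖r ξ‖ ^ 2 = ‖w ξ‖ := fun ξ => by
    rw [hr, Complex.norm_real, Real.norm_of_nonneg (Real.sqrt_nonneg _),
      Real.sq_sqrt (norm_nonneg _)]
  have hrs : ∀ ξ, r ξ * s ξ = w ξ := fun ξ => by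
    by_cases h : w ξ = 0
    · simp [hr, hs, h]
    · refine mul_div_cancel₀ _ ?_
      simpa [hr, Real.sqrt_eq_zero'] using h
  have hrm : Measurable r := Complex.measurable_ofReal.comp hwm.norm.sqrt
  have hsm : Measurable s := hwm.div hrm
  have hsn : ∀ ξ, ‖s ξ‖ = ‖r ξ‖ := fun ξ => by
    by_cases h : r ξ = 0
    · have : w ξ = 0 := by simpa [h] using (hrn ξ).symm
      simp [hs, hr, this]
    · refine mul_left_cancel₀ (norm_ne_zero_iff.2 h) ?_
      rw [← norm_mul, hrs, ← hrn, pow_two]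
  have hr2 : MemLp r 2 volume := by
    rw [memLp_two_iff_integrable_sq_norm hrm.aestronglyMeasurable]
    simpa only [hrn] using hwi.norm
  have hs2 : MemLp s 2 volume :=
    hr2.congr_norm hsm.aestronglyMeasurable (Eventually.of_forall fun ξ => (hsn ξ).symm)
  obtain ⟨b, hb⟩ := exists_parseval_sequence (Lp ℂ 2 (volume : Measure W))
  -- The minus sign compensates for the inner product being conjugate linear in its first argument.
  let θ : E → W → ℝ := fun X ξ => -(2 * Real.pi * inner ℝ (L ξ).1 X)
  let τ : E → W → ℝ := fun Y ξ => 2 * Real.pi * inner ℝ (L ξ).2 Y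
  have hθ : ∀ X, Measurable (θ X) := fun X => by
    have : Continuous (θ X) := by fun_prop
    exact this.measurable
  have hτ : ∀ X, Measurable (τ X) := fun X => by
    have : Continuous (τ X) := by fun_prop
    exact this.measurable
  have hcomm : ∀ i Y, inner ℂ (b i) (memLp_mul_phase hs2 (hτ Y)).toLp =
      (starRingEnd ℂ) (inner ℂ (memLp_mul_phase hs2 (hτ Y)).toLp (b i)) := fun i Y =>
    (inner_conj_symm _ _).symm
  refine ⟨fun i X => inner ℂ (memLp_mul_phase hr2 (hθ X)).toLp (b i),
    fun i Y => inner ℂ (b i) (memLp_mul_phase hs2 (hτ Y)).toLp, eLpNorm r 2 volume ^ 2,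
    ENNReal.pow_ne_top hr2.2.ne, fun i => ?_, fun i => ?_, fun X => ?_, fun Y => ?_,
    fun X Y => ?_⟩
  · exact continuous_inner_toLp_mul_phase hr2 hθ (fun ξ => by fun_prop) (b i)
  · simp only [hcomm]
    exact Complex.continuous_conj.comp
      (continuous_inner_toLp_mul_phase hs2 hτ (fun ξ => by fun_prop) (b i))
  · rw [tsum_enorm_inner_sq hb, enorm_toLp_mul_phase hr2 (hθ X)]
  · simp only [hcomm, RCLike.enorm_conj]
    rw [tsum_enorm_inner_sq hb, enorm_toLp_mul_phase hs2 (hτ Y)]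
    exact le_of_eq (congrArg (· ^ 2)
      (eLpNorm_congr_norm_ae (Eventually.of_forall hsn)))
  · have h1 := hb (memLp_mul_phase hr2 (hθ X)).toLp (memLp_mul_phase hs2 (hτ Y)).toLp
    convert h1 using 1
    rw [inner_Lp_eq_integral]
    have h2 := hinv (L.symm (X, Y))
    rw [L.apply_symm_apply] at h2
    rw [h2]
    refine integral_congr_ae ?_
    filter_upwards [(memLp_mul_phase hr2 (hθ X)).coeFn_toLp,
      (memLp_mul_phase hs2 (hτ Y)).coeFn_toLp] with ξ e1 e2
    rw [e1, e2, ← hrs]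
    have h3 : inner ℝ ξ (L.symm (X, Y)) = inner ℝ (L ξ).1 X + inner ℝ (L ξ).2 Y :=
      WithLp.prod_inner_apply _ _
    rw [h3]
    have h4 : star (r ξ) = r ξ := Complex.conj_ofReal _
    rw [star_mul', h4, show star (Complex.exp (θ X ξ * Complex.I)) =
      Complex.exp (-(θ X ξ) * Complex.I) by
        rw [Complex.star_def, ← Complex.exp_conj]; simp]
    rw [show ((2 * Real.pi * (inner ℝ (L ξ).1 X + inner ℝ (L ξ).2 Y) : ℝ) : ℂ) * Complex.I =
      -(θ X ξ) * Complex.I + τ Y ξ * Complex.I by simp only [θ, τ]; push_cast; ring,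
      Complex.exp_add]
    ring

end NuclearExpansion


/-! ### Trace class operators given by product expansions. -/

section TraceClass

variable {H : Type*} [NormedAddCommGroup H] [InnerProductSpace ℂ H] [CompleteSpace H]

theorem exists_hasSum_inner_smul {u v : ℕ → H} (h : Summable fun i => ‖u i‖ * ‖v i‖) :
    ∃ T : H →L[ℂ] H, ∀ x, HasSum (fun i => inner ℂ (u i) x • v i) (T x) := by
  have h1 : Summable fun i => (innerSL ℂ (u i)).smulRight (v i) :=
    Summable.of_norm (by simpa [ContinuousLinearMap.norm_smulRight_apply] using h)
  exact ⟨_, fun x => h1.hasSum.map (ContinuousLinearMap.apply ℂ H x)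
    (ContinuousLinearMap.apply ℂ H x).continuous⟩

theorem Orthonormal.sum_norm_inner_mul_inner_le {ι : Type*} {b : ι → H} (hb : Orthonormal ℂ b)
    (x y : H) (s : Finset ι) :
    ∑ j ∈ s, ‖inner ℂ x (b j) * inner ℂ (b j) y‖ ≤ ‖x‖ * ‖y‖ := by
  simp only [norm_mul]
  refine (Real.sum_mul_le_sqrt_mul_sqrt _ _ _).trans ?_
  refine mul_le_mul ?_ ?_ (Real.sqrt_nonneg _) (norm_nonneg _)
  · refine Real.sqrt_le_iff.2 ⟨norm_nonneg _, ?_⟩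
    simp only [norm_inner_symm x]
    exact hb.sum_inner_products_le x
  · exact Real.sqrt_le_iff.2 ⟨norm_nonneg _, hb.sum_inner_products_le y⟩

/-- Cauchy–Schwarz and Bessel make the double series over expansion index and basis vector
absolutely summable. Summing over the basis first gives `∑ ⟨u i, v i⟩` by Parseval; the other order
gives the trace. -/
theorem hasTrace_of_hasSum {u v : ℕ → H} (h : Summable fun i => ‖u i‖ * ‖v i‖) {T : H →L[ℂ] H}
    (hT : ∀ x, HasSum (fun i => inner ℂ (u i) x • v i) (T x)) {t : ℂ}
    (ht : HasSum (fun i => inner ℂ (u i) (v i)) t) : HasTrace T t := by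
  refine ⟨⟨u, v, h, hT⟩, fun s b => ?_⟩
  set f : ℕ × s → ℂ := fun z => inner ℂ (u z.1) (b z.2) * inner ℂ (b z.2) (v z.1) with hf
  have hle := fun i => Orthonormal.sum_norm_inner_mul_inner_le b.orthonormal (u i) (v i)
  have hs : Summable f := by
    refine Summable.of_norm ?_
    have h1 : ∀ i, Summable fun j => ‖f (i, j)‖ := fun i =>
      summable_of_sum_le (fun _ => norm_nonneg _) (hle i)
    refine (summable_prod_of_nonneg fun _ => norm_nonneg _).2 ⟨h1, ?_⟩
    exact h.of_nonneg_of_le (fun i => tsum_nonneg fun _ => norm_nonneg _)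
      fun i => (h1 i).tsum_le_of_sum_le (hle i)
  have h1 := hs.hasSum.prod_fiberwise fun i => b.hasSum_inner_mul_inner (u i) (v i)
  have h2 := ((Equiv.prodComm s ℕ).hasSum_iff (a := ∑' z, f z)).2 hs.hasSum
  rw [h1.unique ht] at h2
  refine h2.prod_fiberwise fun j => ?_
  refine ((hT (b j)).mapL (innerSL ℂ (b j))).congr_fun fun i => ?_
  simp [hf]

variable {Ω : Type*} [MeasurableSpace Ω] {μ : Measure Ω}

/-- The partial sums converge in `L²`, hence almost everywhere along a subsequence, and there the
limit must be the pointwise sum. -/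
theorem ae_hasSum_coeFn {c : ℕ → ℂ} {v : ℕ → Lp ℂ 2 μ} {w : Lp ℂ 2 μ}
    (h : HasSum (fun i => c i • v i) w) {f : ℕ → Ω → ℂ} (hf : ∀ i, v i =ᵐ[μ] f i) {g : Ω → ℂ}
    (hg : ∀ᵐ a ∂μ, HasSum (fun i => c i * f i a) (g a)) : w =ᵐ[μ] g := by
  have h1 : TendstoInMeasure μ (fun n => (∑ i ∈ Finset.range n, c i • v i : Lp ℂ 2 μ)) atTop w :=
    tendstoInMeasure_of_tendsto_Lp h.tendsto_sum_nat
  obtain ⟨ns, hns, h2⟩ := h1.exists_seq_tendsto_ae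
  have h3 : ∀ n, (∑ i ∈ Finset.range n, c i • v i : Lp ℂ 2 μ) =ᵐ[μ]
      fun a => ∑ i ∈ Finset.range n, c i * f i a := fun n => by
    have : ∀ i, ∀ᵐ a ∂μ, (c i • v i : Lp ℂ 2 μ) a = c i * f i a := fun i => by
      filter_upwards [Lp.coeFn_smul (c i) (v i), hf i] with a e1 e2
      rw [e1, Pi.smul_apply, e2, smul_eq_mul]
    induction n with
    | zero =>
      filter_upwards [Lp.coeFn_zero ℂ 2 μ] with a ha
      simpa using ha
    | succ n ih =>
      rw [Finset.sum_range_succ]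
      filter_upwards [Lp.coeFn_add (∑ i ∈ Finset.range n, c i • v i) (c n • v n), ih, this n]
        with a e1 e2 e3
      rw [e1, Pi.add_apply, e2, e3, Finset.sum_range_succ]
  filter_upwards [h2, ae_all_iff.2 h3, hg] with a e1 e2 e3
  simp only [e2] at e1
  exact tendsto_nhds_unique e1 (e3.tendsto_sum_nat.comp hns.tendsto_atTop)

theorem summable_mul_of_tsum_enorm_sq {a b : ℕ → ℝ} (ha : ∀ i, 0 ≤ a i) (hb : ∀ i, 0 ≤ b i)
    (hA : ∑' i, ENNReal.ofReal (a i) ^ 2 ≠ ⊤) (hB : ∑' i, ENNReal.ofReal (b i) ^ 2 ≠ ⊤) :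
    Summable fun i => a i * b i := by
  have aux : ∀ c : ℕ → ℝ, (∀ i, 0 ≤ c i) → ∑' i, ENNReal.ofReal (c i) ^ 2 ≠ ⊤ →
      Summable fun i => c i ^ 2 := fun c hc h => by
    have := ENNReal.summable_toReal h
    refine this.congr fun i => ?_
    rw [← ENNReal.ofReal_pow (hc i), ENNReal.toReal_ofReal (sq_nonneg _)]
  refine ((aux a ha hA).add (aux b hb hB)).of_nonneg_of_le
    (fun i => mul_nonneg (ha i) (hb i)) fun i => ?_
  nlinarith [sq_nonneg (a i - b i), sq_nonneg (a i + b i), ha i, hb i]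

theorem tsum_eLpNorm_sq {f : ℕ → Ω → ℂ} (hf : ∀ i, AEStronglyMeasurable (f i) μ) :
    ∑' i, eLpNorm (f i) 2 μ ^ 2 = ∫⁻ a, ∑' i, ‖f i a‖ₑ ^ 2 ∂μ := by
  rw [lintegral_tsum fun i => (hf i).enorm.pow_const 2]
  refine tsum_congr fun i => ?_
  have := eLpNorm_nnreal_pow_eq_lintegral (f := f i) (μ := μ) (p := 2) (by norm_num)
  norm_num at this
  exact_mod_cast this

theorem memLp_of_lintegral_tsum {f : ℕ → Ω → ℂ} (hf : ∀ i, AEStronglyMeasurable (f i) μ)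
    (h : ∫⁻ a, ∑' i, ‖f i a‖ₑ ^ 2 ∂μ ≠ ⊤) (i : ℕ) : MemLp (f i) 2 μ := by
  rw [memLp_two_iff_lintegral (hf i)]
  exact (lintegral_mono fun a => ENNReal.le_tsum i).trans_lt h.lt_top

theorem tsum_ofReal_norm_sq {f : ℕ → Ω → ℂ} (hf : ∀ i, MemLp (f i) 2 μ)
    (h : ∫⁻ a, ∑' i, ‖f i a‖ₑ ^ 2 ∂μ ≠ ⊤) :
    ∑' i, ENNReal.ofReal (eLpNorm (f i) 2 μ).toReal ^ 2 ≠ ⊤ := by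
  simp only [ENNReal.ofReal_toReal (hf _).2.ne]
  rwa [tsum_eLpNorm_sq fun i => (hf i).1]

theorem integral_norm_mul_le_eLpNorm {f g : Ω → ℂ} (hf : MemLp f 2 μ) (hg : MemLp g 2 μ) :
    ∫ a, ‖f a * g a‖ ∂μ ≤ (eLpNorm f 2 μ).toReal * (eLpNorm g 2 μ).toReal := by
  have h1 : ∫ a, ‖f a * g a‖ ∂μ = (eLpNorm (fun a => f a * g a) 1 μ).toReal := by
    rw [eLpNorm_one_eq_lintegral_enorm]
    exact integral_norm_eq_lintegral_enorm (hf.1.mul hg.1)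
  rw [h1, ← ENNReal.toReal_mul]
  refine ENNReal.toReal_mono (ENNReal.mul_ne_top hf.2.ne hg.2.ne) ?_
  have h2 := eLpNorm_smul_le_mul_eLpNorm (p := 2) (q := 2) (r := 1) hg.1 hf.1
  rw [smul_eq_mul] at h2
  exact h2

/-- The pointwise series of a kernel operator with an expansion of finite mass. -/
theorem hasSum_mul_integral {β : ℕ → Ω → ℂ} (hβ : ∀ i, AEStronglyMeasurable (β i) μ)
    (hB : ∫⁻ b, ∑' i, ‖β i b‖ₑ ^ 2 ∂μ ≠ ⊤) {ψ : Ω → ℂ} (hψ : MemLp ψ 2 μ) {α : ℕ → ℂ}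
    (hα : ∑' i, ‖α i‖ₑ ^ 2 ≠ ⊤) {k : Ω → ℂ} (hk : ∀ᵐ b ∂μ, HasSum (fun i => α i * β i b) (k b)) :
    HasSum (fun i => α i * ∫ b, β i b * ψ b ∂μ) (∫ b, k b * ψ b ∂μ) := by
  have hβ2 := memLp_of_lintegral_tsum hβ hB
  have hint : ∀ i, Integrable (fun b => α i * (β i b * ψ b)) μ := fun i =>
    ((hβ2 i).integrable_mul hψ).const_mul _
  have hs : Summable fun i => ∫ b, ‖α i * (β i b * ψ b)‖ ∂μ := by
    have h1 : Summable fun i => ‖α i‖ * (eLpNorm (β i) 2 μ).toReal :=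
      summable_mul_of_tsum_enorm_sq (fun _ => norm_nonneg _) (fun _ => ENNReal.toReal_nonneg)
        (by simpa only [ofReal_norm] using hα) (tsum_ofReal_norm_sq hβ2 hB)
    refine (h1.mul_right (eLpNorm ψ 2 μ).toReal).of_nonneg_of_le
      (fun i => integral_nonneg fun _ => norm_nonneg _) fun i => ?_
    have h2 : ∫ b, ‖α i * (β i b * ψ b)‖ ∂μ = ‖α i‖ * ∫ b, ‖β i b * ψ b‖ ∂μ := by
      rw [← integral_const_mul]
      exact integral_congr_ae (Eventually.of_forall fun b => norm_mul _ _)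
    rw [h2, mul_assoc]
    exact mul_le_mul_of_nonneg_left (integral_norm_mul_le_eLpNorm (hβ2 i) hψ) (norm_nonneg _)
  have h2 := hasSum_integral_of_summable_integral_norm hint hs
  have h3 : ∫ b, k b * ψ b ∂μ = ∫ b, ∑' i, α i * (β i b * ψ b) ∂μ := by
    refine integral_congr_ae ?_
    filter_upwards [hk] with b hb
    have := (hb.mul_right (ψ b)).tsum_eq
    simp only [mul_assoc] at this
    exact this.symm
  rw [h3]
  exact h2.congr_fun fun i => (integral_const_mul (μ := μ) (α i) fun b => β i b * ψ b).symm

theorem hasSum_integral_of_expansion {α β : ℕ → Ω → ℂ} (hα : ∀ i, AEStronglyMeasurable (α i) μ)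
    (hβ : ∀ i, AEStronglyMeasurable (β i) μ) (hA : ∫⁻ a, ∑' i, ‖α i a‖ₑ ^ 2 ∂μ ≠ ⊤)
    (hB : ∫⁻ b, ∑' i, ‖β i b‖ₑ ^ 2 ∂μ ≠ ⊤) {d : Ω → ℂ}
    (hd : ∀ᵐ a ∂μ, HasSum (fun i => α i a * β i a) (d a)) :
    HasSum (fun i => ∫ a, α i a * β i a ∂μ) (∫ a, d a ∂μ) := by
  have hα2 := memLp_of_lintegral_tsum hα hA
  have hβ2 := memLp_of_lintegral_tsum hβ hB
  have hint : ∀ i, Integrable (fun b => α i b * β i b) μ := fun i =>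
    (hα2 i).integrable_mul (hβ2 i)
  have h1 : Summable fun i => ∫ b, ‖α i b * β i b‖ ∂μ := by
    refine (summable_mul_of_tsum_enorm_sq (fun _ => ENNReal.toReal_nonneg)
      (fun _ => ENNReal.toReal_nonneg) (tsum_ofReal_norm_sq hα2 hA)
      (tsum_ofReal_norm_sq hβ2 hB)).of_nonneg_of_le
      (fun i => integral_nonneg fun _ => norm_nonneg _) fun i => ?_
    exact integral_norm_mul_le_eLpNorm (hα2 i) (hβ2 i)
  have h4 : ∫ a, d a ∂μ = ∫ a, ∑' i, α i a * β i a ∂μ := by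
    refine integral_congr_ae ?_
    filter_upwards [hd] with a ha
    exact ha.tsum_eq.symm
  rw [h4]
  exact hasSum_integral_of_summable_integral_norm hint h1

theorem integrable_of_expansion {α β : ℕ → Ω → ℂ} (hα : ∀ i, AEStronglyMeasurable (α i) μ)
    (hβ : ∀ i, AEStronglyMeasurable (β i) μ) (hA : ∫⁻ a, ∑' i, ‖α i a‖ₑ ^ 2 ∂μ ≠ ⊤)
    (hB : ∫⁻ b, ∑' i, ‖β i b‖ₑ ^ 2 ∂μ ≠ ⊤) {d : Ω → ℂ}
    (hd : ∀ᵐ a ∂μ, HasSum (fun i => α i a * β i a) (d a)) : Integrable d μ := by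
  refine ⟨aestronglyMeasurable_of_tendsto_ae atTop
    (f := fun n a => ∑ i ∈ Finset.range n, α i a * β i a)
    (fun n => Finset.aestronglyMeasurable_fun_sum _ fun i _ => (hα i).mul (hβ i))
    (hd.mono fun a ha => ha.tendsto_sum_nat), ?_⟩
  have h2 : ∫⁻ a, (∑' i, ‖α i a‖ₑ ^ 2 + ∑' i, ‖β i a‖ₑ ^ 2) ∂μ < ⊤ := by
    rw [lintegral_add_left' (AEMeasurable.tsum fun i => (hα i).enorm.pow_const 2)]
    exact ENNReal.add_lt_top.2 ⟨hA.lt_top, hB.lt_top⟩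
  refine lt_of_le_of_lt (lintegral_mono_ae ?_) h2
  filter_upwards [hd] with a ha
  rw [← ha.tsum_eq, ← ENNReal.tsum_add]
  refine (enorm_tsum_le_tsum_enorm).trans (ENNReal.tsum_le_tsum fun i => ?_)
  rw [enorm_mul]
  rcases le_total ‖α i a‖ₑ ‖β i a‖ₑ with h | h
  · exact (mul_le_mul_left h _).trans (by rw [← pow_two]; exact le_add_self)
  · exact (mul_le_mul_right h _).trans (by rw [← pow_two]; exact le_self_add)

/-- The diagonal may be a null set for the product measure, so the trace is expressed through the
function `d` that sums the expansion on the diagonal. The last clause identifies `T ψ` with any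
pointwise sum, which makes the construction usable for both `f̂` and `Δ_x f̂`. -/
theorem exists_hasTrace_of_expansion {α β : ℕ → Ω → ℂ} (hα : ∀ i, AEStronglyMeasurable (α i) μ)
    (hβ : ∀ i, AEStronglyMeasurable (β i) μ) (hA : ∫⁻ a, ∑' i, ‖α i a‖ₑ ^ 2 ∂μ ≠ ⊤)
    (hB : ∫⁻ b, ∑' i, ‖β i b‖ₑ ^ 2 ∂μ ≠ ⊤) {d : Ω → ℂ}
    (hd : ∀ᵐ a ∂μ, HasSum (fun i => α i a * β i a) (d a)) :
    ∃ T : Lp ℂ 2 μ →L[ℂ] Lp ℂ 2 μ, HasTrace T (∫ a, d a ∂μ) ∧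
      ∀ (ψ : Lp ℂ 2 μ) (g : Ω → ℂ),
        (∀ᵐ a ∂μ, HasSum (fun i => α i a * ∫ b, β i b * ψ b ∂μ) (g a)) → T ψ =ᵐ[μ] g := by
  have hα2 := memLp_of_lintegral_tsum hα hA
  have hβ2 := memLp_of_lintegral_tsum hβ hB
  have hβs : ∀ i, MemLp (fun b => star (β i b)) 2 μ := fun i => (hβ2 i).star
  set u : ℕ → Lp ℂ 2 μ := fun i => (hβs i).toLp
  set v : ℕ → Lp ℂ 2 μ := fun i => (hα2 i).toLp
  have hu : ∀ i, ‖u i‖ = (eLpNorm (β i) 2 μ).toReal := fun i => by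
    rw [Lp.norm_toLp]
    congr 1
    exact eLpNorm_congr_norm_ae (Eventually.of_forall fun b => norm_star _)
  have hv : ∀ i, ‖v i‖ = (eLpNorm (α i) 2 μ).toReal := fun i => Lp.norm_toLp _ _
  have hs : Summable fun i => ‖u i‖ * ‖v i‖ := by
    simp only [hu, hv]
    exact summable_mul_of_tsum_enorm_sq (fun _ => ENNReal.toReal_nonneg)
      (fun _ => ENNReal.toReal_nonneg) (tsum_ofReal_norm_sq hβ2 hB) (tsum_ofReal_norm_sq hα2 hA)
  have hin : ∀ i (ψ : Lp ℂ 2 μ), inner ℂ (u i) ψ = ∫ b, β i b * ψ b ∂μ := fun i ψ => by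
    rw [inner_Lp_eq_integral]
    refine integral_congr_ae ?_
    filter_upwards [(hβs i).coeFn_toLp] with b hb
    rw [hb, star_star]
  obtain ⟨T, hT⟩ := exists_hasSum_inner_smul hs
  refine ⟨T, hasTrace_of_hasSum hs hT ?_, fun ψ g hg => ?_⟩
  · refine (hasSum_integral_of_expansion hα hβ hA hB hd).congr_fun fun i => ?_
    rw [hin]
    refine integral_congr_ae ?_
    filter_upwards [(hα2 i).coeFn_toLp] with b hb
    rw [hb, mul_comm]
  · refine ae_hasSum_coeFn (hT ψ) (fun i => (hα2 i).coeFn_toLp) ?_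
    filter_upwards [hg] with a ha
    simp only [hin]
    exact ha.congr_fun fun i => mul_comm _ _

end TraceClass


/-! ### Expansions over a compact set. -/

section LocalExpansion

/-- A kernel on the group pulled back by `exp` need not have compact support. Multiplying by a
product bump equal to `1` on `C × C` restores it without changing the values needed. -/
theorem exists_local_expansion {E : Type*} [NormedAddCommGroup E] [InnerProductSpace ℝ E]
    [FiniteDimensional ℝ E] {K : E × E → ℂ} (hK : ContDiff ℝ ∞ K) {C : Set E} (hC : IsCompact C) :
    ∃ (α β : ℕ → E → ℂ) (A : ℝ≥0∞), A ≠ ⊤ ∧ (∀ i, Continuous (α i)) ∧ (∀ i, Continuous (β i)) ∧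
      (∀ X, ∑' i, ‖α i X‖ₑ ^ 2 ≤ A) ∧ (∀ Y, ∑' i, ‖β i Y‖ₑ ^ 2 ≤ A) ∧
      ∀ X ∈ C, ∀ Y ∈ C, HasSum (fun i => α i X * β i Y) (K (X, Y)) := by
  obtain ⟨R, hR, hCR⟩ := hC.isBounded.subset_ball_lt 0 (0 : E)
  let χ : ContDiffBump (0 : E) := ⟨R, R + 1, hR, lt_add_one R⟩
  have h1 : ContDiff ℝ ∞ fun z : E × E => (χ z.1 * χ z.2 : ℝ) • K z :=
    ((χ.contDiff.comp contDiff_fst).mul (χ.contDiff.comp contDiff_snd)).smul hK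
  have h2 : HasCompactSupport fun z : E × E => (χ z.1 * χ z.2 : ℝ) • K z := by
    refine HasCompactSupport.intro (χ.hasCompactSupport.isCompact.prod
      χ.hasCompactSupport.isCompact) fun z hz => ?_
    rw [mem_prod, not_and_or] at hz
    rcases hz with hz | hz
    · simp [image_eq_zero_of_notMem_tsupport hz]
    · simp [image_eq_zero_of_notMem_tsupport hz]
  obtain ⟨α, β, A, hA, hα, hβ, hα2, hβ2, h⟩ := exists_nuclear_expansion h1 h2
  refine ⟨α, β, A, hA, hα, hβ, hα2, hβ2, fun X hX Y hY => ?_⟩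
  have h3 : ∀ Z ∈ C, χ Z = 1 := fun Z hZ =>
    χ.one_of_mem_closedBall (Metric.ball_subset_closedBall (hCR hZ))
  simpa [h3 X hX, h3 Y hY] using h X Y

end LocalExpansion

/-! ### Integral kernels on the group and local integrability of `j_q`. -/

section Kernel

variable {E : Type*} [NormedAddCommGroup E] [InnerProductSpace ℝ E] [FiniteDimensional ℝ E]
  [MeasurableSpace E] [BorelSpace E]
  {G : Type*} [TopologicalSpace G] [T2Space G] [SecondCountableTopology G] [ChartedSpace E G]
  [Group G] [LieGroup 𝓘(ℝ, E) ∞ G] [MeasurableSpace G] [BorelSpace G] {O : Set E}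
  {μ : Measure G} {k : G × G → ℂ}

theorem exists_compact_of_hasCompactSupport (hc : HasCompactSupport k) :
    ∃ S : Set G, IsCompact S ∧ ∀ a b, k (a, b) ≠ 0 → a ∈ S ∧ b ∈ S := by
  refine ⟨Prod.fst '' tsupport k ∪ Prod.snd '' tsupport k,
    (hc.isCompact.image continuous_fst).union (hc.isCompact.image continuous_snd),
    fun a b hab => ?_⟩
  have := subset_tsupport k hab
  exact ⟨Or.inl ⟨_, this, rfl⟩, Or.inr ⟨_, this, rfl⟩⟩

theorem contDiff_kernel_comp (hk : ContMDiff (𝓘(ℝ, E).prod 𝓘(ℝ, E)) 𝓘(ℝ, ℂ) ∞ k)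
    {g h : E × E → G} (hg : ContMDiff 𝓘(ℝ, E × E) 𝓘(ℝ, E) ∞ g)
    (hh : ContMDiff 𝓘(ℝ, E × E) 𝓘(ℝ, E) ∞ h) :
    ContDiff ℝ ∞ fun z : E × E => k (g z, h z) :=
  (hk.comp (hg.prodMk hh)).contDiff

namespace IsWeaklyExponential

variable (hO : IsWeaklyExponential G O)

include hO

theorem integral_haarExp (μ : Measure G) (F : E → ℂ) :
    ∫ X, F X ∂haarExp μ O = ∫ X in O, (expDensity G X : ℂ) * F X ∂algMeasure E μ := by
  rw [haarExp_eq, integral_withDensity_eq_integral_toReal_smul measurable_ofReal_expDensity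
    (by simp)]
  refine integral_congr_ae (Eventually.of_forall fun X => ?_)
  simp only [ENNReal.toReal_ofReal (expDensity_nonneg X), Complex.real_smul]

theorem integral_comp_V [μ.IsHaarMeasure] (q : G) {F : E → ℂ} (hF : StronglyMeasurable F) :
    ∫ a, F (V O q a) ∂μ = ∫ X in O, (expDensity G X : ℂ) * F X ∂algMeasure E μ := by
  rw [← hO.integral_haarExp μ F, ← (hO.measurePreserving_V (μ := μ) q).map_eq,
    integral_map (hO.measurable_V q).aemeasurable hF.aestronglyMeasurable]

theorem contMDiff_translate_exp {F : Type*} [NormedAddCommGroup F] [NormedSpace ℝ F] (a : G)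
    {u : F → E} (hu : ContDiff ℝ ∞ u) :
    ContMDiff 𝓘(ℝ, F) 𝓘(ℝ, E) ∞ fun z => a * lieExp G (u z) :=
  contMDiff_const.mul (hO.contMDiff_exp.comp hu.contMDiff)

/-- An integral kernel on `G` expands into products of functions of finite total mass. -/
theorem exists_kernel_expansion [μ.IsHaarMeasure]
    (hk : ContMDiff (𝓘(ℝ, E).prod 𝓘(ℝ, E)) 𝓘(ℝ, ℂ) ∞ k) (hc : HasCompactSupport k) :
    ∃ (α β : ℕ → G → ℂ) (A : ℝ≥0∞) (S : Set G), A ≠ ⊤ ∧ IsCompact S ∧ (∀ i, Measurable (α i)) ∧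
      (∀ i, Measurable (β i)) ∧
      (∀ a, ∑' i, ‖α i a‖ₑ ^ 2 ≤ S.indicator (fun _ => A) a) ∧
      (∀ b, ∑' i, ‖β i b‖ₑ ^ 2 ≤ S.indicator (fun _ => A) b) ∧
      ∀ a ∈ lieExp G '' O, ∀ b ∈ lieExp G '' O, HasSum (fun i => α i a * β i b) (k (a, b)) := by
  obtain ⟨S, hS, hkS⟩ := exists_compact_of_hasCompactSupport hc
  have hu := hO.contMDiff_exp (G := G)
  obtain ⟨α, β, A, hA, hα, hβ, hα2, hβ2, h⟩ := exists_local_expansion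
    (contDiff_kernel_comp hk (hu.comp (contDiff_fst (E := E) (F := E)).contMDiff)
      (hu.comp (contDiff_snd (E := E) (F := E)).contMDiff)) (hO.isCompact_closure_log hS)
  have hbd : ∀ γ : ℕ → E → ℂ, (∀ X, ∑' i, ‖γ i X‖ₑ ^ 2 ≤ A) → ∀ a : G,
      ∑' i, ‖S.indicator (fun a => γ i (lieLog O a)) a‖ₑ ^ 2 ≤ S.indicator (fun _ => A) a := by
    intro γ hγ a
    by_cases ha : a ∈ S
    · simpa only [indicator_of_mem ha] using hγ _
    · simp [ha]
  -- Cutting the factors off outside `S` is harmless because `k` vanishes outside `S × S`, and it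
  -- makes the total mass finite.
  refine ⟨fun i => S.indicator fun a => α i (lieLog O a), fun i => S.indicator fun b =>
    β i (lieLog O b), A, S, hA, hS,
    fun i => ((hα i).measurable.comp hO.measurable_log).indicator hS.measurableSet,
    fun i => ((hβ i).measurable.comp hO.measurable_log).indicator hS.measurableSet,
    hbd α hα2, hbd β hβ2, fun a ha b hb => ?_⟩
  by_cases hab : a ∈ S ∧ b ∈ S
  · obtain ⟨h1, h2⟩ := hab
    have := h (lieLog O a) (subset_closure ⟨a, ⟨h1, ha⟩, rfl⟩) (lieLog O b)
      (subset_closure ⟨b, ⟨h2, hb⟩, rfl⟩)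
    simpa [h1, h2, lieExp_lieLog ha, lieExp_lieLog hb] using this
  · have h0 : k (a, b) = 0 := by
      by_contra h0
      exact hab (hkS a b h0)
    rw [h0]
    convert hasSum_zero (α := ℂ) (β := ℕ) using 2 with i
    rw [not_and_or] at hab
    rcases hab with h | h <;> simp [h]

/-- The denominator `|det λ|` of `j_q` may tend to zero at the boundary of `O`, but the Haar density
contains the same factor. After cancellation at most the continuous function `cosh/exp` remains,
over a compact set of logarithms. -/
theorem setLIntegral_jExp_lt_top [μ.IsHaarMeasure] (q : G) {S : Set G} (hS : IsCompact S) :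
    ∫⁻ b in S, ENNReal.ofReal (jExp G O (V O q b)) ∂μ < ⊤ := by
  have : IsTopologicalGroup G := topologicalGroup_of_lieGroup 𝓘(ℝ, E) ∞
  have := hO.isAddHaarMeasure_algMeasure μ
  have hqS : IsCompact ((fun g => q * g) ⁻¹' S) :=
    (Homeomorph.mulLeft q).isCompact_preimage.2 hS
  set C := closure (lieLog O '' ((fun g => q * g) ⁻¹' S ∩ lieExp G '' O))
  have hC : IsCompact C := hO.isCompact_closure_log hqS
  set F : E → ℝ≥0∞ := fun X => C.indicator (fun X => ENNReal.ofReal (jExp G O X)) X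
  have hF : Measurable F := (hO.measurable_jExp.ennreal_ofReal).indicator hC.measurableSet
  calc ∫⁻ b in S, ENNReal.ofReal (jExp G O (V O q b)) ∂μ ≤ ∫⁻ b, F (V O q b) ∂μ := by
        rw [← lintegral_indicator hS.measurableSet]
        refine lintegral_mono_ae ?_
        filter_upwards [hO.ae_inv_mul_mem_image q] with b hb
        by_cases h : b ∈ S
        · rw [indicator_of_mem h]
          have : V O q b ∈ C := hO.mem_closure_log (lieLog_mem hb) (by
            rw [mem_preimage, hO.lieExp_V hb]; exact h)
          simp only [F, indicator_of_mem this, le_refl]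
        · rw [indicator_of_notMem h]; exact zero_le
    _ = ∫⁻ X in O, ENNReal.ofReal (expDensity G X) * F X ∂algMeasure E μ := by
        rw [(hO.measurePreserving_V q).lintegral_comp hF, hO.lintegral_haarExp μ hF]
    _ ≤ ∫⁻ X in O, C.indicator (fun X => ENNReal.ofReal (coshDet G X / expDet G X)) X
          ∂algMeasure E μ := by
        refine setLIntegral_mono' hO.isOpen.measurableSet fun X hX => ?_
        by_cases h : X ∈ C
        · simp only [F, indicator_of_mem h]
          rw [← ENNReal.ofReal_mul (expDensity_nonneg X), expDensity_eq, jExp]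
          refine ENNReal.ofReal_le_ofReal ?_
          have h1 := hO.lambdaDet_pos hX
          have h2 := expDet_pos (G := G) X
          have h3 : O.indicator (fun _ => (1 : ℝ)) ((2 : ℝ) • X) ≤ 1 :=
            indicator_le_self' (fun _ _ => zero_le_one) _
          rw [show lambdaDet G X / expDet G X * (coshDet G X / lambdaDet G X *
            O.indicator (fun _ => (1 : ℝ)) ((2 : ℝ) • X)) = coshDet G X / expDet G X *
            O.indicator (fun _ => (1 : ℝ)) ((2 : ℝ) • X) by field_simp]
          exact mul_le_of_le_one_right (div_nonneg (coshDet_nonneg X) h2.le) h3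
        · simp only [F, indicator_of_notMem h, mul_zero, le_refl]
    _ ≤ ∫⁻ X in C, ENNReal.ofReal (coshDet G X / expDet G X) ∂algMeasure E μ := by
        rw [← lintegral_indicator hC.measurableSet]
        exact setLIntegral_le_lintegral _ _
    _ < ⊤ := by
        have hcont : Continuous fun X : E => coshDet G X / expDet G X :=
          continuous_coshDet.div continuous_expDet fun X => (expDet_pos X).ne'
        exact (hcont.continuousOn.integrableOn_compact hC).setLIntegral_lt_top

end IsWeaklyExponential

end Kernel


/-! ### The operator `f̂`, and the trace of `Δ_x f̂`. -/

section OperatorOfSymbol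

variable {E : Type*} [NormedAddCommGroup E] [InnerProductSpace ℝ E] [FiniteDimensional ℝ E]
  [MeasurableSpace E] [BorelSpace E]
  {G : Type*} [TopologicalSpace G] [T2Space G] [SecondCountableTopology G] [ChartedSpace E G]
  [Group G] [LieGroup 𝓘(ℝ, E) ∞ G] [MeasurableSpace G] [BorelSpace G] {O : Set E}
  {μ : Measure G} {k : G × G → ℂ} {f : G × StrongDual ℝ E → ℂ} {ħ : ℝ}

/-- The function on the Lie algebra whose Fourier transform is `f(q, ·)`. -/
def symbolTransform (O : Set E) (k : G × G → ℂ) (q : G) (X : E) : ℂ :=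
  O.indicator (fun X => (√(lambdaDet G X) : ℂ) *
    k (q * lieExp G (-((1 / 2 : ℝ) • X)), q * lieExp G ((1 / 2 : ℝ) • X))) X

namespace IsWeaklyExponential

variable (hO : IsWeaklyExponential G O)

include hO

/-- The points `q exp (-X/2)` and `q exp (X/2)` have quotient `exp X` and midpoint `q`. Evaluating
`k` there recovers the transform of `f` at `(q, X)` up to `F(X) = √|det λ|`, which is nonzero on
`O`. -/
theorem symbol_eq_integral (hf : HasIntegralKernel ħ O μ f k) (q : G) (p : StrongDual ℝ E) :
    f (q, p) = ∫ X, symbolTransform O k q X * Complex.exp (-(Complex.I / ħ) * (p X : ℂ))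
      ∂algMeasure E μ := by
  obtain ⟨-, -, ft, -, h0, h1, h2⟩ := hf
  rw [h2]
  congr 1
  funext X
  congr 1
  by_cases hX : X ∈ O
  · rw [symbolTransform, indicator_of_mem hX]
    have hab : (q * lieExp G (-((1 / 2 : ℝ) • X)))⁻¹ * (q * lieExp G ((1 / 2 : ℝ) • X)) =
        lieExp G X := by
      rw [lieExp_neg, mul_inv_rev, inv_inv, mul_assoc, inv_mul_cancel_left, ← lieExp_add_smul,
        show (1 / 2 : ℝ) + 1 / 2 = 1 by norm_num, one_smul]
    have h3 := h1 (q * lieExp G (-((1 / 2 : ℝ) • X))) (q * lieExp G ((1 / 2 : ℝ) • X))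
      (by rw [hab]; exact mem_image_of_mem _ hX)
    rw [V, hab, hO.lieLog_lieExp hX, mul_assoc, lieExp_neg, inv_mul_cancel, mul_one] at h3
    rw [lieExp_neg, h3, bigF_eq, mul_left_comm, Complex.ofReal_inv, mul_inv_cancel₀, mul_one]
    exact Complex.ofReal_ne_zero.2 (Real.sqrt_pos.2 (hO.lambdaDet_pos hX)).ne'
  · rw [symbolTransform, indicator_of_notMem hX, h0 q X hX]

/-- The reason for the weight in `Δ_x`: `(λ/e) · √(cosh/λ) · e = √(cosh · λ)`, and this is `√λ` at
`2X` by the doubling rule. The phase is that of `2X` as well. -/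
theorem expDensity_mul_quantizerWeight (p : StrongDual ℝ E) {X : E} (hX : X ∈ O) :
    (expDensity G X : ℂ) * quantizerWeight G ħ O p X =
      ((1 / |Real.pi * ħ| ^ Module.finrank ℝ E : ℝ) : ℂ) *
      O.indicator (fun X => (√(lambdaDet G X) : ℂ)) ((2 : ℝ) • X) *
        Complex.exp (-(Complex.I / ħ) * (p ((2 : ℝ) • X) : ℂ)) := by
  have hL := hO.lambdaDet_pos hX
  have he := expDet_pos (G := G) X
  have h1 : expDensity G X * √(jExp G O X * expDet G X ^ 2) =
      O.indicator (fun X => √(lambdaDet G X)) ((2 : ℝ) • X) := by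
    rw [Real.sqrt_mul (jExp_nonneg X), Real.sqrt_sq he.le, expDensity_eq, jExp]
    by_cases h : (2 : ℝ) • X ∈ O
    · rw [indicator_of_mem h, indicator_of_mem h, mul_one, lambdaDet_two_smul,
        Real.sqrt_div (coshDet_nonneg X), Real.sqrt_mul (coshDet_nonneg X)]
      have h2 : lambdaDet G X = √(lambdaDet G X) * √(lambdaDet G X) :=
        (Real.mul_self_sqrt hL.le).symm
      have h3 := (Real.sqrt_pos.2 hL).ne'
      rw [div_mul_eq_mul_div, mul_comm _ (expDet G X), mul_div_assoc,
        mul_div_cancel_left₀ _ he.ne']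
      nth_rewrite 1 [h2]
      field_simp
    · rw [indicator_of_notMem h, indicator_of_notMem h, mul_zero, Real.sqrt_zero, zero_mul,
        mul_zero]
  have h2 : O.indicator (fun X => (√(lambdaDet G X) : ℂ)) ((2 : ℝ) • X) =
      ((O.indicator (fun X => √(lambdaDet G X)) ((2 : ℝ) • X) : ℝ) : ℂ) := by
    by_cases h : (2 : ℝ) • X ∈ O
    · rw [indicator_of_mem h, indicator_of_mem h]
    · rw [indicator_of_notMem h, indicator_of_notMem h, Complex.ofReal_zero]
  rw [h2, ← h1, quantizerWeight, map_smul, smul_eq_mul]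
  push_cast
  rw [show -(2 * Complex.I / (ħ : ℂ)) * (p X : ℂ) = -(Complex.I / (ħ : ℂ)) * (2 * (p X : ℂ)) by
    ring]
  ring

/-- At `a = q exp X` the kernel is evaluated at `q exp (-X)` and `q exp X`, the pair that enters the
formula for `f(q, p)` at `2X`. Rescaling `X` contributes `2⁻ⁿ`, which turns `|πħ|ⁿ` into `|2πħ|ⁿ`.
-/
theorem integral_weight_kernel_diagonal [μ.IsHaarMeasure] (hħ : ħ ≠ 0)
    (hf : HasIntegralKernel ħ O μ f k) (q : G) (p : StrongDual ℝ E) :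
    f (q, p) = ((|2 * Real.pi * ħ| ^ Module.finrank ℝ E : ℝ) : ℂ) *
      ∫ a, quantizerWeight G ħ O p (V O q a) * k (refl q a, a) ∂μ := by
  have : IsTopologicalGroup G := topologicalGroup_of_lieGroup 𝓘(ℝ, E) ∞
  have := hO.isAddHaarMeasure_algMeasure μ
  have hexp := hO.continuous_exp (G := G)
  set n := Module.finrank ℝ E
  set Φ : E → ℂ := fun X => symbolTransform O k q X *
    Complex.exp (-(Complex.I / ħ) * (p X : ℂ)) with hΦ
  have hF : StronglyMeasurable fun X : E => quantizerWeight G ħ O p X *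
      k (q * lieExp G (-X), q * lieExp G X) := by
    refine (hO.measurable_quantizerWeight ħ p).stronglyMeasurable.mul ?_
    exact (hf.1.continuous.comp ((continuous_const.mul (hexp.comp continuous_neg)).prodMk
      (continuous_const.mul hexp))).stronglyMeasurable
  have h1 : ∫ a, quantizerWeight G ħ O p (V O q a) * k (refl q a, a) ∂μ =
      ∫ X in O, (expDensity G X : ℂ) * (quantizerWeight G ħ O p X *
      k (q * lieExp G (-X), q * lieExp G X)) ∂algMeasure E μ := by
    rw [← hO.integral_comp_V q hF]
    refine integral_congr_ae ?_
    filter_upwards [hO.ae_inv_mul_mem_image q] with a ha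
    rw [← hO.refl_eq ha, hO.lieExp_V ha]
  have h2 : ∫ X in O, (expDensity G X : ℂ) * (quantizerWeight G ħ O p X *
      k (q * lieExp G (-X), q * lieExp G X)) ∂algMeasure E μ =
      ((1 / |Real.pi * ħ| ^ n : ℝ) : ℂ) * ∫ X, Φ ((2 : ℝ) • X) ∂algMeasure E μ := by
    rw [← integral_const_mul, ← integral_indicator hO.isOpen.measurableSet]
    congr 1
    funext X
    by_cases hX : X ∈ O
    · rw [indicator_of_mem hX, ← mul_assoc, hO.expDensity_mul_quantizerWeight p hX, hΦ]
      simp only [symbolTransform]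
      by_cases h : (2 : ℝ) • X ∈ O
      · rw [indicator_of_mem h, indicator_of_mem h, smul_smul,
          show (1 / 2 : ℝ) * 2 = 1 by norm_num, one_smul]
        ring
      · rw [indicator_of_notMem h, indicator_of_notMem h]
        ring
    -- Since `O` is star-shaped, `2X ∈ O` forces `X ∈ O`; restricting the integral to `X ∈ O`
    -- therefore loses nothing.
    · have h : (2 : ℝ) • X ∉ O := fun h => hX (by
        have := hO.half_mem h
        rwa [smul_smul, show (1 / 2 : ℝ) * 2 = 1 by norm_num, one_smul] at this)
      simp [hΦ, symbolTransform, hX, h]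
  rw [h1, h2, Measure.integral_comp_smul, hO.symbol_eq_integral hf]
  have hc : |2 * Real.pi * ħ| ^ n * (1 / |Real.pi * ħ| ^ n * |((2 : ℝ) ^ n)⁻¹|) = 1 := by
    have : |Real.pi * ħ| ≠ 0 := abs_ne_zero.2 (mul_ne_zero Real.pi_ne_zero hħ)
    rw [mul_assoc, abs_mul 2, mul_pow, abs_inv, abs_pow]
    have h2 : |(2 : ℝ)| ≠ 0 := by norm_num
    field_simp
  rw [Complex.real_smul, ← mul_assoc, ← mul_assoc, ← Complex.ofReal_mul, ← Complex.ofReal_mul,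
    mul_assoc (|2 * Real.pi * ħ| ^ n), hc, Complex.ofReal_one, one_mul]

/-- The weighted-composition identity moves the reflection off `α i` and leaves the weight `j_q`
times a constant, which is integrable over the compact set carrying the expansion. -/
theorem lintegral_tsum_weight_lt_top [μ.IsHaarMeasure] (p : StrongDual ℝ E) (q : G)
    {α : ℕ → G → ℂ} {A : ℝ≥0∞} {S : Set G} (hA : A ≠ ⊤) (hS : IsCompact S)
    (hα : ∀ i, Measurable (α i))
    (hαS : ∀ a, ∑' i, ‖α i a‖ₑ ^ 2 ≤ S.indicator (fun _ => A) a) :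
    ∫⁻ a, ∑' i, ‖quantizerWeight G ħ O p (V O q a) * α i (refl q a)‖ₑ ^ 2 ∂μ ≠ ⊤ := by
  have : IsTopologicalGroup G := topologicalGroup_of_lieGroup 𝓘(ℝ, E) ∞
  have hs : Measurable (refl q : G → G) := by unfold refl; fun_prop
  have hρ : Measurable fun b : G => expDet G (V O q b) ^ 2 :=
    ((continuous_expDet (G := G)).measurable.comp (hO.measurable_V q)).pow_const 2
  have hm : Measurable fun b : G => quantizerWeight G ħ O p (V O q b) :=
    (hO.measurable_quantizerWeight ħ p).comp (hO.measurable_V q)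
  have hmρ : ∀ᵐ b ∂μ, quantizerWeight G ħ O p (V O q (refl q b)) * (expDet G (V O q b) ^ 2 : ℝ) =
      Star.star (quantizerWeight G ħ O p (V O q b)) := by
    filter_upwards [hO.ae_inv_mul_mem_image q] with b hb
    rw [hO.V_refl hb, hO.quantizerWeight_neg]
  set c : ℝ := (1 / |Real.pi * ħ| ^ Module.finrank ℝ E) ^ 2
  have hw : ∀ᵐ b ∂μ, ENNReal.ofReal (‖quantizerWeight G ħ O p (V O q b)‖ *
      ‖quantizerWeight G ħ O p (V O q (refl q b))‖) =
      ENNReal.ofReal c * ENNReal.ofReal (jExp G O (V O q b)) := by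
    filter_upwards [hO.ae_inv_mul_mem_image q] with b hb
    rw [hO.V_refl hb, hO.norm_quantizerWeight_mul, ENNReal.ofReal_mul (sq_nonneg _)]
  have hj : Measurable fun b => ENNReal.ofReal (jExp G O (V O q b)) :=
    ((hO.measurable_jExp (G := G)).comp (hO.measurable_V q)).ennreal_ofReal
  have h1 : ∀ i, Measurable fun a => ‖quantizerWeight G ħ O p (V O q a) * α i (refl q a)‖ₑ ^ 2 :=
    fun i => (hm.mul ((hα i).comp hs)).enorm.pow_const 2
  have h2 : ∀ i, Measurable fun b => ENNReal.ofReal (‖quantizerWeight G ħ O p (V O q b)‖ *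
      ‖quantizerWeight G ħ O p (V O q (refl q b))‖) * ‖α i b‖ₑ ^ 2 := fun i =>
    (hm.norm.mul (hm.comp hs).norm).ennreal_ofReal.mul ((hα i).enorm.pow_const 2)
  rw [lintegral_tsum fun i => (h1 i).aemeasurable]
  simp only [lintegral_enorm_sq_mul_comp hs hρ (refl_refl q) (hO.map_refl_withDensity (μ := μ) q)
    (fun b => sq_nonneg _) hm hmρ (hα _).aestronglyMeasurable]
  rw [← lintegral_tsum fun i => (h2 i).aemeasurable]
  simp only [ENNReal.tsum_mul_left]
  refine ne_top_of_le_ne_top (ENNReal.mul_ne_top (ENNReal.mul_ne_top (ENNReal.ofReal_ne_top (r := c)) hA)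
    (hO.setLIntegral_jExp_lt_top (μ := μ) q hS).ne) ?_
  rw [← lintegral_const_mul _ hj, ← lintegral_indicator hS.measurableSet]
  refine lintegral_mono_ae ?_
  filter_upwards [hw] with b hb
  rw [hb]
  refine (mul_le_mul_right (hαS b) _).trans ?_
  by_cases h : b ∈ S
  · rw [indicator_of_mem h, indicator_of_mem h]
    exact le_of_eq (by ring)
  · simp [h]

theorem exists_operator_of_symbol [μ.IsHaarMeasure] (hħ : ħ ≠ 0)
    (hf : HasIntegralKernel ħ O μ f k) :
    ∃ fhat : Lp ℂ 2 μ →L[ℂ] Lp ℂ 2 μ,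
      (∀ ψ : Lp ℂ 2 μ, fhat ψ =ᵐ[μ] kernelApply μ k ψ) ∧
      ∀ x : G × StrongDual ℝ E, ∃ (T : Lp ℂ 2 μ →L[ℂ] Lp ℂ 2 μ) (t : ℂ),
        (∀ ψ : Lp ℂ 2 μ, ∃ h : fhat ψ ∈ (quantizer ħ O μ x).domain,
          T ψ = quantizer ħ O μ x ⟨fhat ψ, h⟩) ∧
        HasTrace T t ∧ f x = ((|2 * Real.pi * ħ| ^ Module.finrank ℝ E : ℝ) : ℂ) * t := by
  have : IsTopologicalGroup G := topologicalGroup_of_lieGroup 𝓘(ℝ, E) ∞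
  obtain ⟨α, β, A, S, hA, hS, hα, hβ, hαS, hβS, hk⟩ := hO.exists_kernel_expansion (μ := μ) hf.1 hf.2.1
  have hfin : ∀ γ : ℕ → G → ℂ, (∀ a, ∑' i, ‖γ i a‖ₑ ^ 2 ≤ S.indicator (fun _ => A) a) →
      ∫⁻ a, ∑' i, ‖γ i a‖ₑ ^ 2 ∂μ ≠ ⊤ := fun γ hγ => by
    refine ne_top_of_le_ne_top (ENNReal.mul_ne_top hA (hS.measure_lt_top (μ := μ)).ne) ?_
    rw [← lintegral_indicator_const hS.measurableSet]
    exact lintegral_mono hγ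
  have hpt : ∀ a, ∑' i, ‖α i a‖ₑ ^ 2 ≠ ⊤ := fun a =>
    ne_top_of_le_ne_top hA ((hαS a).trans (indicator_le_self _ _ a))
  have hβm : ∀ i, AEStronglyMeasurable (β i) μ := fun i => (hβ i).aestronglyMeasurable
  have hsum : ∀ (ψ : Lp ℂ 2 μ), ∀ a ∈ lieExp G '' O,
      HasSum (fun i => α i a * ∫ b, β i b * ψ b ∂μ) (kernelApply μ k ψ a) := fun ψ a ha =>
    hasSum_mul_integral hβm (hfin β hβS) (Lp.memLp ψ) (hpt a)
      (hO.ae_mem_image.mono fun b hb => hk a ha b hb)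
  obtain ⟨fhat, -, hfhat⟩ := exists_hasTrace_of_expansion
    (fun i => (hα i).aestronglyMeasurable (μ := μ)) hβm (hfin α hαS) (hfin β hβS)
    (d := fun a => k (a, a)) (hO.ae_mem_image.mono fun a ha => hk a ha a ha)
  have hfk : ∀ ψ : Lp ℂ 2 μ, fhat ψ =ᵐ[μ] kernelApply μ k ψ := fun ψ =>
    hfhat ψ _ (hO.ae_mem_image.mono fun a ha => hsum ψ a ha)
  refine ⟨fhat, hfk, fun ⟨q, p⟩ => ?_⟩
  have hs : Measurable (refl q : G → G) := by unfold refl; fun_prop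
  have hq := refl_quasiMeasurePreserving E μ q
  have hm : Measurable fun b : G => quantizerWeight G ħ O p (V O q b) :=
    (hO.measurable_quantizerWeight ħ p).comp (hO.measurable_V q)
  -- `Δ_x` acts on the first variable of the kernel only, so it transforms each `α i` and leaves `β
  -- i` unchanged.
  obtain ⟨T, hT, hTψ⟩ := exists_hasTrace_of_expansion
    (α := fun i a => quantizerWeight G ħ O p (V O q a) * α i (refl q a))
    (fun i => (hm.mul ((hα i).comp hs)).aestronglyMeasurable (μ := μ)) hβm
    (hO.lintegral_tsum_weight_lt_top p q hA hS hα hαS) (hfin β hβS)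
    (d := fun a => quantizerWeight G ħ O p (V O q a) * k (refl q a, a)) (by
      filter_upwards [hO.ae_mem_image, hq.ae (hO.ae_mem_image (μ := μ))] with a h1 h2
      simpa only [mul_assoc] using (hk _ h2 a h1).mul_left (quantizerWeight G ħ O p (V O q a)))
  have hTq : ∀ ψ : Lp ℂ 2 μ, T ψ =ᵐ[μ] quantizerFun ħ O (q, p) (fhat ψ) := fun ψ => by
    refine hTψ ψ _ ?_
    filter_upwards [hq.ae (hO.ae_mem_image (μ := μ)), hq.ae (hfk ψ),
      hO.quantizerFun_ae_eq ħ (q, p) (fhat ψ)] with a h1 h2 h3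
    rw [h3, h2]
    simpa only [mul_assoc] using (hsum ψ _ h1).mul_left (quantizerWeight G ħ O p (V O q a))
  refine ⟨T, _, fun ψ => ?_, hT, hO.integral_weight_kernel_diagonal hħ hf q p⟩
  have hmem : MemLp (quantizerFun ħ O (q, p) (fhat ψ)) 2 μ := (Lp.memLp (T ψ)).ae_eq (hTq ψ)
  refine ⟨hmem, Lp.ext ((hTq ψ).trans (MemLp.coeFn_toLp hmem).symm)⟩

end IsWeaklyExponential

end OperatorOfSymbol


/-! ### Plancherel for the semiclassical Fourier transform on the dual. -/

section Plancherel

open FourierTransform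

variable {E : Type*} [NormedAddCommGroup E] [InnerProductSpace ℝ E] [FiniteDimensional ℝ E]
  [MeasurableSpace E] [BorelSpace E] {φ χ : E → ℂ}

theorem continuous_fourier_of_integrable (hφ : Integrable φ) : Continuous (𝓕 φ) :=
  VectorFourier.fourierIntegral_continuous Real.continuous_fourierChar
    (innerSL ℝ).continuous₂ hφ

/-- The abstract `L²` transform and the Fourier integral define the same tempered distribution, and
test functions separate locally integrable functions up to null sets. -/
theorem coeFn_fourier_toLp (hφ : Integrable φ) (hφ2 : MemLp φ 2 volume) :
    (𝓕 hφ2.toLp : Lp ℂ 2 (volume : Measure E)) =ᵐ[volume] 𝓕 φ := by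
  refine ae_eq_of_integral_contDiff_smul_eq ((Lp.memLp _).locallyIntegrable (by norm_num))
    (continuous_fourier_of_integrable hφ).locallyIntegrable fun g hg hgc => ?_
  have hgc' : HasCompactSupport fun x => (g x : ℂ) := hgc.comp_left (g := Complex.ofReal) rfl
  let γ : SchwartzMap E ℂ := hgc'.toSchwartzMap (Complex.ofRealCLM.contDiff.comp hg)
  have h1 : ∫ x, g x • (𝓕 hφ2.toLp : Lp ℂ 2 (volume : Measure E)) x =
      ((𝓕 hφ2.toLp : Lp ℂ 2 (volume : Measure E)) : TemperedDistribution E ℂ) γ := by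
    rw [Lp.toTemperedDistribution_apply]
    rfl
  rw [h1, ← Lp.fourier_toTemperedDistribution_eq, TemperedDistribution.fourier_apply,
    Lp.toTemperedDistribution_apply]
  have h2 : ∫ x, (𝓕 γ : SchwartzMap E ℂ) x • (hφ2.toLp : Lp ℂ 2 (volume : Measure E)) x =
      ∫ x, 𝓕 (γ : E → ℂ) x • φ x := by
    refine integral_congr_ae ?_
    filter_upwards [hφ2.coeFn_toLp] with x hx
    rw [hx, SchwartzMap.fourier_coe]
  rw [h2]
  exact VectorFourier.integral_fourierIntegral_smul_eq_flip (L := innerₗ E)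
    Real.continuous_fourierChar continuous_inner γ.integrable hφ |>.trans (by
      refine integral_congr_ae (Eventually.of_forall fun x => ?_)
      simp only [flip_innerₗ]
      rfl)

theorem lintegral_enorm_fourier_sq (hφ : Integrable φ) (hφ2 : MemLp φ 2 volume) :
    ∫⁻ ξ, ‖𝓕 φ ξ‖ₑ ^ 2 = ∫⁻ x, ‖φ x‖ₑ ^ 2 := by
  have h1 : eLpNorm (𝓕 φ) 2 volume = eLpNorm φ 2 volume := by
    rw [← eLpNorm_congr_ae (coeFn_fourier_toLp hφ hφ2), ← Lp.enorm_def,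
      ← eLpNorm_congr_ae hφ2.coeFn_toLp, ← Lp.enorm_def, ← ofReal_norm, Lp.norm_fourier_eq,
      ofReal_norm]
  have h2 : ∀ f : E → ℂ, eLpNorm f 2 volume ^ 2 = ∫⁻ x, ‖f x‖ₑ ^ 2 := fun f => by
    have := eLpNorm_nnreal_pow_eq_lintegral (f := f) (μ := volume) (p := 2) (by norm_num)
    norm_num at this
    exact_mod_cast this
  rw [← h2, ← h2, h1]

theorem integral_star_fourier_mul_fourier (hφ : Integrable φ) (hφ2 : MemLp φ 2 volume)
    (hχ : Integrable χ) (hχ2 : MemLp χ 2 volume) :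
    ∫ ξ, star (𝓕 φ ξ) * 𝓕 χ ξ = ∫ x, star (φ x) * χ x := by
  have h := Lp.inner_fourier_eq (hφ2.toLp : Lp ℂ 2 (volume : Measure E)) hχ2.toLp
  rw [inner_Lp_eq_integral, inner_Lp_eq_integral] at h
  refine Eq.trans (integral_congr_ae ?_) (h.trans (integral_congr_ae ?_))
  · filter_upwards [coeFn_fourier_toLp hφ hφ2, coeFn_fourier_toLp hχ hχ2] with x h1 h2
    rw [h1, h2]
  · filter_upwards [hφ2.coeFn_toLp, hχ2.coeFn_toLp] with x h1 h2
    rw [h1, h2]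

/-- The semiclassical Fourier transform on the dual space. -/
def momentumTransform (ħ : ℝ) (σ : Measure E) (φ : E → ℂ) (p : StrongDual ℝ E) : ℂ :=
  ∫ X, φ X * Complex.exp (-(Complex.I / ħ) * (p X : ℂ)) ∂σ

/-- The linear change of variables relating momenta and frequencies. -/
def frequencyEquiv (E : Type*) [NormedAddCommGroup E] [InnerProductSpace ℝ E]
    [FiniteDimensional ℝ E] {ħ : ℝ} (hħ : ħ ≠ 0) : E ≃L[ℝ] StrongDual ℝ E :=
  (ContinuousLinearEquiv.smulLeft (Units.mk0 (2 * Real.pi * ħ)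
    (mul_ne_zero (mul_ne_zero two_ne_zero Real.pi_ne_zero) hħ))).trans
      (InnerProductSpace.toDual ℝ E).toContinuousLinearEquiv

theorem frequencyEquiv_apply {ħ : ℝ} (hħ : ħ ≠ 0) (ξ X : E) :
    frequencyEquiv E hħ ξ X = 2 * Real.pi * ħ * inner ℝ ξ X := by
  change inner ℝ ((2 * Real.pi * ħ) • ξ) X = _
  rw [inner_smul_left]
  rfl

theorem measurableEmbedding_frequencyEquiv {ħ : ℝ} (hħ : ħ ≠ 0) :
    MeasurableEmbedding (frequencyEquiv E hħ) :=
  (frequencyEquiv E hħ).toHomeomorph.measurableEmbedding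

variable {ħ : ℝ} {h : ℝ≥0∞}

theorem momentumTransform_frequencyEquiv (hħ : ħ ≠ 0) (φ : E → ℂ) (ξ : E) :
    momentumTransform ħ (h • volume) φ (frequencyEquiv E hħ ξ) = h.toReal * 𝓕 φ ξ := by
  rw [momentumTransform, integral_smul_measure, Complex.real_smul, Real.fourier_eq']
  congr 2
  funext X
  have : (ħ : ℂ) ≠ 0 := Complex.ofReal_ne_zero.2 hħ
  rw [frequencyEquiv_apply, smul_eq_mul, mul_comm, real_inner_comm]
  congr 2
  push_cast
  field_simp

/-- The source of the factor `|2πħ|ⁿ`: momenta are frequencies multiplied by `2πħ`. -/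
theorem map_toDual_volume (hħ : ħ ≠ 0) :
    (volume : Measure E).map (InnerProductSpace.toDual ℝ E) =
      ENNReal.ofReal (|2 * Real.pi * ħ| ^ Module.finrank ℝ E) •
        (volume : Measure E).map (frequencyEquiv E hħ) := by
  have hc : 2 * Real.pi * ħ ≠ 0 := mul_ne_zero (mul_ne_zero two_ne_zero Real.pi_ne_zero) hħ
  have h1 : ⇑(frequencyEquiv E hħ) =
      (InnerProductSpace.toDual ℝ E) ∘ fun ξ : E => (2 * Real.pi * ħ) • ξ := rfl
  rw [h1, ← Measure.map_map (InnerProductSpace.toDual ℝ E).continuous.measurable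
    (measurable_const_smul _), Measure.map_addHaar_smul _ hc, Measure.map_smul, smul_smul,
    ← ENNReal.ofReal_mul (by positivity), abs_inv, abs_pow, mul_inv_cancel₀, ENNReal.ofReal_one,
    one_smul]
  exact pow_ne_zero _ (abs_ne_zero.2 hc)

theorem continuous_momentumTransform (hħ : ħ ≠ 0) (hφ : Integrable φ) :
    Continuous (momentumTransform ħ (h • volume) φ) := by
  have h1 : momentumTransform ħ (h • volume) φ =
      (fun ξ => (h.toReal : ℂ) * 𝓕 φ ξ) ∘ (frequencyEquiv E hħ).symm := by
    funext p
    rw [Function.comp_apply, ← momentumTransform_frequencyEquiv hħ,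
      ContinuousLinearEquiv.apply_symm_apply]
  rw [h1]
  exact (continuous_const.mul (continuous_fourier_of_integrable hφ)).comp
    (frequencyEquiv E hħ).symm.continuous

theorem lintegral_enorm_momentumTransform_sq (hħ : ħ ≠ 0) (h0 : h ≠ 0) (ht : h ≠ ⊤)
    (hφ : Integrable φ) (hφ2 : MemLp φ 2 volume) :
    ∫⁻ p, ‖momentumTransform ħ (h • volume) φ p‖ₑ ^ 2
        ∂(h⁻¹ • (volume : Measure E).map (InnerProductSpace.toDual ℝ E)) =
      ENNReal.ofReal (|2 * Real.pi * ħ| ^ Module.finrank ℝ E) *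
        ∫⁻ X, ‖φ X‖ₑ ^ 2 ∂(h • volume) := by
  rw [map_toDual_volume hħ, lintegral_smul_measure, lintegral_smul_measure,
    lintegral_smul_measure, (measurableEmbedding_frequencyEquiv hħ).lintegral_map]
  have h1 : ∀ ξ : E, ‖momentumTransform ħ (h • volume) φ (frequencyEquiv E hħ ξ)‖ₑ ^ 2 =
      h ^ 2 * ‖𝓕 φ ξ‖ₑ ^ 2 := fun ξ => by
    rw [momentumTransform_frequencyEquiv, enorm_mul, mul_pow, ← ofReal_norm (h.toReal : ℂ),
      Complex.norm_real, Real.norm_of_nonneg ENNReal.toReal_nonneg, ENNReal.ofReal_toReal ht]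
  have h2 : ∫⁻ ξ, ‖momentumTransform ħ (h • volume) φ (frequencyEquiv E hħ ξ)‖ₑ ^ 2 =
      h ^ 2 * ∫⁻ x, ‖φ x‖ₑ ^ 2 := by
    simp only [h1]
    rw [lintegral_const_mul' _ _ (ENNReal.pow_ne_top ht), lintegral_enorm_fourier_sq hφ hφ2]
  refine Eq.trans (congrArg (fun t => h⁻¹ • (ENNReal.ofReal
    (|2 * Real.pi * ħ| ^ Module.finrank ℝ E) • t)) h2) ?_
  simp only [smul_eq_mul]
  rw [pow_two, mul_assoc h h, mul_left_comm _ h, ← mul_assoc, ENNReal.inv_mul_cancel h0 ht, one_mul]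

/-- Each transform carries a factor `h` and the dual measure a factor `h⁻¹`; the remaining `h`
belongs to `dX`. -/
theorem integral_star_momentumTransform_mul (hħ : ħ ≠ 0) (h0 : h ≠ 0) (ht : h ≠ ⊤)
    (hφ : Integrable φ) (hφ2 : MemLp φ 2 volume) (hχ : Integrable χ) (hχ2 : MemLp χ 2 volume) :
    ∫ p, star (momentumTransform ħ (h • volume) φ p) * momentumTransform ħ (h • volume) χ p
        ∂(h⁻¹ • (volume : Measure E).map (InnerProductSpace.toDual ℝ E)) =
      ((|2 * Real.pi * ħ| ^ Module.finrank ℝ E : ℝ) : ℂ) *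
        ∫ X, star (φ X) * χ X ∂(h • volume) := by
  rw [map_toDual_volume hħ, integral_smul_measure, integral_smul_measure,
    integral_smul_measure, (measurableEmbedding_frequencyEquiv hħ).integral_map]
  have h1 : ∀ ξ : E, star (momentumTransform ħ (h • volume) φ (frequencyEquiv E hħ ξ)) *
      momentumTransform ħ (h • volume) χ (frequencyEquiv E hħ ξ) =
      (h.toReal ^ 2 : ℝ) * (star (𝓕 φ ξ) * 𝓕 χ ξ) := fun ξ => by
    rw [momentumTransform_frequencyEquiv, momentumTransform_frequencyEquiv, star_mul',
      Complex.star_def, Complex.conj_ofReal]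
    push_cast
    ring
  have h2 : ∫ ξ, star (momentumTransform ħ (h • volume) φ (frequencyEquiv E hħ ξ)) *
      momentumTransform ħ (h • volume) χ (frequencyEquiv E hħ ξ) =
      (h.toReal ^ 2 : ℝ) * ∫ x, star (φ x) * χ x := by
    simp only [h1]
    rw [integral_const_mul, integral_star_fourier_mul_fourier hφ hφ2 hχ hχ2]
  refine Eq.trans (congrArg (fun t => (h⁻¹).toReal • ((ENNReal.ofReal
    (|2 * Real.pi * ħ| ^ Module.finrank ℝ E)).toReal • t)) h2) ?_
  have h3 : h.toReal ≠ 0 := ENNReal.toReal_ne_zero.2 ⟨h0, ht⟩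
  have h3' : (h.toReal : ℂ) ≠ 0 := Complex.ofReal_ne_zero.2 h3
  rw [ENNReal.toReal_ofReal (by positivity), ENNReal.toReal_inv]
  simp only [Complex.real_smul]
  push_cast
  field_simp

end Plancherel


/-! ### Plancherel summed over a product expansion. -/

section SymbolCalculus

variable {E : Type*} [NormedAddCommGroup E] [InnerProductSpace ℝ E] [FiniteDimensional ℝ E]
  [MeasurableSpace E] [BorelSpace E] {ħ : ℝ} {h : ℝ≥0∞}

theorem enorm_integral_mul_le {Ω : Type*} [MeasurableSpace Ω] {μ : Measure Ω} {f g : Ω → ℂ}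
    (hf : AEStronglyMeasurable f μ) (hg : AEStronglyMeasurable g μ) :
    ‖∫ a, f a * g a ∂μ‖ₑ ≤ eLpNorm f 2 μ * eLpNorm g 2 μ := by
  have h2 := eLpNorm_smul_le_mul_eLpNorm (p := 2) (q := 2) (r := 1) hg hf
  rw [smul_eq_mul, eLpNorm_one_eq_lintegral_enorm] at h2
  exact (enorm_integral_le_lintegral_enorm _).trans h2

theorem lintegral_tsum_mul_sq_ne_top {Ω : Type*} [MeasurableSpace Ω] {μ : Measure Ω} {g : Ω → ℂ}
    {α : ℕ → Ω → ℂ} {A : ℝ≥0∞} (hA : A ≠ ⊤) (hg : ∫⁻ a, ‖g a‖ₑ ^ 2 ∂μ ≠ ⊤)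
    (hα : ∀ a, ∑' i, ‖α i a‖ₑ ^ 2 ≤ A) : ∫⁻ a, ∑' i, ‖g a * α i a‖ₑ ^ 2 ∂μ ≠ ⊤ := by
  refine ne_top_of_le_ne_top (ENNReal.mul_ne_top hA hg) ?_
  rw [← lintegral_const_mul' _ _ hA]
  refine lintegral_mono fun a => ?_
  simp only [enorm_mul, mul_pow]
  rw [ENNReal.tsum_mul_left, mul_comm]
  exact mul_le_mul_left (hα a) _

/-- Plancherel preserves the total square mass of a sequence up to a constant. The series of
products is thus integrable on the dual side too, and the two sides can be compared term by term. -/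
theorem integral_star_momentumTransform_expansion (hħ : ħ ≠ 0) (h0 : h ≠ 0) (ht : h ≠ ⊤)
    {φ χ : ℕ → E → ℂ} (hφm : ∀ i, Measurable (φ i)) (hχm : ∀ i, Measurable (χ i))
    (hφ : ∀ i, Integrable (φ i) (h • volume)) (hχ : ∀ i, Integrable (χ i) (h • volume))
    (hφ2 : ∫⁻ X, ∑' i, ‖φ i X‖ₑ ^ 2 ∂(h • volume) ≠ ⊤)
    (hχ2 : ∫⁻ X, ∑' i, ‖χ i X‖ₑ ^ 2 ∂(h • volume) ≠ ⊤) {P : StrongDual ℝ E → ℂ}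
    (hP : ∀ p, HasSum (fun i => star (momentumTransform ħ (h • volume) (φ i) p) *
      momentumTransform ħ (h • volume) (χ i) p) (P p)) {D : E → ℂ}
    (hD : ∀ X, HasSum (fun i => star (φ i X) * χ i X) (D X)) :
    Integrable P (h⁻¹ • (volume : Measure E).map (InnerProductSpace.toDual ℝ E)) ∧
      ∫ p, P p ∂(h⁻¹ • (volume : Measure E).map (InnerProductSpace.toDual ℝ E)) =
        ((|2 * Real.pi * ħ| ^ Module.finrank ℝ E : ℝ) : ℂ) * ∫ X, D X ∂(h • volume) := by
  have key : ∀ φ : ℕ → E → ℂ, (∀ i, Measurable (φ i)) → (∀ i, Integrable (φ i) (h • volume)) →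
      ∫⁻ X, ∑' i, ‖φ i X‖ₑ ^ 2 ∂(h • volume) ≠ ⊤ →
      (∀ i, Integrable (φ i) volume) ∧ (∀ i, MemLp (φ i) 2 volume) ∧
      (∀ i, AEStronglyMeasurable (momentumTransform ħ (h • volume) (φ i))
        (h⁻¹ • (volume : Measure E).map (InnerProductSpace.toDual ℝ E))) ∧
      ∫⁻ p, ∑' i, ‖momentumTransform ħ (h • volume) (φ i) p‖ₑ ^ 2
        ∂(h⁻¹ • (volume : Measure E).map (InnerProductSpace.toDual ℝ E)) ≠ ⊤ := by
    intro φ hm hi h2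
    have a1 : ∀ i, Integrable (φ i) volume := fun i => (integrable_smul_measure h0 ht).1 (hi i)
    have a2 : ∀ i, MemLp (φ i) 2 volume := fun i => by
      have := memLp_of_lintegral_tsum (fun i => (hm i).aestronglyMeasurable) h2 i
      rw [memLp_two_iff_lintegral (hm i).aestronglyMeasurable, lintegral_smul_measure] at this
      rw [memLp_two_iff_lintegral (hm i).aestronglyMeasurable]
      exact ENNReal.lt_top_of_mul_ne_top_right this.ne h0
    have a3 := fun i => (continuous_momentumTransform (h := h) hħ (a1 i)).measurable
    refine ⟨a1, a2, fun i => (a3 i).aestronglyMeasurable, ?_⟩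
    rw [lintegral_tsum fun i => ((a3 i).enorm.pow_const 2).aemeasurable]
    simp only [lintegral_enorm_momentumTransform_sq hħ h0 ht (a1 _) (a2 _)]
    rw [ENNReal.tsum_mul_left, ← lintegral_tsum fun i => ((hm i).enorm.pow_const 2).aemeasurable]
    exact ENNReal.mul_ne_top ENNReal.ofReal_ne_top h2
  obtain ⟨a1, a2, a3, a4⟩ := key φ hφm hφ hφ2
  obtain ⟨b1, b2, b3, b4⟩ := key χ hχm hχ hχ2
  have a3' := fun i => (a3 i).star
  have a4' : ∫⁻ p, ∑' i, ‖star (momentumTransform ħ (h • volume) (φ i) p)‖ₑ ^ 2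
      ∂(h⁻¹ • (volume : Measure E).map (InnerProductSpace.toDual ℝ E)) ≠ ⊤ := by
    simpa only [Complex.star_def, RCLike.enorm_conj] using a4
  have hφ2' : ∫⁻ X, ∑' i, ‖star (φ i X)‖ₑ ^ 2 ∂(h • volume) ≠ ⊤ := by
    simpa only [Complex.star_def, RCLike.enorm_conj] using hφ2
  refine ⟨integrable_of_expansion a3' b3 a4' b4 (Eventually.of_forall hP), ?_⟩
  have s1 := hasSum_integral_of_expansion a3' b3 a4' b4 (Eventually.of_forall hP)
  have s2 := (hasSum_integral_of_expansion (fun i => (hφm i).aestronglyMeasurable.star)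
    (fun i => (hχm i).aestronglyMeasurable) hφ2' hχ2 (Eventually.of_forall hD)).mul_left
    ((|2 * Real.pi * ħ| ^ Module.finrank ℝ E : ℝ) : ℂ)
  refine s1.unique (s2.congr_fun fun i => ?_)
  exact integral_star_momentumTransform_mul hħ h0 ht (a1 i) (a2 i) (b1 i) (b2 i)

theorem memLp_indicator_phase {C : Set E} (hC : IsCompact C) (c : ℂ) (hc : c.re = 0)
    (σ : Measure E) [IsFiniteMeasureOnCompacts σ] (p : StrongDual ℝ E) :
    MemLp (C.indicator fun X => Complex.exp (c * (p X : ℂ))) 2 σ := by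
  refine (memLp_indicator_const 2 hC.measurableSet (1 : ℂ) (Or.inr hC.measure_lt_top.ne)).congr_norm
    ?_ (Eventually.of_forall fun X => ?_)
  · have : Continuous fun X : E => Complex.exp (c * (p X : ℂ)) := by fun_prop
    exact (this.measurable.indicator hC.measurableSet).aestronglyMeasurable
  · by_cases hX : X ∈ C
    · rw [indicator_of_mem hX, indicator_of_mem hX, Complex.norm_exp]
      simp [hc]
    · rw [indicator_of_notMem hX, indicator_of_notMem hX]

/-- A trace formula for products of Fourier integral transforms with a kernel. -/
theorem integral_kernel_momentum (hħ : ħ ≠ 0) (h0 : h ≠ 0) (ht : h ≠ ⊤) {C : Set E}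
    (hC : IsCompact C) {K : E × E → ℂ} (hK : ContDiff ℝ ∞ K) {g η : E → ℂ} (hgm : Measurable g)
    (hηm : Measurable η) (hgC : ∀ X ∉ C, g X = 0) (hηC : ∀ X ∉ C, η X = 0)
    (hg2 : ∫⁻ X, ‖g X‖ₑ ^ 2 ∂(h • volume) ≠ ⊤) (hη2 : ∫⁻ X, ‖η X‖ₑ ^ 2 ∂(h • volume) ≠ ⊤) :
    Integrable (fun p : StrongDual ℝ E => ∫ X, g X *
        momentumTransform ħ (h • volume) (fun Y => η Y * K (X, Y)) p *
        Complex.exp ((Complex.I / ħ) * (p X : ℂ)) ∂(h • volume))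
      (h⁻¹ • (volume : Measure E).map (InnerProductSpace.toDual ℝ E)) ∧
    ∫ p : StrongDual ℝ E, ∫ X, g X *
        momentumTransform ħ (h • volume) (fun Y => η Y * K (X, Y)) p *
        Complex.exp ((Complex.I / ħ) * (p X : ℂ)) ∂(h • volume)
      ∂(h⁻¹ • (volume : Measure E).map (InnerProductSpace.toDual ℝ E)) =
      ((|2 * Real.pi * ħ| ^ Module.finrank ℝ E : ℝ) : ℂ) *
        ∫ X, g X * η X * K (X, X) ∂(h • volume) := by
  obtain ⟨α, β, A, hA, hα, hβ, hα2, hβ2, hsum⟩ := exists_local_expansion hK hC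
  have : (h • volume : Measure E).IsAddHaarMeasure := Measure.IsAddHaarMeasure.smul _ h0 ht
  have hP1 := memLp_indicator_phase hC (Complex.I / ħ) (by simp) (h • volume)
  have hP2 := memLp_indicator_phase hC (-(Complex.I / ħ)) (by simp) (h • volume)
  have hga : ∀ i, Measurable fun X => g X * α i X := fun i => hgm.mul (hα i).measurable
  have hηb : ∀ i, Measurable fun X => η X * β i X := fun i => hηm.mul (hβ i).measurable
  have hgs : ∀ i, Measurable fun X => star (g X * α i X) := fun i =>
    Complex.continuous_conj.measurable.comp (hga i)
  have hga2 := lintegral_tsum_mul_sq_ne_top hA hg2 hα2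
  have hηb2 := lintegral_tsum_mul_sq_ne_top hA hη2 hβ2
  have hL : ∀ (φ : ℕ → E → ℂ), (∀ i, Measurable (φ i)) →
      ∫⁻ X, ∑' i, ‖φ i X‖ₑ ^ 2 ∂(h • volume) ≠ ⊤ → (∀ i, ∀ X ∉ C, φ i X = 0) →
      ∀ i, Integrable (φ i) (h • volume) := by
    intro φ hm h2 hz i
    refine ((memLp_of_lintegral_tsum (fun i => (hm i).aestronglyMeasurable) h2 i).integrable_mul
      (memLp_indicator_const 2 hC.measurableSet (1 : ℂ) (Or.inr hC.measure_lt_top.ne))).congr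
      (Eventually.of_forall fun X => ?_)
    by_cases hX : X ∈ C
    · simp [hX]
    · simp [hX, hz i X hX]
  have hφ2 : ∫⁻ X, ∑' i, ‖star (g X * α i X)‖ₑ ^ 2 ∂(h • volume) ≠ ⊤ := by
    simpa only [Complex.star_def, RCLike.enorm_conj] using hga2
  -- Conjugating both the function and its transform reverses the phase, which produces the factor
  -- `e^{i⟨p,X⟩/ħ}`. Truncating the phase to `C` makes it square integrable.
  have hstar : ∀ i p, star (momentumTransform ħ (h • volume) (fun X => star (g X * α i X)) p) =
      ∫ X, g X * α i X * C.indicator (fun X => Complex.exp ((Complex.I / ħ) * (p X : ℂ))) X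
        ∂(h • volume) := fun i p => by
    rw [momentumTransform, Complex.star_def, ← integral_conj]
    refine integral_congr_ae (Eventually.of_forall fun X => ?_)
    by_cases hX : X ∈ C
    · beta_reduce
      rw [indicator_of_mem hX, map_mul, ← Complex.star_def, star_star, Complex.star_def,
        ← Complex.exp_conj]
      simp [neg_div]
    · simp [hX, hgC X hX]
  have hmom : ∀ i p, momentumTransform ħ (h • volume) (fun Y => η Y * β i Y) p =
      ∫ Y, η Y * β i Y * C.indicator (fun Y => Complex.exp (-(Complex.I / ħ) * (p Y : ℂ))) Y
        ∂(h • volume) := fun i p => by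
    rw [momentumTransform]
    refine integral_congr_ae (Eventually.of_forall fun X => ?_)
    by_cases hX : X ∈ C
    · simp [hX]
    · simp [hX, hηC X hX]
  have hN : ∀ X ∈ C, ∀ p, HasSum (fun i => α i X *
      momentumTransform ħ (h • volume) (fun Y => η Y * β i Y) p)
      (momentumTransform ħ (h • volume) (fun Y => η Y * K (X, Y)) p) := by
    intro X hX p
    have h1 := hasSum_mul_integral (fun i => (hηb i).aestronglyMeasurable) hηb2 (hP2 p)
      (ne_top_of_le_ne_top hA (hα2 X)) (k := fun Y => η Y * K (X, Y))
      (Eventually.of_forall fun Y => by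
        by_cases hY : Y ∈ C
        · refine ((hsum X hX Y hY).mul_left (η Y)).congr_fun fun i => ?_
          ring
        · simp [hηC Y hY])
    simp only [hmom]
    convert h1 using 1
    rw [momentumTransform]
    refine integral_congr_ae (Eventually.of_forall fun Y => ?_)
    by_cases hY : Y ∈ C
    · simp [hY]
    · simp [hY, hηC Y hY]
  refine integral_star_momentumTransform_expansion hħ h0 ht
    (φ := fun i X => star (g X * α i X)) (χ := fun i Y => η Y * β i Y)
    hgs hηb
    (hL _ hgs hφ2 fun i X hX => by simp [hgC X hX])
    (hL _ hηb hηb2 fun i X hX => by simp [hηC X hX]) hφ2 hηb2 (fun p => ?_) (fun X => ?_)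
  -- By Cauchy–Schwarz each transform at `p` is at most the norm of `η β i` times that of the phase
  -- on `C`; the squares of the former are summable.
  · have hfin : ∑' i, ‖momentumTransform ħ (h • volume) (fun Y => η Y * β i Y) p‖ₑ ^ 2 ≠ ⊤ := by
      refine ne_top_of_le_ne_top (ENNReal.mul_ne_top hηb2
        (ENNReal.pow_ne_top (n := 2) (hP2 p).2.ne)) ?_
      rw [← tsum_eLpNorm_sq fun i => (hηb i).aestronglyMeasurable, ← ENNReal.tsum_mul_right]
      refine ENNReal.tsum_le_tsum fun i => ?_
      rw [← mul_pow, hmom]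
      exact pow_le_pow_left₀ (zero_le) (enorm_integral_mul_le (hηb i).aestronglyMeasurable (hP2 p).1) 2
    have h1 := hasSum_mul_integral (fun i => (hga i).aestronglyMeasurable) hga2 (hP1 p) hfin
      (k := fun X => g X * momentumTransform ħ (h • volume) (fun Y => η Y * K (X, Y)) p)
      (Eventually.of_forall fun X => by
        by_cases hX : X ∈ C
        · refine ((hN X hX p).mul_left (g X)).congr_fun fun i => ?_
          ring
        · simp [hgC X hX])
    have h2 : ∫ X, g X * momentumTransform ħ (h • volume) (fun Y => η Y * K (X, Y)) p *
        Complex.exp ((Complex.I / ħ) * (p X : ℂ)) ∂(h • volume) =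
        ∫ X, g X * momentumTransform ħ (h • volume) (fun Y => η Y * K (X, Y)) p *
          C.indicator (fun X => Complex.exp ((Complex.I / ħ) * (p X : ℂ))) X ∂(h • volume) := by
      refine integral_congr_ae (Eventually.of_forall fun X => ?_)
      by_cases hX : X ∈ C
      · simp [hX]
      · simp [hX, hgC X hX]
    rw [h2]
    refine h1.congr_fun fun i => ?_
    rw [hstar, mul_comm]
  · by_cases hX : X ∈ C
    · refine ((hsum X hX X hX).mul_left (g X * η X)).congr_fun fun i => ?_
      rw [star_star]
      ring
    · simp [hgC X hX]

end SymbolCalculus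


/-! ### Exponential coordinates centred at the evaluation point `a`. -/

section ExponentialCoordinates

variable {E : Type*} [NormedAddCommGroup E] [InnerProductSpace ℝ E] [FiniteDimensional ℝ E]
  [MeasurableSpace E] [BorelSpace E]
  {G : Type*} [TopologicalSpace G] [T2Space G] [SecondCountableTopology G] [ChartedSpace E G]
  [Group G] [LieGroup 𝓘(ℝ, E) ∞ G] [MeasurableSpace G] [BorelSpace G] {O : Set E}
  {μ : Measure G} {k : G × G → ℂ} {f : G × StrongDual ℝ E → ℂ} {ħ : ℝ}

namespace IsWeaklyExponential

variable (hO : IsWeaklyExponential G O)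

include hO

theorem lieExp_two_smul (w : E) : lieExp G ((2 : ℝ) • w) = lieExp G w * lieExp G w := by
  have := lieExp_add_smul (G := G) w 1 1
  rw [one_smul] at this
  rw [← this]
  norm_num

/-- The roles are exchanged: `a` is fixed and `q = a exp w` varies. Then `V_q(a) = -w` and `s_q(a) =
a exp (2w)`. -/
theorem quantizerFun_eq_of_coord (ħ : ℝ) (p : StrongDual ℝ E) (ψ : G → ℂ) {q a : G}
    (hq : a⁻¹ * q ∈ lieExp G '' O) :
    quantizerFun ħ O (q, p) ψ a = quantizerWeight G ħ O p (-V O a q) *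
      ψ (a * lieExp G ((2 : ℝ) • V O a q)) := by
  have h1 : q⁻¹ * a = (a⁻¹ * q)⁻¹ := by rw [mul_inv_rev, inv_inv]
  have h2 : V O q a = -V O a q := by rw [V, h1, hO.log_inv hq, V]
  have h3 : refl q a = a * lieExp G ((2 : ℝ) • V O a q) := by
    rw [hO.lieExp_two_smul, ← mul_assoc, hO.lieExp_V hq, V, lieExp_lieLog hq, refl, mul_assoc]
  rw [hO.quantizerFun_eq ħ (q, p) ψ (by rw [h1]; exact hO.inv_mem_image hq)]
  simp only [h2, h3]

theorem quantizerWeight_eq_zero (ħ : ℝ) (p : StrongDual ℝ E) {w : E} (hw : (2 : ℝ) • w ∉ O) :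
    quantizerWeight G ħ O p (-w) = 0 := by
  rw [quantizerWeight, hO.jExp_neg, jExp, indicator_of_notMem hw]
  simp

/-- At a fixed point `a`, changing `ψ` on a null set affects only a null set of `q`. Indeed `w ↦ a
exp (2w)` pulls null sets back to null sets where `2w ∈ O`, and elsewhere the weight vanishes. -/
theorem ae_quantizerFun_congr [μ.IsHaarMeasure] (ħ : ℝ) (a : G) {ψ χ : G → ℂ} (h : ψ =ᵐ[μ] χ) :
    ∀ᵐ q ∂μ, ∀ p, quantizerFun ħ O (q, p) ψ a = quantizerFun ħ O (q, p) χ a := by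
  have := hO.isAddHaarMeasure_algMeasure μ
  have h1 : ∀ᵐ X ∂haarExp μ O, ψ (a * lieExp G X) = χ (a * lieExp G X) :=
    (hO.measurePreserving_mul_exp (μ := μ) a).quasiMeasurePreserving.ae
      (p := fun g => ψ g = χ g) h
  rw [haarExp_eq, ae_withDensity_iff measurable_ofReal_expDensity,
    ae_restrict_iff' hO.isOpen.measurableSet] at h1
  have h2 : ∀ᵐ w ∂algMeasure E μ, (2 : ℝ) • w ∈ O →
      ENNReal.ofReal (expDensity G ((2 : ℝ) • w)) ≠ 0 →
      ψ (a * lieExp G ((2 : ℝ) • w)) = χ (a * lieExp G ((2 : ℝ) • w)) :=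
    (Measure.quasiMeasurePreserving_smul (algMeasure E μ) (two_ne_zero' ℝ)).ae h1
  have h3 : ∀ᵐ w ∂haarExp μ O, (2 : ℝ) • w ∈ O →
      ψ (a * lieExp G ((2 : ℝ) • w)) = χ (a * lieExp G ((2 : ℝ) • w)) := by
    rw [haarExp_eq]
    refine (withDensity_absolutelyContinuous _ _).ae_le (ae_restrict_of_ae ?_)
    filter_upwards [h2] with w hw hwO
    have h0 : 0 < expDensity G ((2 : ℝ) • w) := hO.expDensity_pos hwO
    exact hw hwO (ENNReal.ofReal_pos.2 h0).ne'
  filter_upwards [(hO.measurePreserving_V a).quasiMeasurePreserving.ae h3,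
    hO.ae_inv_mul_mem_image a] with q h4 h5 p
  rw [hO.quantizerFun_eq_of_coord ħ p ψ h5, hO.quantizerFun_eq_of_coord ħ p χ h5]
  by_cases h : (2 : ℝ) • V O a q ∈ O
  · rw [h4 h]
  · rw [hO.quantizerWeight_eq_zero ħ p h, zero_mul, zero_mul]

theorem measurable_symbolTransform (hk : Continuous k) :
    Measurable fun z : G × E => symbolTransform O k z.1 z.2 := by
  have : IsTopologicalGroup G := topologicalGroup_of_lieGroup 𝓘(ℝ, E) ∞
  have hexp := hO.continuous_exp (G := G)
  have hc : Continuous fun z : G × E => (√(lambdaDet G z.2) : ℂ) *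
      k (z.1 * lieExp G (-((1 / 2 : ℝ) • z.2)), z.1 * lieExp G ((1 / 2 : ℝ) • z.2)) := by
    have hL := (continuous_lambdaDet (G := G) (E := E)).sqrt
    exact (Complex.continuous_ofReal.comp (hL.comp continuous_snd)).mul
      (hk.comp (by fun_prop))
  exact hc.measurable.indicator (measurable_snd hO.isOpen.measurableSet)

/-- If both arguments of `k` lie in the compact set `S`, then `exp Y ∈ S⁻¹ S`, which confines `Y ∈
O` to a compact set independent of `q`. -/
theorem exists_compact_symbolTransform (hc : HasCompactSupport k) :
    ∃ C : Set E, IsCompact C ∧ ∀ q Y, symbolTransform O k q Y ≠ 0 → Y ∈ C := by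
  have : IsTopologicalGroup G := topologicalGroup_of_lieGroup 𝓘(ℝ, E) ∞
  obtain ⟨S, hS, hkS⟩ := exists_compact_of_hasCompactSupport hc
  have hS2 : IsCompact ((fun z : G × G => z.1⁻¹ * z.2) '' S ×ˢ S) :=
    (hS.prod hS).image (by fun_prop)
  refine ⟨_, hO.isCompact_closure_log hS2, fun q Y hY => ?_⟩
  have hYO : Y ∈ O := by
    by_contra h
    exact hY (indicator_of_notMem h _)
  rw [symbolTransform, indicator_of_mem hYO] at hY
  obtain ⟨h1, h2⟩ := hkS _ _ (right_ne_zero_of_mul hY)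
  refine hO.mem_closure_log hYO ⟨_, mk_mem_prod h1 h2, ?_⟩
  have h3 := lieExp_add_smul (G := G) Y (1 / 2) (1 / 2)
  rw [show (1 / 2 : ℝ) + 1 / 2 = 1 by norm_num, one_smul] at h3
  simp only [lieExp_neg]
  rw [h3, mul_inv_rev, inv_inv, mul_assoc, inv_mul_cancel_left]

theorem stronglyMeasurable_symbol [μ.IsHaarMeasure] (hf : HasIntegralKernel ħ O μ f k) :
    StronglyMeasurable f := by
  have := hO.isAddHaarMeasure_algMeasure μ
  have h1 : f = fun z => ∫ X, symbolTransform O k z.1 X *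
      Complex.exp (-(Complex.I / ħ) * (z.2 X : ℂ)) ∂algMeasure E μ :=
    funext fun z => hO.symbol_eq_integral hf z.1 z.2
  have h2 : Measurable fun z : (G × StrongDual ℝ E) × E => symbolTransform O k z.1.1 z.2 *
      Complex.exp (-(Complex.I / ħ) * (z.1.2 z.2 : ℂ)) := by
    refine Measurable.mul ((hO.measurable_symbolTransform hf.1.continuous).comp
      ((measurable_fst.comp measurable_fst).prodMk measurable_snd)) ?_
    have : Continuous fun z : StrongDual ℝ E × E =>
      Complex.exp (-(Complex.I / ħ) * (z.1 z.2 : ℂ)) := by fun_prop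
    exact this.measurable.comp ((measurable_snd.comp measurable_fst).prodMk measurable_snd)
  rw [h1]
  exact h2.stronglyMeasurable.integral_prod_right'

theorem exists_bound_symbol [μ.IsHaarMeasure] (hf : HasIntegralKernel ħ O μ f k) :
    ∃ M, ∀ z, ‖f z‖ ≤ M := by
  have := hO.isAddHaarMeasure_algMeasure μ
  obtain ⟨C, hC, hsupp⟩ := hO.exists_compact_symbolTransform hf.2.1
  obtain ⟨B, hB⟩ := hf.2.1.exists_bound_of_continuous hf.1.continuous
  have hB0 : 0 ≤ B := (norm_nonneg _).trans (hB 1)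
  have hL : Continuous fun X : E => √(lambdaDet G X) * B :=
    (continuous_lambdaDet (G := G)).sqrt.mul continuous_const
  refine ⟨∫ X in C, √(lambdaDet G X) * B ∂algMeasure E μ, fun z => ?_⟩
  rw [show z = (z.1, z.2) from rfl, hO.symbol_eq_integral hf,
    ← integral_indicator hC.measurableSet]
  refine norm_integral_le_of_norm_le
    ((hL.continuousOn.integrableOn_compact hC).integrable_indicator hC.measurableSet)
    (Eventually.of_forall fun X => ?_)
  have h1 := norm_exp_phase 1 (z.2 X) ħ
  rw [Complex.ofReal_one, one_mul] at h1
  rw [norm_mul, h1, mul_one]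
  by_cases hX : X ∈ C
  · rw [indicator_of_mem hX]
    by_cases hXO : X ∈ O
    · rw [symbolTransform, indicator_of_mem hXO, norm_mul, Complex.norm_real,
        Real.norm_of_nonneg (Real.sqrt_nonneg _)]
      exact mul_le_mul_of_nonneg_left (hB _) (Real.sqrt_nonneg _)
    · rw [symbolTransform, indicator_of_notMem hXO, norm_zero]
      positivity
  · have : symbolTransform O k z.1 X = 0 := by
      by_contra h
      exact hX (hsupp _ _ h)
    rw [this, norm_zero]
    exact indicator_nonneg (fun X _ => by positivity) X

/-- The kernel at the pairs of points with midpoint `a exp(X/2)` and difference `Y` vanishes unless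
`X` and `Y` lie in a compact set. -/
theorem exists_compact_midpoint (hc : HasCompactSupport k) (a : G) :
    ∃ C : Set E, IsCompact C ∧ ∀ X ∈ O, ∀ Y ∈ O,
      k (a * lieExp G ((1 / 2 : ℝ) • X) * lieExp G (-((1 / 2 : ℝ) • Y)),
        a * lieExp G ((1 / 2 : ℝ) • X) * lieExp G ((1 / 2 : ℝ) • Y)) ≠ 0 → X ∈ C ∧ Y ∈ C := by
  have : IsTopologicalGroup G := topologicalGroup_of_lieGroup 𝓘(ℝ, E) ∞
  have hexp := hO.continuous_exp (G := G)
  obtain ⟨C₁, hC₁, hsupp⟩ := hO.exists_compact_symbolTransform hc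
  obtain ⟨S, hS, hkS⟩ := exists_compact_of_hasCompactSupport hc
  have hS2 : IsCompact ((fun z : G × E => a⁻¹ * z.1 * lieExp G ((1 / 2 : ℝ) • z.2)) '' S ×ˢ C₁) :=
    (hS.prod hC₁).image (by fun_prop)
  set C₂ := closure (lieLog O '' ((fun z : G × E => a⁻¹ * z.1 * lieExp G ((1 / 2 : ℝ) • z.2)) ''
    S ×ˢ C₁ ∩ lieExp G '' O))
  have hC₂ : IsCompact C₂ := hO.isCompact_closure_log hS2
  -- With `Y` confined to `C₁`, the midpoint satisfies `exp (X/2) ∈ a⁻¹ S exp (Y/2)`. Its logarithm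
  -- `X/2` lies in `C₂`, hence the doubling.
  refine ⟨C₁ ∪ (fun X => (2 : ℝ) • X) '' C₂, hC₁.union (hC₂.image (continuous_const_smul _)),
    fun X hX Y hY hk => ?_⟩
  have hY1 : Y ∈ C₁ := by
    refine hsupp (a * lieExp G ((1 / 2 : ℝ) • X)) Y ?_
    rw [symbolTransform, indicator_of_mem hY]
    exact mul_ne_zero
      (Complex.ofReal_ne_zero.2 (Real.sqrt_pos.2 (hO.lambdaDet_pos hY)).ne') hk
  refine ⟨Or.inr ⟨(1 / 2 : ℝ) • X, ?_, ?_⟩, Or.inl hY1⟩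
  · refine hO.mem_closure_log (hO.half_mem hX) ⟨(_, Y), mk_mem_prod (hkS _ _ hk).1 hY1, ?_⟩
    simp only [lieExp_neg]
    group
  · simp only [smul_smul]
    norm_num

end IsWeaklyExponential

end ExponentialCoordinates


/-! ### The integrand of the improper integral in the variables `X = 2w` and `Y`. -/

section ImproperIntegral

variable {E : Type*} [NormedAddCommGroup E] [InnerProductSpace ℝ E] [FiniteDimensional ℝ E]
  [MeasurableSpace E] [BorelSpace E]
  {G : Type*} [TopologicalSpace G] [T2Space G] [SecondCountableTopology G] [ChartedSpace E G]
  [Group G] [LieGroup 𝓘(ℝ, E) ∞ G] [MeasurableSpace G] [BorelSpace G] {O : Set E}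
  {μ : Measure G} {k : G × G → ℂ} {f : G × StrongDual ℝ E → ℂ} {ħ : ℝ}

/-- The kernel at the points with midpoint `a exp(X/2)` and difference `Y`. -/
def midpointKernel (k : G × G → ℂ) (a : G) (z : E × E) : ℂ :=
  k (a * lieExp G ((1 / 2 : ℝ) • z.1) * lieExp G (-((1 / 2 : ℝ) • z.2)),
    a * lieExp G ((1 / 2 : ℝ) • z.1) * lieExp G ((1 / 2 : ℝ) • z.2))

/-- The weight of `dX` in the amplitude of `Δ_x ψ`. -/
def amplitude (S : Set E) (ψ : G → ℂ) (a : G) (X : E) : ℂ :=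
  S.indicator (fun X => ((√(lambdaDet G X) / expDet G X : ℝ) : ℂ) * ψ (a * lieExp G X)) X

/-- The truncated square root of `|det λ(ad X)|`. -/
def sqrtLambdaDet (G : Type*) [TopologicalSpace G] [ChartedSpace E G]
    [Group G] [LieGroup 𝓘(ℝ, E) ∞ G] (S : Set E) (X : E) : ℂ :=
  S.indicator (fun X => (√(lambdaDet G X) : ℂ)) X

namespace IsWeaklyExponential

variable (hO : IsWeaklyExponential G O)

include hO

theorem contDiff_midpointKernel (hk : ContMDiff (𝓘(ℝ, E).prod 𝓘(ℝ, E)) 𝓘(ℝ, ℂ) ∞ k) (a : G) :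
    ContDiff ℝ ∞ (midpointKernel k a : E × E → ℂ) := by
  have h1 : ContDiff ℝ ∞ fun z : E × E => (1 / 2 : ℝ) • z.1 := by fun_prop
  have h2 : ContDiff ℝ ∞ fun z : E × E => (1 / 2 : ℝ) • z.2 := by fun_prop
  have h3 : ContDiff ℝ ∞ fun z : E × E => -((1 / 2 : ℝ) • z.2) := by fun_prop
  have h0 := hO.contMDiff_translate_exp a h1
  exact contDiff_kernel_comp hk (h0.mul (hO.contMDiff_exp.comp h3.contMDiff))
    (h0.mul (hO.contMDiff_exp.comp h2.contMDiff))

theorem midpointKernel_diag (k : G × G → ℂ) (a : G) (X : E) :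
    midpointKernel k a (X, X) = k (a, a * lieExp G X) := by
  have h := lieExp_add_smul (G := G) X (1 / 2) (1 / 2)
  rw [show (1 / 2 : ℝ) + 1 / 2 = 1 by norm_num, one_smul] at h
  rw [midpointKernel, h, lieExp_neg]
  simp only [mul_assoc, mul_inv_cancel, mul_one]

/-- The cutoff `O ∩ C` does not depend on `X`, so the transform of the symbol factors into a weight
in `Y` alone and a kernel smooth in both variables. -/
theorem symbolTransform_midpoint {C : Set E} {a : G} (hC : ∀ X ∈ O, ∀ Y ∈ O,
    midpointKernel k a (X, Y) ≠ 0 → X ∈ C ∧ Y ∈ C) {X : E} (hX : X ∈ O) :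
    symbolTransform O k (a * lieExp G ((1 / 2 : ℝ) • X)) =
      fun Y => sqrtLambdaDet G (O ∩ C) Y * midpointKernel k a (X, Y) := by
  funext Y
  by_cases hY : Y ∈ O
  · rw [symbolTransform, indicator_of_mem hY]
    change _ * midpointKernel k a (X, Y) = _
    by_cases hYC : Y ∈ C
    · rw [sqrtLambdaDet, indicator_of_mem (show Y ∈ O ∩ C from ⟨hY, hYC⟩)]
    · have : midpointKernel k a (X, Y) = 0 := by
        by_contra h
        exact hYC (hC X hX Y hY h).2
      rw [this, mul_zero, mul_zero]
  · rw [symbolTransform, sqrtLambdaDet, indicator_of_notMem hY,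
      indicator_of_notMem fun h => hY h.1, zero_mul]

theorem measurable_amplitude {C : Set E} (hC : MeasurableSet C) {ψ : G → ℂ} (hψ : Measurable ψ)
    (a : G) : Measurable (amplitude (O ∩ C) ψ a) := by
  have : IsTopologicalGroup G := topologicalGroup_of_lieGroup 𝓘(ℝ, E) ∞
  have h1 : Measurable fun X : E => √(lambdaDet G X) / expDet G X :=
    continuous_lambdaDet.measurable.sqrt.div continuous_expDet.measurable
  exact ((Complex.measurable_ofReal.comp h1).mul
    (hψ.comp (hO.continuous_exp.measurable.const_mul a))).indicator
      (hO.isOpen.measurableSet.inter hC)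

theorem measurable_sqrtLambdaDet {C : Set E} (hC : MeasurableSet C) :
    Measurable (sqrtLambdaDet G (O ∩ C)) :=
  (Complex.measurable_ofReal.comp continuous_lambdaDet.measurable.sqrt).indicator
    (hO.isOpen.measurableSet.inter hC)

theorem lintegral_sqrtLambdaDet_sq [μ.IsHaarMeasure] {C : Set E} (hC : IsCompact C) :
    ∫⁻ X, ‖sqrtLambdaDet G (O ∩ C) X‖ₑ ^ 2 ∂algMeasure E μ ≠ ⊤ := by
  have := hO.isAddHaarMeasure_algMeasure μ
  have h1 := (continuous_lambdaDet (G := G) (E := E)).continuousOn.integrableOn_compact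
    (μ := algMeasure E μ) hC
  refine ne_top_of_le_ne_top h1.setLIntegral_lt_top.ne ?_
  rw [← lintegral_indicator hC.measurableSet]
  refine lintegral_mono fun X => ?_
  by_cases hX : X ∈ O ∩ C
  · rw [sqrtLambdaDet, indicator_of_mem hX, indicator_of_mem hX.2, ← ofReal_norm,
      Complex.norm_real, Real.norm_of_nonneg (Real.sqrt_nonneg _),
      ← ENNReal.ofReal_pow (Real.sqrt_nonneg _), Real.sq_sqrt (lambdaDet_nonneg X)]
  · rw [sqrtLambdaDet, indicator_of_notMem hX]
    simp

/-- The square of the amplitude is `|ψ|²` times the Haar density `λ/e` times a further `1/e`, which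
is bounded on `C`. -/
theorem lintegral_amplitude_sq [μ.IsHaarMeasure] {C : Set E} (hC : IsCompact C) {ψ : G → ℂ}
    (hψm : Measurable ψ) (hψ : MemLp ψ 2 μ) (a : G) :
    ∫⁻ X, ‖amplitude (O ∩ C) ψ a X‖ₑ ^ 2 ∂algMeasure E μ ≠ ⊤ := by
  have : IsTopologicalGroup G := topologicalGroup_of_lieGroup 𝓘(ℝ, E) ∞
  obtain ⟨B, hB⟩ := hC.exists_bound_of_continuousOn
    ((continuous_expDet (G := G) (E := E)).inv₀ fun X => (expDet_pos X).ne').continuousOn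
  have h1 : ∫⁻ X, ‖ψ (a * lieExp G X)‖ₑ ^ 2 ∂haarExp μ O ≠ ⊤ := by
    rw [(hO.measurePreserving_mul_exp a).lintegral_comp (hψm.enorm.pow_const 2)]
    exact ((memLp_two_iff_lintegral hψ.1).1 hψ).ne
  have hF : Measurable fun X : E => ‖ψ (a * lieExp G X)‖ₑ ^ 2 :=
    (hψm.comp (hO.continuous_exp.measurable.const_mul a)).enorm.pow_const 2
  rw [hO.lintegral_haarExp μ hF] at h1
  refine ne_top_of_le_ne_top (ENNReal.mul_ne_top (ENNReal.ofReal_ne_top (r := B)) h1) ?_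
  rw [← lintegral_const_mul' _ _ ENNReal.ofReal_ne_top,
    ← lintegral_indicator hO.isOpen.measurableSet]
  refine lintegral_mono fun X => ?_
  by_cases hX : X ∈ O ∩ C
  · have he := expDet_pos (G := G) X
    have hB' : (expDet G X)⁻¹ ≤ B := (le_abs_self _).trans (hB X hX.2)
    rw [amplitude, indicator_of_mem hX, indicator_of_mem hX.1, ← mul_assoc, enorm_mul, mul_pow,
      ← ofReal_norm, Complex.norm_real, Real.norm_of_nonneg (by positivity),
      ← ENNReal.ofReal_pow (by positivity),
      ← ENNReal.ofReal_mul ((inv_nonneg.2 he.le).trans hB'), div_pow,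
      Real.sq_sqrt (lambdaDet_nonneg X), expDensity_eq]
    refine mul_le_mul_left (ENNReal.ofReal_le_ofReal ?_) _
    rw [pow_two, ← div_div, div_eq_inv_mul]
    exact mul_le_mul_of_nonneg_right hB' (div_nonneg (lambdaDet_nonneg X) he.le)
  · rw [amplitude, indicator_of_notMem hX]
    simp

theorem integrable_amplitude [μ.IsHaarMeasure] {C : Set E} (hC : IsCompact C) {ψ : G → ℂ}
    (hψm : Measurable ψ) (hψ : MemLp ψ 2 μ) (a : G) :
    Integrable (amplitude (O ∩ C) ψ a) (algMeasure E μ) := by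
  have := hO.isAddHaarMeasure_algMeasure μ
  have hm := (hO.measurable_amplitude hC.measurableSet hψm a).aestronglyMeasurable
    (μ := algMeasure E μ)
  refine (((memLp_two_iff_lintegral hm).2 (hO.lintegral_amplitude_sq hC hψm hψ a).lt_top
    ).integrable_mul (memLp_indicator_const 2 hC.measurableSet (1 : ℂ)
      (Or.inr hC.measure_lt_top.ne))).congr (Eventually.of_forall fun X => ?_)
  by_cases hX : X ∈ C
  · simp [hX]
  · simp [amplitude, hX]

theorem expDensity_mul_integrand [μ.IsHaarMeasure] (hf : HasIntegralKernel ħ O μ f k) {C : Set E}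
    {a : G} (hC : ∀ X ∈ O, ∀ Y ∈ O, midpointKernel k a (X, Y) ≠ 0 → X ∈ C ∧ Y ∈ C) (ψ : G → ℂ)
    (p : StrongDual ℝ E) {w : E} (hw : w ∈ O) :
    (expDensity G w : ℂ) * (f (a * lieExp G w, p) * (quantizerWeight G ħ O p (-w) *
      ψ (a * lieExp G ((2 : ℝ) • w)))) =
    ((1 / |Real.pi * ħ| ^ Module.finrank ℝ E : ℝ) : ℂ) *
      (amplitude (O ∩ C) ψ a ((2 : ℝ) • w) * momentumTransform ħ (algMeasure E μ)
        (fun Y => sqrtLambdaDet G (O ∩ C) Y * midpointKernel k a ((2 : ℝ) • w, Y)) p *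
        Complex.exp ((Complex.I / ħ) * (p ((2 : ℝ) • w) : ℂ))) := by
  by_cases h2 : (2 : ℝ) • w ∈ O
  swap
  · rw [hO.quantizerWeight_eq_zero ħ p h2, amplitude, indicator_of_notMem fun h => h2 h.1]
    ring
  have he := (expDet_pos (G := G) w).ne'
  have hw2 : (1 / 2 : ℝ) • (2 : ℝ) • w = w := by
    rw [smul_smul]
    norm_num
  have hf1 : f (a * lieExp G w, p) = momentumTransform ħ (algMeasure E μ)
      (fun Y => sqrtLambdaDet G (O ∩ C) Y * midpointKernel k a ((2 : ℝ) • w, Y)) p := by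
    rw [← hO.symbolTransform_midpoint hC h2, hw2]
    exact hO.symbol_eq_integral hf _ p
  have h3 : (expDensity G w : ℂ) * quantizerWeight G ħ O p (-w) =
      ((1 / |Real.pi * ħ| ^ Module.finrank ℝ E : ℝ) : ℂ) *
      ((√(lambdaDet G ((2 : ℝ) • w)) / expDet G ((2 : ℝ) • w) : ℝ) : ℂ) *
        Complex.exp ((Complex.I / ħ) * (p ((2 : ℝ) • w) : ℂ)) := by
    -- The weight sits at `-w` while the density sits at `w`; the ratio of densities `e(w)²` equals
    -- `expDet (2w)`, the denominator of the amplitude.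
    have h4 := hO.expDensity_mul_quantizerWeight (ħ := ħ) p (hO.neg_mem hw)
    have h5 : expDensity G (-w) = expDensity G w * expDet G w ^ 2 := by
      rw [expDensity_eq, expDensity_eq, lambdaDet_neg, expDet_neg]
      field_simp
    rw [smul_neg, indicator_of_mem (hO.neg_mem h2), lambdaDet_neg, h5, map_neg] at h4
    have he' : (expDet G w : ℂ) ≠ 0 := Complex.ofReal_ne_zero.2 he
    rw [expDet_two_smul]
    push_cast at h4 ⊢
    rw [mul_neg, neg_mul, neg_neg] at h4
    rw [mul_div_assoc', div_mul_eq_mul_div, eq_div_iff (pow_ne_zero 2 he'), ← h4]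
    ring
  by_cases hC2 : (2 : ℝ) • w ∈ C
  · rw [amplitude, indicator_of_mem (show (2 : ℝ) • w ∈ O ∩ C from ⟨h2, hC2⟩), ← hf1]
    calc _ = ((expDensity G w : ℂ) * quantizerWeight G ħ O p (-w)) * (f (a * lieExp G w, p) *
          ψ (a * lieExp G ((2 : ℝ) • w))) := by ring
      _ = _ := by
        rw [h3]
        ring
  · have h0 : (fun Y => sqrtLambdaDet G (O ∩ C) Y * midpointKernel k a ((2 : ℝ) • w, Y)) =
        fun _ => 0 := by
      funext Y
      by_cases hY : Y ∈ O
      · have : midpointKernel k a ((2 : ℝ) • w, Y) = 0 := by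
          by_contra h
          exact hC2 (hC _ h2 Y hY h).1
        rw [this, mul_zero]
      · rw [sqrtLambdaDet, indicator_of_notMem fun h => hY h.1, zero_mul]
    rw [hf1, h0, amplitude, indicator_of_notMem fun h => hC2 h.2]
    simp [momentumTransform]

/-- On the diagonal the weights combine to `(√λ/e) · √λ = λ/e`, the Haar density, and the kernel
becomes `k(a, a exp X)`. -/
theorem integral_amplitude_diag [μ.IsHaarMeasure] (hk : Continuous k) {C : Set E} {a : G}
    (hC : ∀ X ∈ O, ∀ Y ∈ O, midpointKernel k a (X, Y) ≠ 0 → X ∈ C ∧ Y ∈ C) {ψ : G → ℂ}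
    (hψ : Measurable ψ) :
    ∫ X, amplitude (O ∩ C) ψ a X * sqrtLambdaDet G (O ∩ C) X * midpointKernel k a (X, X)
      ∂algMeasure E μ = kernelApply μ k ψ a := by
  have : IsTopologicalGroup G := topologicalGroup_of_lieGroup 𝓘(ℝ, E) ∞
  have hexp := hO.continuous_exp (G := G)
  have hm : StronglyMeasurable fun X : E => k (a, a * lieExp G X) * ψ (a * lieExp G X) :=
    ((hk.comp (by fun_prop)).measurable.mul
      (hψ.comp (hexp.measurable.const_mul a))).stronglyMeasurable
  have h1 : kernelApply μ k ψ a = ∫ b, k (a, a * lieExp G (V O a b)) *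
      ψ (a * lieExp G (V O a b)) ∂μ := by
    refine integral_congr_ae ?_
    filter_upwards [hO.ae_inv_mul_mem_image a] with b hb
    rw [hO.lieExp_V hb]
  rw [h1, hO.integral_comp_V a hm, ← integral_indicator hO.isOpen.measurableSet]
  refine integral_congr_ae (Eventually.of_forall fun X => ?_)
  by_cases hX : X ∈ O
  · beta_reduce
    rw [indicator_of_mem hX]
    by_cases hXC : X ∈ C
    · have h2 : X ∈ O ∩ C := ⟨hX, hXC⟩
      rw [amplitude, sqrtLambdaDet, indicator_of_mem h2, indicator_of_mem h2,
        hO.midpointKernel_diag, expDensity_eq]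
      have h3 : (√(lambdaDet G X) : ℂ) * √(lambdaDet G X) = lambdaDet G X := by
        rw [← Complex.ofReal_mul, Real.mul_self_sqrt (lambdaDet_nonneg X)]
      push_cast
      rw [← h3]
      ring
    · have h4 : midpointKernel k a (X, X) = 0 := by
        by_contra h
        exact hXC (hC X hX X hX h).1
      rw [h4, ← hO.midpointKernel_diag k a X, h4]
      simp
  · simp [amplitude, hX]

end IsWeaklyExponential

end ImproperIntegral


/-! ### Integrability on `G × K_j` and passage to the limit. -/

section ImproperIntegral

variable {E : Type*} [NormedAddCommGroup E] [InnerProductSpace ℝ E] [FiniteDimensional ℝ E]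
  [MeasurableSpace E] [BorelSpace E]
  {G : Type*} [TopologicalSpace G] [T2Space G] [SecondCountableTopology G] [ChartedSpace E G]
  [Group G] [LieGroup 𝓘(ℝ, E) ∞ G] [MeasurableSpace G] [BorelSpace G] {O : Set E}
  {μ : Measure G} {k : G × G → ℂ} {f : G × StrongDual ℝ E → ℂ} {ħ : ℝ}

/-- The function `(q, p) ↦ f(q, p) Δ_{(q, p)} ψ(a)` at `q = a exp(w)`. -/
def expIntegrand (ħ : ℝ) (O : Set E) (f : G × StrongDual ℝ E → ℂ) (ψ : G → ℂ) (a : G)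
    (z : E × StrongDual ℝ E) : ℂ :=
  f (a * lieExp G z.1, z.2) * (quantizerWeight G ħ O z.2 (-z.1) *
    ψ (a * lieExp G ((2 : ℝ) • z.1)))

namespace IsWeaklyExponential

variable (hO : IsWeaklyExponential G O)

include hO

theorem isAddHaarMeasure_dualMeasure (μ : Measure G) [μ.IsHaarMeasure] :
    (dualMeasure E μ).IsAddHaarMeasure := by
  have h := hO.haarDensity_spec μ
  have h1 : ((volume : Measure E).map (InnerProductSpace.toDual ℝ E)).IsAddHaarMeasure :=
    (InnerProductSpace.toDual ℝ E).toContinuousLinearEquiv.isAddHaarMeasure_map volume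
  exact Measure.IsAddHaarMeasure.smul _ (ENNReal.inv_ne_zero.2 h.2.1) (ENNReal.inv_ne_top.2 h.1)

theorem measurable_expIntegrand [μ.IsHaarMeasure] (hf : HasIntegralKernel ħ O μ f k) {ψ : G → ℂ}
    (hψ : Measurable ψ) (a : G) : Measurable (expIntegrand ħ O f ψ a) := by
  have : IsTopologicalGroup G := topologicalGroup_of_lieGroup 𝓘(ℝ, E) ∞
  have hexp := hO.continuous_exp (G := G)
  have h1 : Measurable fun z : E × StrongDual ℝ E => f (a * lieExp G z.1, z.2) := by
    refine (hO.stronglyMeasurable_symbol hf).measurable.comp (Measurable.prodMk ?_ measurable_snd)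
    exact (hexp.measurable.const_mul a).comp measurable_fst
  have h2 : Measurable fun z : E × StrongDual ℝ E => ψ (a * lieExp G ((2 : ℝ) • z.1)) :=
    (hψ.comp ((hexp.comp (continuous_const_smul (2 : ℝ))).measurable.const_mul a)).comp
      measurable_fst
  have h3 : Continuous fun z : E × StrongDual ℝ E =>
      Complex.exp (-(2 * Complex.I / ħ) * (z.2 (-z.1) : ℂ)) := by
    have : Continuous fun z : E × StrongDual ℝ E => z.2 (-z.1) := by fun_prop
    fun_prop
  have h4 := (hO.measurable_jExp (G := G)).mul
    ((continuous_expDet (G := G)).measurable.pow_const 2)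
  have h5 : Measurable fun z : E × StrongDual ℝ E =>
      (√(jExp G O (-z.1) * expDet G (-z.1) ^ 2) : ℂ) :=
    (Complex.measurable_ofReal.comp h4.sqrt).comp measurable_fst.neg
  exact h1.mul (((measurable_const.mul h5).mul h3.measurable).mul h2)

theorem integrable_expIntegrand [μ.IsHaarMeasure] (hf : HasIntegralKernel ħ O μ f k) {ψ : G → ℂ}
    (hψm : Measurable ψ) (hψ : MemLp ψ 2 μ) (a : G) (ρ : Measure (StrongDual ℝ E))
    [IsFiniteMeasure ρ] : Integrable (expIntegrand ħ O f ψ a) ((haarExp μ O).prod ρ) := by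
  have := hO.isAddHaarMeasure_algMeasure μ
  obtain ⟨C, hC, hkC⟩ := hO.exists_compact_midpoint hf.2.1 a
  obtain ⟨M, hM⟩ := hO.exists_bound_symbol hf
  set c : ℝ := 1 / |Real.pi * ħ| ^ Module.finrank ℝ E
  have hc : 0 ≤ c := by positivity
  have hfin : SigmaFinite (haarExp μ O) := by
    rw [haarExp_eq]
    infer_instance
  -- A majorant independent of `p`, available because `f` is bounded by `M`. The inverse density
  -- cancels against the density of `haarExp`, leaving the integrable amplitude.
  let g : E → ℝ := fun w => (expDensity G w)⁻¹ * (c * (‖amplitude (O ∩ C) ψ a ((2 : ℝ) • w)‖ * M))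
  have hg : Integrable g (haarExp μ O) := by
    rw [haarExp_eq, integrable_withDensity_iff_integrable_smul' measurable_ofReal_expDensity
      (by simp)]
    have h1 : Integrable (fun w => c * (‖amplitude (O ∩ C) ψ a ((2 : ℝ) • w)‖ * M))
        (algMeasure E μ) :=
      ((((hO.integrable_amplitude hC hψm hψ a).comp_smul (two_ne_zero' ℝ)).norm).mul_const
        M).const_mul c
    refine (h1.restrict (s := O)).congr ?_
    filter_upwards [ae_restrict_mem hO.isOpen.measurableSet] with w hw
    have h2 := (hO.expDensity_pos (G := G) hw).ne'
    rw [ENNReal.toReal_ofReal (expDensity_nonneg w), smul_eq_mul, mul_inv_cancel_left₀ h2]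
  refine (hg.comp_fst ρ).mono' (hO.measurable_expIntegrand hf hψm a).aestronglyMeasurable ?_
  filter_upwards [Measure.quasiMeasurePreserving_fst.ae (hO.ae_haarExp_mem (μ := μ))] with z hz
  have h2 := hO.expDensity_pos (G := G) hz
  have h3 := congrArg norm (hO.expDensity_mul_integrand hf hkC ψ z.2 hz)
  rw [norm_mul, Complex.norm_real, Real.norm_of_nonneg h2.le] at h3
  change ‖expIntegrand ħ O f ψ a z‖ ≤ (expDensity G z.1)⁻¹ * _
  rw [← div_eq_inv_mul, le_div_iff₀' h2]
  refine h3.le.trans ?_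
  have h4 := norm_exp_phase (-1) (z.2 ((2 : ℝ) • z.1)) ħ
  have h5 : -(((-1 : ℝ) : ℂ) * Complex.I / ħ) = Complex.I / ħ := by
    push_cast
    ring
  rw [h5] at h4
  rw [norm_mul, norm_mul, norm_mul, h4, mul_one, Complex.norm_real, Real.norm_of_nonneg hc]
  refine mul_le_mul_of_nonneg_left ?_ hc
  by_cases h6 : (2 : ℝ) • z.1 ∈ O
  · refine mul_le_mul_of_nonneg_left ?_ (norm_nonneg _)
    rw [← hO.symbolTransform_midpoint hkC h6]
    exact (congrArg norm (hO.symbol_eq_integral hf _ z.2)).symm.le.trans (hM _)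
  · rw [amplitude, indicator_of_notMem fun h => h6 h.1]
    simp

theorem integral_expIntegrand [μ.IsHaarMeasure] (hf : HasIntegralKernel ħ O μ f k) {C : Set E}
    {a : G} (hC : ∀ X ∈ O, ∀ Y ∈ O, midpointKernel k a (X, Y) ≠ 0 → X ∈ C ∧ Y ∈ C) {ψ : G → ℂ}
    (hψ : Measurable ψ) (p : StrongDual ℝ E) :
    ∫ q, expIntegrand ħ O f ψ a (V O a q, p) ∂μ =
      ((1 / |2 * Real.pi * ħ| ^ Module.finrank ℝ E : ℝ) : ℂ) *
        ∫ X, amplitude (O ∩ C) ψ a X * momentumTransform ħ (algMeasure E μ)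
          (fun Y => sqrtLambdaDet G (O ∩ C) Y * midpointKernel k a (X, Y)) p *
          Complex.exp ((Complex.I / ħ) * (p X : ℂ)) ∂algMeasure E μ := by
  have := hO.isAddHaarMeasure_algMeasure μ
  have hm : StronglyMeasurable fun w => expIntegrand ħ O f ψ a (w, p) :=
    ((hO.measurable_expIntegrand hf hψ a).comp measurable_prodMk_right).stronglyMeasurable
  set Q : E → ℂ := fun X => amplitude (O ∩ C) ψ a X * momentumTransform ħ (algMeasure E μ)
    (fun Y => sqrtLambdaDet G (O ∩ C) Y * midpointKernel k a (X, Y)) p *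
    Complex.exp ((Complex.I / ħ) * (p X : ℂ))
  rw [hO.integral_comp_V a hm, ← integral_indicator hO.isOpen.measurableSet]
  have h1 : (O.indicator fun w => (expDensity G w : ℂ) * expIntegrand ħ O f ψ a (w, p)) =
      fun w => ((1 / |Real.pi * ħ| ^ Module.finrank ℝ E : ℝ) : ℂ) * Q ((2 : ℝ) • w) := by
    funext w
    by_cases hw : w ∈ O
    · rw [indicator_of_mem hw]
      exact hO.expDensity_mul_integrand hf hC ψ p hw
    · rw [indicator_of_notMem hw]
      have h2 : (2 : ℝ) • w ∉ O := fun h => by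
        have := hO.half_mem h
        rw [smul_smul] at this
        norm_num at this
        exact hw this
      simp only [Q]
      rw [amplitude, indicator_of_notMem fun h => h2 h.1]
      simp
  rw [h1, integral_const_mul, Measure.integral_comp_smul, Complex.real_smul, ← mul_assoc]
  congr 1
  rw [← Complex.ofReal_mul]
  congr 1
  -- The substitution `X = 2w` contributes `2⁻ⁿ`, which joins `|πħ|⁻ⁿ` to give `|2πħ|⁻ⁿ`.
  rw [abs_of_nonneg (by positivity : (0 : ℝ) ≤ ((2 : ℝ) ^ Module.finrank ℝ E)⁻¹), mul_assoc 2,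
    abs_mul 2, mul_pow, abs_two, one_div, one_div, mul_inv, mul_comm]

/-- `f̂ ψ(a) = ∫ f(x) Δ_x ψ(a) dx` as an improper integral. -/
theorem tendsto_setIntegral_quantizerFun [μ.IsHaarMeasure] (hħ : ħ ≠ 0)
    (hf : HasIntegralKernel ħ O μ f k) {ψ : G → ℂ} (hψ : MemLp ψ 2 μ) (a : G)
    {K : ℕ → Set (StrongDual ℝ E)} (hK : ∀ j, IsCompact (K j)) (hKm : Monotone K)
    (hKu : ⋃ j, K j = univ) :
    (∀ j, IntegrableOn (fun x => f x * quantizerFun ħ O x ψ a) (univ ×ˢ K j) (liouville E μ)) ∧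
      Tendsto (fun j => ∫ x in univ ×ˢ K j, f x * quantizerFun ħ O x ψ a ∂liouville E μ)
        atTop (𝓝 (kernelApply μ k ψ a)) := by
  have : IsTopologicalGroup G := topologicalGroup_of_lieGroup 𝓘(ℝ, E) ∞
  have : ProperSpace E := FiniteDimensional.proper_real E
  have : LocallyCompactSpace G := ChartedSpace.locallyCompactSpace E G
  have := hO.isAddHaarMeasure_algMeasure μ
  have := hO.isAddHaarMeasure_dualMeasure μ
  have hd := hO.haarDensity_spec μ
  -- The statement concerns every point `a`, while `ψ` is measurable only up to a null set. A Borel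
  -- representative is admissible by `ae_quantizerFun_congr`.
  obtain ⟨χ, hχm, hχ⟩ : ∃ χ, Measurable χ ∧ ψ =ᵐ[μ] χ :=
    ⟨_, hψ.1.stronglyMeasurable_mk.measurable, hψ.1.ae_eq_mk⟩
  have hχ2 : MemLp χ 2 μ := hψ.ae_eq hχ
  have hfin : SigmaFinite (haarExp μ O) := by
    rw [haarExp_eq]
    infer_instance
  have hρ : ∀ j, IsFiniteMeasure ((dualMeasure E μ).restrict (K j)) := fun j =>
    ⟨by rw [Measure.restrict_apply_univ]; exact (hK j).measure_lt_top⟩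
  have hres : ∀ j, (liouville E μ).restrict (univ ×ˢ K j) =
      μ.prod ((dualMeasure E μ).restrict (K j)) := fun j => by
    rw [liouville, ← Measure.prod_restrict, Measure.restrict_univ]
  have hae : ∀ j, (fun x => f x * quantizerFun ħ O x ψ a)
      =ᵐ[μ.prod ((dualMeasure E μ).restrict (K j))]
      fun x => expIntegrand ħ O f χ a (V O a x.1, x.2) := fun j => by
    filter_upwards [Measure.quasiMeasurePreserving_fst.ae (hO.ae_quantizerFun_congr ħ a hχ),
      Measure.quasiMeasurePreserving_fst.ae (hO.ae_inv_mul_mem_image (μ := μ) a)] with x h1 h2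
    rw [expIntegrand, hO.lieExp_V h2, ← hO.quantizerFun_eq_of_coord ħ x.2 χ h2, ← h1 x.2]
  have hint : ∀ j, Integrable (fun x : G × StrongDual ℝ E =>
      expIntegrand ħ O f χ a (V O a x.1, x.2)) (μ.prod ((dualMeasure E μ).restrict (K j))) :=
    fun j => ((hO.measurePreserving_V (μ := μ) a).prod (MeasurePreserving.id _)).integrable_comp
      (hO.measurable_expIntegrand hf hχm a).aestronglyMeasurable |>.2
        (hO.integrable_expIntegrand hf hχm hχ2 a _)
  refine ⟨fun j => ?_, ?_⟩
  · rw [IntegrableOn, hres]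
    exact (hint j).congr (hae j).symm
  obtain ⟨C, hC, hkC⟩ := hO.exists_compact_midpoint hf.2.1 a
  have hmain := integral_kernel_momentum hħ hd.1 hd.2.1 hC (hO.contDiff_midpointKernel hf.1 a)
    (hO.measurable_amplitude hC.measurableSet hχm a)
    (hO.measurable_sqrtLambdaDet hC.measurableSet)
    (fun X hX => indicator_of_notMem (fun h => hX h.2) _)
    (fun X hX => indicator_of_notMem (fun h => hX h.2) _)
    (hO.lintegral_amplitude_sq hC hχm hχ2 a) (hO.lintegral_sqrtLambdaDet_sq hC)
  have h1 : ∀ j, ∫ x in univ ×ˢ K j, f x * quantizerFun ħ O x ψ a ∂liouville E μ =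
      ((1 / |2 * Real.pi * ħ| ^ Module.finrank ℝ E : ℝ) : ℂ) * ∫ p in K j,
        ∫ X, amplitude (O ∩ C) χ a X * momentumTransform ħ (algMeasure E μ)
          (fun Y => sqrtLambdaDet G (O ∩ C) Y * midpointKernel k a (X, Y)) p *
          Complex.exp ((Complex.I / ħ) * (p X : ℂ)) ∂algMeasure E μ ∂dualMeasure E μ :=
    fun j => by
      rw [hres, integral_congr_ae (hae j), integral_prod_symm _ (hint j), ← integral_const_mul]
      exact integral_congr_ae (Eventually.of_forall fun p =>
        hO.integral_expIntegrand hf hkC hχm p)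
  have h2 : kernelApply μ k ψ a = kernelApply μ k χ a := by
    refine integral_congr_ae ?_
    filter_upwards [hχ] with b hb
    rw [hb]
  have h3 : kernelApply μ k ψ a = ((1 / |2 * Real.pi * ħ| ^ Module.finrank ℝ E : ℝ) : ℂ) *
      ∫ p in ⋃ j, K j, ∫ X, amplitude (O ∩ C) χ a X * momentumTransform ħ (algMeasure E μ)
          (fun Y => sqrtLambdaDet G (O ∩ C) Y * midpointKernel k a (X, Y)) p *
          Complex.exp ((Complex.I / ħ) * (p X : ℂ)) ∂algMeasure E μ ∂dualMeasure E μ := by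
    have hne : (|2 * Real.pi * ħ| ^ Module.finrank ℝ E : ℝ) ≠ 0 :=
      pow_ne_zero _ (abs_ne_zero.2 (mul_ne_zero (mul_ne_zero two_ne_zero Real.pi_ne_zero) hħ))
    rw [hKu, Measure.restrict_univ, h2, ← hO.integral_amplitude_diag hf.1.continuous hkC hχm]
    refine Eq.trans ?_ (congrArg _ hmain.2.symm)
    rw [← mul_assoc, ← Complex.ofReal_mul, one_div_mul_cancel hne, Complex.ofReal_one, one_mul]
    rfl
  simp only [h1, h3]
  -- Once `q` has been integrated out, the function of `p` is integrable over the whole dual, so any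
  -- increasing exhaustion gives the same limit.
  exact (tendsto_setIntegral_of_monotone (fun j => (hK j).measurableSet) hKm
    hmain.1.integrableOn).const_mul _

end IsWeaklyExponential

end ImproperIntegral

end LieGroupQ

end

theorem mainTheorem11 (E : Type*) [NormedAddCommGroup E] [InnerProductSpace ℝ E]
    [FiniteDimensional ℝ E] [MeasurableSpace E] [BorelSpace E] (G : Type*) [TopologicalSpace G] [T2Space G]
    [SecondCountableTopology G] [ChartedSpace E G] [Group G]
    [LieGroup 𝓘(ℝ, E) ∞ G] [MeasurableSpace G] [BorelSpace G]
    (μ : Measure G) [μ.IsHaarMeasure]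
    (O : Set E) (hO : LieGroupQ.IsWeaklyExponential G O) (ħ : ℝ) (hħ : ħ ≠ 0) :
    (∀ (f : G × StrongDual ℝ E → ℂ) (k : G × G → ℂ), LieGroupQ.HasIntegralKernel ħ O μ f k →
      ∃ fhat : Lp ℂ 2 μ →L[ℂ] Lp ℂ 2 μ,
        (∀ ψ : Lp ℂ 2 μ, fhat ψ =ᵐ[μ] LieGroupQ.kernelApply μ k ψ) ∧
        (∀ ψ : G → ℂ, MemLp ψ 2 μ → ∀ a : G,
          ∀ K : ℕ → Set (StrongDual ℝ E), (∀ j, IsCompact (K j)) → Monotone K →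
            ⋃ j, K j = univ →
            (∀ j, IntegrableOn (fun x => f x * LieGroupQ.quantizerFun ħ O x ψ a)
              (univ ×ˢ K j) (LieGroupQ.liouville E μ)) ∧
            Tendsto (fun j => ∫ x in univ ×ˢ K j,
                f x * LieGroupQ.quantizerFun ħ O x ψ a ∂(LieGroupQ.liouville E μ))
              atTop (𝓝 (LieGroupQ.kernelApply μ k ψ a))) ∧
        (∀ x : G × StrongDual ℝ E, ∃ (T : Lp ℂ 2 μ →L[ℂ] Lp ℂ 2 μ) (t : ℂ),
          (∀ ψ : Lp ℂ 2 μ, ∃ h : fhat ψ ∈ (LieGroupQ.quantizer ħ O μ x).domain,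
            T ψ = LieGroupQ.quantizer ħ O μ x ⟨fhat ψ, h⟩) ∧
          LieGroupQ.HasTrace T t ∧ f x = ((|2 * Real.pi * ħ| ^ Module.finrank ℝ E : ℝ) : ℂ) * t)) ∧
    (∀ x : G × StrongDual ℝ E,
      (∀ ψ : Lp ℂ 2 μ, ψ ∈ (LieGroupQ.quantizer ħ O μ x).domain ↔
        ∫⁻ a, ENNReal.ofReal (LieGroupQ.jFun O x.1 a) * ‖ψ a‖ₑ ^ 2 ∂μ < ⊤) ∧
      Dense ((LieGroupQ.quantizer ħ O μ x).domain : Set (Lp ℂ 2 μ)) ∧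
      IsSelfAdjoint (LieGroupQ.quantizer ħ O μ x)) := by
  refine ⟨fun f k hf => ?_, hO.quantizer_spec hħ⟩
  obtain ⟨fhat, h1, h2⟩ := hO.exists_operator_of_symbol hħ hf
  exact ⟨fhat, h1, fun ψ hψ a _ hK hKm hKu =>
    hO.tendsto_setIntegral_quantizerFun hħ hf hψ a hK hKm hKu, h2⟩
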